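/- Let $q$ be a power of a prime $p$. Number the $36$ positive roots $\alpha_1,\dots,\alpha_{36}$ of the root system of type $\mathrm E_6$ by height and, within each height, in decreasing lexicographic order of the coefficient vectors with respect to the simple roots $\alpha_1,\dots,\alpha_6$ (Bourbaki labelling: the Dynkin diagram is the chain $1,3,4,5,6$ with $2$ joined to $4$). Let $U=\mathrm{UE}_6(q)$ be the group generated by elements $x_i(t)=x_{\alpha_i}(t)$ ($1\le i\le 36$, $t\in\mathbb F_q$) subject to the Chevalley relations $x_i(s)x_i(t)=x_i(s+t)$ and, with $[x,y]=x^{-1}y^{-1}xy$, $[x_i(s),x_j(r)]=x_k(N_{ij}sr)$ if $\alpha_i+\alpha_j=\alpha_k$ is a root and $[x_i(s),x_j(r)]=1$ if $\alpha_i+\alpha_j$ is not a root; here $N_{ij}=\pm1$ are the structure constants of the Lie algebra of type $\mathrm E_6$, with signs such that $N_{\alpha_m,\gamma-\alpha_m}=1$ whenever $\gamma$ is a nonsimple positive root and $m$ is the least index for which $\gamma-\alpha_m$ is a root. This is a Sylow $p$-subgroup of $\mathrm E_6(q)$. The $[5,20,25]$-core of $\mathrm{UE}_6(q)$ is given by $$\mathcal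 S=\{\alpha_1,\alpha_2,\alpha_3,\alpha_5,\alpha_6,\dots,\alpha_{18},\alpha_{20},\alpha_{21},\alpha_{24}\},\qquad \mathcal Z=\{\alpha_{17},\alpha_{18},\alpha_{20},\alpha_{21},\alpha_{24}\}.$$ Put $\mathcal P=\Phi^+\setminus\{\alpha_4\}$ and $\mathcal K=\mathcal P\setminus\mathcal S$, let $X_{\mathcal P}$ and $X_{\mathcal K}$ be the subgroups of $U$ generated by the $x_i(t)$ with $\alpha_i\in\mathcal P$, respectively $\alpha_i\in\mathcal K$, and let $X_{\mathcal S}=X_{\mathcal P}/X_{\mathcal K}$. We also write $x_i(t)$ for the image of $x_i(t)$ in $X_{\mathcal S}$. Let $\operatorname{Irr}(X_{\mathcal S})_{\mathcal Z}$ be the set of irreducible complex characters of $X_{\mathcal S}$ whose kernel contains none of the root subgroups $X_\alpha=\{x_\alpha(t)\mid t\in\mathbb F_q\}$, $\alpha\in\mathcal Z$. Let $\phi(t)=e^{2\pi i\operatorname{Tr}(t)/p}$ for $t\in\mathbb F_q$, with $\operatorname{Tr}:\mathbb F_q\to\mathbb F_p$ the trace. For $\underline a=(a_{17},a_{18},a_{20},a_{21},a_{24})\in(\mathbb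 F_q^\times)^5$ and $t\in\mathbb F_q$ put $$x_{2,3,5}(t)=x_2(a_{18}a_{21}t)\,x_3(-a_{18}a_{20}t)\,x_5(a_{17}a_{21}t),$$ $$x_{7,11,13,14,15}(t)=x_7(a_{20}a_{24}t)\,x_{11}(-a_{17}a_{24}t)\,x_{13}(-a_{18}a_{20}t)\,x_{14}(-a_{17}a_{21}t)\,x_{15}(a_{17}a_{20}t),$$ $$x_{1,6,8,9,10,12,16}(t)=x_1(a_{21}a_{24}t)\,x_6(-a_{18}a_{24}t)\,x_8(-a_{18}a_{21}t)\,x_9(a_{18}a_{20}t)\,x_{10}(a_{17}a_{21}t)\,x_{12}(a_{18}a_{20}a_{21}a_{24}t^2)\,x_{16}(a_{17}a_{18}a_{21}a_{24}t^2).$$ Each character below is induced from the linear character $\psi$, which exists and is unique, of the subgroup generated by the listed elements (for all $t\in\mathbb F_q$) that has the listed values; in all cases the list includes $\psi(x_i(t))=\phi(a_it)$ for $i\in\{17,18,20,21,24\}$. * If $p\ne3$, then $\operatorname{Irr}(X_{\mathcal S})_{\mathcal Z}=\mathcal F_8^{p\neq 3}$ consists of $q(q-1)^5$ characters, all of degree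 $q^7$. They are parametrized bijectively as $\chi^{\underline a}_{b}$ by $\underline a\in(\mathbb F_q^\times)^5$ and $b\in\mathbb F_q$, where $\chi^{\underline a}_b$ is induced from $\psi$ with $\psi(x_{2,3,5}(t))=\phi(bt)$ and $\psi(x_i(t))=1$ for $i\in\{7,11,12,13,14,15,16\}$. * If $p=3$, then $\operatorname{Irr}(X_{\mathcal S})_{\mathcal Z}$ is the disjoint union $\mathcal F_8^{1,p=3}\sqcup\mathcal F_8^{2,p=3}$, where: * $\mathcal F_8^{1,p=3}$ consists of $(q-1)^6$ characters, all of degree $q^7$. They are parametrized bijectively by $\underline a\in(\mathbb F_q^\times)^5$ and $c\in\mathbb F_q^\times$; the character with label $(\underline a,c)$ is induced from $\psi$ with $\psi(x_{7,11,13,14,15}(t))=\phi(ct)$ and $\psi(x_i(t))=1$ for $i\in\{2,3,5,11,13,14,15\}$. * $\mathcal F_8^{2,p=3}$ consists of $q^2(q-1)^5$ characters, all of degree $q^6$. They are parametrized bijectively by $\underline a\in(\mathbb F_q^\times)^5$ and $(b,b')\in\mathbb F_q^2$; the character with label $(\underline a,b,b')$ is induced from $\psi$ with $\psi(x_{1,6,8,9,10,12,16}(t))=\phi(bt)$,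 $\psi(x_{2,3,5}(t))=\phi(b't)$ and $\psi(x_i(t))=1$ for $i\in\{2,3,7,11,13,14,15\}$. -/

import Mathlib

noncomputable section

namespace UE6

/-- The 36 positive roots `α_1, …, α_36` of the root system of type `E_6`, as coefficient vectors
with respect to the simple roots `α_1, …, α_6` (Bourbaki labelling: the Dynkin diagram is the chain
`1 - 3 - 4 - 5 - 6`, with `2` joined to `4`).  They are ordered by height, and in each height in
decreasing lexicographic order of the coefficient vectors (the ordering of GAP and MAGMA). -/
def rootVec : Fin 36 → Fin 6 → ℕ :=
  ![![1,0,0,0,0,0], ![0,1,0,0,0,0], ![0,0,1,0,0,0], ![0,0,0,1,0,0], ![0,0,0,0,1,0],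
    ![0,0,0,0,0,1], ![1,0,1,0,0,0], ![0,1,0,1,0,0], ![0,0,1,1,0,0], ![0,0,0,1,1,0],
    ![0,0,0,0,1,1], ![1,0,1,1,0,0], ![0,1,1,1,0,0], ![0,1,0,1,1,0], ![0,0,1,1,1,0],
    ![0,0,0,1,1,1], ![1,1,1,1,0,0], ![1,0,1,1,1,0], ![0,1,1,1,1,0], ![0,1,0,1,1,1],
    ![0,0,1,1,1,1], ![1,1,1,1,1,0], ![1,0,1,1,1,1], ![0,1,1,2,1,0], ![0,1,1,1,1,1],
    ![1,1,1,2,1,0], ![1,1,1,1,1,1], ![0,1,1,2,1,1], ![1,1,2,2,1,0], ![1,1,1,2,1,1],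
    ![0,1,1,2,2,1], ![1,1,2,2,1,1], ![1,1,1,2,2,1], ![1,1,2,2,2,1], ![1,1,2,3,2,1],
    ![1,2,2,3,2,1]]

/-- For `1 ≤ n ≤ 36`, `ix n` is the (zero-based) index of the root `α_n`. -/
def ix (n : ℕ) : Fin 36 := Fin.ofNat 36 (n + 35)

/-- `IsSum i j k` says that the root with index `k` is the sum of those with indices `i`, `j`. -/
def IsSum (i j k : Fin 36) : Prop := ∀ a, rootVec i a + rootVec j a = rootVec k a

instance (i j k : Fin 36) : Decidable (IsSum i j k) := by unfold IsSum; infer_instance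

/-- A bilinear form `f` on the root lattice with `f(α, β) + f(β, α) ≡ (α, β)` modulo `2` and
`f(α, α) = (α, α) / 2`; so `(-1) ^ f(α, β)` are the usual signs `ε(α, β)` of the simply laced
Lie algebra of type `E_6`, `[E_α, E_β] = ε(α, β) E_{α + β}`. -/
def bil (v w : Fin 6 → ℕ) : ℕ :=
  v 0 * w 0 + v 1 * w 1 + v 2 * w 2 + v 3 * w 3 + v 4 * w 4 + v 5 * w 5 +
    (v 2 * w 0 + v 3 * w 2 + v 4 * w 3 + v 5 * w 4 + v 3 * w 1)

/-- The rescaling `e_α = ± E_α` of the root vectors for which the structure constants of all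
extraspecial pairs are `+1`. -/
def rescale (i : Fin 36) : ℤ :=
  if i = ix 24 ∨ i = ix 26 ∨ i = ix 28 ∨ i = ix 29 ∨ i = ix 30 ∨ i = ix 32 ∨ i = ix 35
  then -1 else 1

/-- The structure constant `N_{α, β} = ± 1` in `[e_α, e_β] = N_{α, β} e_{α + β}`, where `i`, `j`,
`k` are the indices of `α`, `β`, `α + β`.  The signs are those for which
`N_{α_m, γ - α_m} = 1` for every nonsimple positive root `γ`, where `m` is the least index such that
`γ - α_m` is a root (extraspecial pairs). -/
def structConst (i j k : Fin 36) : ℤ :=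
  (-1) ^ bil (rootVec i) (rootVec j) * rescale i * rescale j * rescale k

/-- The Chevalley relations of the positive root elements `x_α(t)` of the Chevalley group of type
`E_6` over `F`; the commutator is `[x, y] = x⁻¹ y⁻¹ x y`. -/
inductive ChevalleyRel (F : Type*) [Field F] : FreeGroup (Fin 36 × F) → Prop
  | add (i : Fin 36) (s t : F) :
      ChevalleyRel F
        (FreeGroup.of (i, s) * FreeGroup.of (i, t) * (FreeGroup.of (i, s + t))⁻¹)
  | comm_sum (i j k : Fin 36) (s r : F) (h : IsSum i j k) :
      ChevalleyRel F
        ((FreeGroup.of (i, s))⁻¹ * (FreeGroup.of (j, r))⁻¹ * FreeGroup.of (i, s) *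
          FreeGroup.of (j, r) * (FreeGroup.of (k, (structConst i j k : F) * s * r))⁻¹)
  | comm_one (i j : Fin 36) (s r : F) (h : ∀ k, ¬ IsSum i j k) :
      ChevalleyRel F
        ((FreeGroup.of (i, s))⁻¹ * (FreeGroup.of (j, r))⁻¹ * FreeGroup.of (i, s) *
          FreeGroup.of (j, r))

/-- The group `UE_6(q)`, `q = |F|`, through its presentation by the Chevalley relations. -/
abbrev U (F : Type*) [Field F] : Type _ :=
  PresentedGroup {w : FreeGroup (Fin 36 × F) | ChevalleyRel F w}

/-- The root element `x_α(t)`, for the root `α` with index `i`. -/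
def x {F : Type*} [Field F] (i : Fin 36) (t : F) : U F := PresentedGroup.of (i, t)

/-- The subgroup `X_A` of `UE_6(q)` generated by the root subgroups `X_α`, `α ∈ A`. -/
def XSub (F : Type*) [Field F] (A : Finset (Fin 36)) : Subgroup (U F) :=
  Subgroup.closure {g | ∃ i ∈ A, ∃ t : F, g = x i t}

/-- A pattern (closed set of positive roots) `P` with a normal subset `K`.  The underlying
quattern is `S = P \ K`. -/
structure Quattern where
  P : Finset (Fin 36)
  K : Finset (Fin 36)
  K_sub : K ⊆ P
  P_closed : ∀ i ∈ P, ∀ j ∈ P, ∀ k, IsSum i j k → k ∈ P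
  K_normal : ∀ i ∈ K, ∀ j ∈ P, ∀ k, IsSum i j k → k ∈ K

section Group

variable {F : Type*} [Field F]

theorem x_add (i : Fin 36) (s t : F) : x i s * x i t = x i (s + t) :=
  mul_inv_eq_one.mp (PresentedGroup.one_of_mem (ChevalleyRel.add i s t))

theorem x_zero (i : Fin 36) : x i (0 : F) = 1 := by
  have h := x_add i (0 : F) 0
  rwa [add_zero, mul_eq_left] at h

theorem x_inv (i : Fin 36) (t : F) : (x i t)⁻¹ = x i (-t) :=
  inv_eq_of_mul_eq_one_right (by rw [x_add, add_neg_cancel, x_zero])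

theorem comm_sum (i j k : Fin 36) (s r : F) (h : IsSum i j k) :
    (x i s)⁻¹ * (x j r)⁻¹ * x i s * x j r = x k ((structConst i j k : F) * s * r) :=
  mul_inv_eq_one.mp (PresentedGroup.one_of_mem (ChevalleyRel.comm_sum i j k s r h))

theorem comm_one (i j : Fin 36) (s r : F) (h : ∀ k, ¬ IsSum i j k) :
    (x i s)⁻¹ * (x j r)⁻¹ * x i s * x j r = 1 :=
  PresentedGroup.one_of_mem (ChevalleyRel.comm_one i j s r h)

theorem conj_mem (Q : Quattern) {i j : Fin 36} (hi : i ∈ Q.K) (hj : j ∈ Q.P) (s r : F) :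
    (x j r)⁻¹ * x i s * x j r ∈ XSub F Q.K := by
  have key : (x j r)⁻¹ * x i s * x j r =
      x i s * ((x i s)⁻¹ * (x j r)⁻¹ * x i s * x j r) := by group
  rw [key]
  refine mul_mem (Subgroup.subset_closure ⟨i, hi, s, rfl⟩) ?_
  by_cases h : ∃ k, IsSum i j k
  · obtain ⟨k, hk⟩ := h
    rw [comm_sum i j k s r hk]
    exact Subgroup.subset_closure ⟨k, Q.K_normal i hi j hj k hk, _, rfl⟩
  · rw [comm_one i j s r (fun k hk => h ⟨k, hk⟩)]
    exact one_mem _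

theorem conj_mem_of_mem (Q : Quattern) {j : Fin 36} (hj : j ∈ Q.P) (r : F) {n : U F}
    (hn : n ∈ XSub F Q.K) : x j r * n * (x j r)⁻¹ ∈ XSub F Q.K := by
  induction hn using Subgroup.closure_induction with
  | mem z hz =>
    obtain ⟨i, hi, s, rfl⟩ := hz
    have := conj_mem Q hi hj s (-r)
    rwa [← x_inv, inv_inv] at this
  | one => simp [one_mem]
  | mul a b _ _ h1 h2 => simpa [mul_assoc] using mul_mem h1 h2
  | inv a _ h1 => simpa [mul_assoc] using inv_mem h1

instance XSub_normal (Q : Quattern) : ((XSub F Q.K).subgroupOf (XSub F Q.P)).Normal := by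
  have hle : XSub F Q.K ≤ XSub F Q.P :=
    Subgroup.closure_mono fun g ⟨i, hi, t, ht⟩ => ⟨i, Q.K_sub hi, t, ht⟩
  rw [Subgroup.normal_subgroupOf_iff_le_normalizer hle]
  refine (Subgroup.closure_le _).mpr ?_
  rintro g ⟨j, hj, r, rfl⟩
  rw [SetLike.mem_coe, Subgroup.mem_normalizer_iff]
  intro n
  refine ⟨conj_mem_of_mem Q hj r, fun h => ?_⟩
  have := conj_mem_of_mem Q hj (-r) h
  rw [← x_inv] at this
  simpa [mul_assoc] using this

end Group

/-- The quattern group `X_S = X_P / X_K`, where `S = P \ K`. -/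
abbrev Quattern.X (Q : Quattern) (F : Type*) [Field F] : Type _ :=
  XSub F Q.P ⧸ (XSub F Q.K).subgroupOf (XSub F Q.P)

/-- The image in `X_S` of the root element `x_α(t)`, for a root `α` in `P`. -/
def Quattern.elt (Q : Quattern) {F : Type*} [Field F] (i : Fin 36) (hi : i ∈ Q.P) (t : F) :
    Q.X F :=
  QuotientGroup.mk ⟨UE6.x i t, Subgroup.subset_closure ⟨i, hi, t, rfl⟩⟩

/-- `Irr(G)`, as a set of functions on `G`: the characters of the irreducible complex
representations of `G` of finite dimension. -/
def Irr (G : Type*) [Group G] : Set (G → ℂ) :=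
  {χ | ∃ (n : ℕ) (ρ : Representation ℂ G (Fin n → ℂ)), ρ.IsIrreducible ∧ χ = ρ.character}

/-- The kernel of a character. -/
def charKer {G : Type*} [Group G] (χ : G → ℂ) : Set G := {g | χ g = χ 1}

/-- `Irr(X_S)_Z`, for a set `Z` of roots in `S`: the irreducible characters of `X_S` whose kernel
contains none of the root subgroups `X_α`, `α ∈ Z`. -/
def Quattern.IrrOver (Q : Quattern) (F : Type*) [Field F] (Z : Finset (Fin 36)) :
    Set (Q.X F → ℂ) :=
  {χ | χ ∈ Irr (Q.X F) ∧
    ∀ i ∈ Z, ∀ hi : i ∈ Q.P, ¬ (Set.range (Q.elt i hi (F := F)) ⊆ charKer χ)}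

open Classical in
/-- The character of the finite group `G` induced from a linear character `ψ` of a subgroup. -/
def indChar {G : Type*} [Group G] (M : Subgroup G) (ψ : M →* ℂ) : G → ℂ :=
  fun g => (Nat.card M : ℂ)⁻¹ * ∑ᶠ y : G, if h : y * g * y⁻¹ ∈ M then ψ ⟨y * g * y⁻¹, h⟩ else 0

/-- The additive character `φ(t) = exp(2 π i Tr(t) / p)` of a finite field of characteristic `p`. -/
def phi (p : ℕ) [Fact p.Prime] {F : Type*} [Field F] [CharP F p] (t : F) : ℂ :=
  letI := ZMod.algebra F p
  ZMod.stdAddChar (Algebra.trace (ZMod p) F t)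

/-- Given a list of pairs `(y, b)`, with `y : F → G` and `b ∈ F`, let `M` be the subgroup of `G`
generated by all elements `y(t)`.  `IsIndFrom p D χ` says that `M` has a (necessarily unique)
linear character `ψ` with `ψ(y(t)) = φ(b t)` for all pairs `(y, b)` and all `t`, and that `χ` is
induced from `ψ`. -/
def IsIndFrom (p : ℕ) [Fact p.Prime] {F : Type*} [Field F] [CharP F p] {G : Type*} [Group G]
    (D : List ((F → G) × F)) (χ : G → ℂ) : Prop :=
  ∃ ψ : Subgroup.closure {g : G | ∃ d ∈ D, ∃ t, g = d.1 t} →* ℂ,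
    (∀ (d : (F → G) × F) (hd : d ∈ D) (t : F),
      ψ ⟨d.1 t, Subgroup.subset_closure ⟨d, hd, t, rfl⟩⟩ = phi p (d.2 * t)) ∧
    χ = indChar _ ψ

/-- The set `K` of the core. -/
def coreK : Finset (Fin 36) :=
  {ix 19, ix 22, ix 23, ix 25, ix 26, ix 27, ix 28, ix 29, ix 30, ix 31, ix 32, ix 33, ix 34,
    ix 35, ix 36}

theorem eq_ix_four (i : Fin 36) (h : ∀ a, rootVec i a ≤ rootVec (ix 4) a) : i = ix 4 := by
  revert i; decide

theorem coreK_up : ∀ i ∈ coreK, ∀ k, (∀ a, rootVec i a ≤ rootVec k a) →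
    k ∈ coreK ∨ (i = ix 19 ∧ k = ix 24) := by
  decide

theorem eq_ix_four' (j : Fin 36) (h : IsSum (ix 19) j (ix 24)) : j = ix 4 := by
  revert j; decide

/-- The quattern of the `[5, 20, 25]`-core: `P` consists of all positive roots except `α_4`, and
`S = P \ K` of `α_n` for `n = 1, 2, 3, 5, …, 18, 20, 21, 24`. -/
def core : Quattern where
  P := Finset.univ.erase (ix 4)
  K := coreK
  K_sub := by decide
  P_closed := by
    intro i hi j _ k h
    refine Finset.mem_erase.mpr ⟨?_, Finset.mem_univ _⟩
    rintro rfl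
    exact (Finset.mem_erase.mp hi).1 (eq_ix_four i fun a => (Nat.le_add_right _ _).trans (h a).le)
  K_normal := by
    intro i hi j hj k h
    rcases coreK_up i hi k fun a => (Nat.le_add_right _ _).trans (h a).le with h' | ⟨rfl, rfl⟩
    · exact h'
    · exact absurd (eq_ix_four' j h) (Finset.mem_erase.mp hj).1

/-- The set `Z` of central roots of the core. -/
def coreZ : Finset (Fin 36) := {ix 17, ix 18, ix 20, ix 21, ix 24}

/-- The group `X_S` of the core. -/
abbrev XS (F : Type*) [Field F] : Type _ := core.X F

/-- The element `x_n(t)` of `X_S`, for `n ≠ 4`. -/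
def xS {F : Type*} [Field F] (n : ℕ) (t : F) (h : ix n ∈ core.P := by decide) : XS F :=
  core.elt (ix n) h t

/-- The labels `a_17, a_18, a_20, a_21, a_24` in `F^×` of a linear character of `X_Z`. -/
structure CLabel (F : Type*) [Field F] where
  a17 : Fˣ
  a18 : Fˣ
  a20 : Fˣ
  a21 : Fˣ
  a24 : Fˣ

section Families

variable {F : Type*} [Field F]

/-- `x_{2,3,5}(t)` -/
def x235 (A : CLabel F) (t : F) : XS F :=
  xS 2 (A.a18 * A.a21 * t) * xS 3 (-(A.a18 * A.a20 * t)) * xS 5 (A.a17 * A.a21 * t)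

/-- `x_{7,11,13,14,15}(t)` -/
def xJ (A : CLabel F) (t : F) : XS F :=
  xS 7 (A.a20 * A.a24 * t) * xS 11 (-(A.a17 * A.a24 * t)) * xS 13 (-(A.a18 * A.a20 * t)) *
    xS 14 (-(A.a17 * A.a21 * t)) * xS 15 (A.a17 * A.a20 * t)

/-- `x_{1,6,8,9,10,12,16}(t)` (used for `p = 3`) -/
def xI (A : CLabel F) (t : F) : XS F :=
  xS 1 (A.a21 * A.a24 * t) * xS 6 (-(A.a18 * A.a24 * t)) * xS 8 (-(A.a18 * A.a21 * t)) *
    xS 9 (A.a18 * A.a20 * t) * xS 10 (A.a17 * A.a21 * t) *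
    xS 12 (A.a18 * A.a20 * A.a21 * A.a24 * t ^ 2) * xS 16 (A.a17 * A.a18 * A.a21 * A.a24 * t ^ 2)

/-- The linear character of `X_Z` with label `A`: `x_n(t) ↦ φ(a_n t)`. -/
def dataZ (A : CLabel F) : List ((F → XS F) × F) :=
  [(fun t => xS 17 t, A.a17), (fun t => xS 18 t, A.a18), (fun t => xS 20 t, A.a20),
    (fun t => xS 21 t, A.a21), (fun t => xS 24 t, A.a24)]

/-- Data of the character with label `A`, `b = b_{2,3,5}` for `p ≠ 3`. -/
def dataNe3 (A : CLabel F) (b : F) : List ((F → XS F) × F) :=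
  [(x235 A, b), (fun t => xS 7 t, 0), (fun t => xS 11 t, 0), (fun t => xS 12 t, 0),
    (fun t => xS 13 t, 0), (fun t => xS 14 t, 0), (fun t => xS 15 t, 0),
    (fun t => xS 16 t, 0)] ++ dataZ A

/-- Data of the character with label `A`, `c = a_{7,11,13,14,15}` for `p = 3`, first family. -/
def dataOne (A : CLabel F) (c : Fˣ) : List ((F → XS F) × F) :=
  [(xJ A, (c : F)), (fun t => xS 2 t, 0), (fun t => xS 3 t, 0), (fun t => xS 5 t, 0),
    (fun t => xS 11 t, 0), (fun t => xS 13 t, 0), (fun t => xS 14 t, 0),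
    (fun t => xS 15 t, 0)] ++ dataZ A

/-- Data of the character with label `A`, `b = b_{1,6,8,9,10,12,16}`, `b' = b_{2,3,5}` for
`p = 3`, second family. -/
def dataTwo (A : CLabel F) (b b' : F) : List ((F → XS F) × F) :=
  [(xI A, b), (x235 A, b'), (fun t => xS 2 t, 0), (fun t => xS 3 t, 0), (fun t => xS 7 t, 0),
    (fun t => xS 11 t, 0), (fun t => xS 13 t, 0), (fun t => xS 14 t, 0),
    (fun t => xS 15 t, 0)] ++ dataZ A

end Families

/-- The family for `p ≠ 3`. -/
def famNe3 (p : ℕ) [Fact p.Prime] (F : Type*) [Field F] [CharP F p] : Set (XS F → ℂ) :=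
  {χ | ∃ A b, IsIndFrom p (dataNe3 A b) χ}

/-- The first family for `p = 3`. -/
def famOne (p : ℕ) [Fact p.Prime] (F : Type*) [Field F] [CharP F p] : Set (XS F → ℂ) :=
  {χ | ∃ A c, IsIndFrom p (dataOne A c) χ}

/-- The second family for `p = 3`. -/
def famTwo (p : ℕ) [Fact p.Prime] (F : Type*) [Field F] [CharP F p] : Set (XS F → ℂ) :=
  {χ | ∃ A b b', IsIndFrom p (dataTwo A b b') χ}

end UE6

end

/-! The roots of `S` form three layers: the roots 1, 2, 3, 5, 6, 8, 9, 10, which are not sums of two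
roots of `P`; the roots 7, 11, …, 16; and `Z`, whose root subgroups are central in X_S. By Schur's
lemma each character in question lies over a linear character of X_Z with all five labels nonzero.
Fix such a label.

Conjugating x_i(t), with i in the middle layer, by u changes its value under the linear character by
φ(t λ_i(u)), where λ_i is a linear form in the first-layer coordinates of u. The forms λ_12 and λ_16
involve only u_2, u_3, u_5 and vanish together on the line of x_{2,3,5}. The forms λ_7, λ_11, λ_13,
λ_14, λ_15 involve u_1, u_6, u_8, u_9, u_10, and eliminating four of these unknowns leaves the
coefficient 3.

If p ≠ 3 these five forms are independent, and Mackey's criterion holds for the middle layer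
together with x_{2,3,5} and X_Z. If p = 3 they have a line of common zeros, the direction of
x_{1,6,8,9,10,12,16}, and a linear dependency, the direction of x_{7,11,13,14,15}. When the
character is nontrivial on the latter, the commutator of X_1 and X_3, which lies in X_7, makes up
for the missing equation; when it is trivial there, it extends to x_{1,6,8,9,10,12,16} and the
degree drops by a factor q. Irreducibility and distinctness follow from Mackey's criterion
(`indChar_mem_irr`, `indChar_ne`). Completeness follows because, over one label, the squares of the
degrees add up to q^15, the index of X_Z (`mem_range_of_sum_sq`).

All computations take place in an explicit group law on F^20 (`Coord`). As X_P is only a subgroup of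
a presented group, the map to `Coord` is obtained from an action of the whole of U on F × `Coord`, a
model of the cosets of X_K. It is onto, and a filtration by root subgroups bounds the order of X_S
by q^20, so it is an isomorphism (`toCoord_bijective`). -/

noncomputable section

namespace UE6

section Characters

open Module Representation

/-! ### Irreducible characters of finite groups. -/

section CharacterTheory

variable {G : Type*} [Group G] [Fintype G]

theorem invertible_card : Nonempty (Invertible (Nat.card G : ℂ)) :=
  ⟨invertibleOfNonzero (by exact_mod_cast Nat.card_pos.ne')⟩

theorem sum_mul_inv_eq_zero_of_ne {χ χ' : G → ℂ} (h : χ ∈ Irr G) (h' : χ' ∈ Irr G)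
    (hne : χ ≠ χ') : ∑ g, χ g * χ' g⁻¹ = 0 := by
  obtain ⟨n, ρ, hρ, rfl⟩ := h
  obtain ⟨m, σ, hσ, rfl⟩ := h'
  obtain ⟨_⟩ := invertible_card (G := G)
  have key := Representation.char_orthonormal ρ σ
  rw [if_neg (fun ⟨φ⟩ => hne (char_iso φ).symm)] at key
  exact (mul_eq_zero.mp key).resolve_left
    (inv_ne_zero (by exact_mod_cast Nat.card_pos.ne'))

omit [Fintype G] in
theorem irr_apply_one_ne_zero {χ : G → ℂ} (h : χ ∈ Irr G) : χ 1 ≠ 0 := by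
  obtain ⟨n, ρ, hρ, rfl⟩ := h
  rw [char_one]
  have : Nontrivial (Fin n → ℂ) := by
    by_contra hn
    rw [not_nontrivial_iff_subsingleton] at hn
    have : (⊥ : Subrepresentation ρ) = ⊤ := by
      ext v
      have := hn.elim v 0
      subst this
      simp only [zero_mem]
    exact bot_ne_top this
  exact_mod_cast finrank_pos.ne'

/-- A representation with one-dimensional endomorphism algebra is irreducible. -/
theorem isIrreducible_of_finrank_intertwiningMap {V : Type*} [AddCommGroup V] [Module ℂ V]
    [FiniteDimensional ℂ V] (ρ : Representation ℂ G V)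
    (h : finrank ℂ (IntertwiningMap ρ ρ) = 1) : ρ.IsIrreducible := by
  have hid : IntertwiningMap.id ρ ≠ 0 := by
    intro h0
    have : Subsingleton (IntertwiningMap ρ ρ) := ⟨fun f g => by
      have key : ∀ f : IntertwiningMap ρ ρ, f = 0 := fun f => by
        ext v
        have := congrArg (fun F : IntertwiningMap ρ ρ => F v) h0
        simp only [IntertwiningMap.id_apply, IntertwiningMap.coe_zero, Pi.zero_apply] at this
        simp [this]
      rw [key f, key g]⟩
    rw [finrank_zero_of_subsingleton] at h
    exact zero_ne_one h
  have hscal := (finrank_eq_one_iff_of_nonzero' _ hid).mp h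
  have : NeZero (Nat.card G : ℂ) := ⟨by exact_mod_cast Nat.card_pos.ne'⟩
  have hnt : Nontrivial (Subrepresentation ρ) := by
    refine ⟨⊥, ⊤, fun hbt => hid ?_⟩
    ext v
    have hv : v ∈ (⊤ : Subrepresentation ρ).toSubmodule := Submodule.mem_top
    rw [← hbt] at hv
    simpa using (Submodule.mem_bot ℂ).mp hv
  refine { hnt with eq_bot_or_eq_top := fun W => ?_ }
  -- Maschke: the projection onto `W` along an invariant complement is an intertwiner, hence a
  -- scalar `c`. If `c = 0` then `W = ⊥`, otherwise `W = ⊤`.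
  obtain ⟨W', hW⟩ := exists_isCompl W
  have hc : IsCompl W.toSubmodule W'.toSubmodule := by
    constructor
    · rw [disjoint_iff, ← Subrepresentation.toSubmodule_inf, disjoint_iff.mp hW.disjoint]; rfl
    · rw [codisjoint_iff, ← Subrepresentation.toSubmodule_sup, codisjoint_iff.mp hW.codisjoint]; rfl
  have hcomm : ∀ g v, (Submodule.projection _ _ hc) (ρ g v) = ρ g ((Submodule.projection _ _ hc) v) := by
    intro g v
    obtain ⟨a, ha, b, hb, rfl⟩ := Submodule.mem_sup.mp
      (hc.sup_eq_top ▸ Submodule.mem_top : v ∈ W.toSubmodule ⊔ W'.toSubmodule)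
    have e1 := Submodule.projection_apply_left hc ⟨a, ha⟩
    have e2 := Submodule.projection_apply_right hc ⟨b, hb⟩
    have e3 := Submodule.projection_apply_left hc ⟨ρ g a, W.apply_mem_toSubmodule g ha⟩
    have e4 := Submodule.projection_apply_right hc ⟨ρ g b, W'.apply_mem_toSubmodule g hb⟩
    simp only at e1 e2 e3 e4
    simp only [map_add, e1, e2, e3, e4, map_zero]
  obtain ⟨c, hc'⟩ := hscal ⟨(Submodule.projection _ _ hc), fun g => by ext v; exact hcomm g v⟩
  have hP : ∀ v, (Submodule.projection _ _ hc) v = c • v := fun v => by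
    have := congrArg (fun F : IntertwiningMap ρ ρ => F v) hc'
    simpa using this.symm
  by_cases h0 : c = 0
  · left
    apply Subrepresentation.toSubmodule_injective
    refine (Submodule.eq_bot_iff _).mpr fun v hv => ?_
    have := Submodule.projection_apply_left hc ⟨v, hv⟩
    simp only at this
    rw [← this, hP, h0, zero_smul]
  · right
    apply Subrepresentation.toSubmodule_injective
    refine (Submodule.eq_top_iff').mpr fun v => ?_
    have h1 : c • v ∈ W.toSubmodule := by
      rw [← hP]; exact Submodule.projection_apply_mem hc v
    simpa [smul_smul, inv_mul_cancel₀ h0] using W.toSubmodule.smul_mem c⁻¹ h1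

/-- The norm of a character is the dimension of its endomorphism algebra, so norm one forces
irreducibility. The transport along `e` is needed because `Irr` only admits the spaces `Fin n → ℂ`.
-/
theorem character_mem_irr {V : Type*} [AddCommGroup V] [Module ℂ V]
    [FiniteDimensional ℂ V] (ρ : Representation ℂ G V)
    (h : ∑ g, ρ.character g * ρ.character g⁻¹ = Nat.card G) : ρ.character ∈ Irr G := by
  let e : V ≃ₗ[ℂ] (Fin (finrank ℂ V) → ℂ) := (finBasis ℂ V).equivFun
  let σ : Representation ℂ G (Fin (finrank ℂ V) → ℂ) :=
    { toFun := fun g => e.toLinearMap ∘ₗ ρ g ∘ₗ e.symm.toLinearMap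
      map_one' := by ext; simp
      map_mul' := fun a b => by
        refine LinearMap.ext fun v => ?_
        simp }
  have hiso : ρ.character = σ.character :=
    char_iso (Representation.Equiv.mk e fun g => by
      refine LinearMap.ext fun v => ?_
      simp [σ])
  refine ⟨_, σ, ?_, hiso⟩
  apply isIrreducible_of_finrank_intertwiningMap
  obtain ⟨_⟩ := invertible_card (G := G)
  have key := card_inv_mul_sum_char_mul_char_eq_finrank σ σ
  rw [← hiso, h, inv_mul_cancel_of_invertible] at key
  exact_mod_cast key.symm

omit [Fintype G] in
/-- Schur's lemma: central elements act by scalars. -/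
theorem exists_central_char {χ : G → ℂ} (h : χ ∈ Irr G) :
    ∃ l : Subgroup.center G →* ℂ, ∀ (z : Subgroup.center G) (g : G), χ (z * g) = l z * χ g := by
  have h1 := irr_apply_one_ne_zero h
  obtain ⟨n, ρ, hρ, rfl⟩ := h
  have key : ∀ z : Subgroup.center G, ∃ c : ℂ, ∀ g, ρ.character (z * g) = c * ρ.character g := by
    intro z
    let f : IntertwiningMap ρ ρ := ⟨ρ z, fun g => by
      rw [← Module.End.mul_eq_comp, ← Module.End.mul_eq_comp, ← map_mul, ← map_mul,
        Subgroup.mem_center_iff.mp z.2 g]⟩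
    obtain ⟨c, hc⟩ := (IsIrreducible.algebraMap_intertwiningMap_bijective_of_isAlgClosed
      (ρ := ρ)).2 f
    have hz : ρ z = c • LinearMap.id := by
      ext1 v
      have := congrArg (fun F : IntertwiningMap ρ ρ => F (Pi.single v 1)) hc
      ext1
      simpa [f, Algebra.algebraMap_eq_smul_one] using this.symm
    refine ⟨c, fun g => ?_⟩
    simp only [character]
    rw [map_mul, hz]
    simp [Module.End.mul_eq_comp]
  choose c hc using key
  have hcz : ∀ z, c z = ρ.character z / ρ.character 1 := fun z => by
    rw [eq_div_iff h1, ← hc, mul_one]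
  refine ⟨⟨⟨c, ?_⟩, ?_⟩, hc⟩
  · rw [hcz]; exact div_self h1
  · intro a b
    change c (a * b) = c a * c b
    rw [hcz (a * b), div_eq_iff h1, Subgroup.coe_mul, hc, mul_assoc, hcz b, div_mul_cancel₀ _ h1]

/-- Elements have finite order, so the values of `ψ` are roots of unity. -/
theorem map_inv_eq_conj (ψ : G →* ℂ) (m : G) : ψ m⁻¹ = (starRingEnd ℂ) (ψ m) := by
  have h1 : ψ m * ψ m⁻¹ = 1 := by rw [← map_mul, mul_inv_cancel, map_one]
  have h2 : ‖ψ m‖ = 1 := by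
    refine Complex.norm_eq_one_of_pow_eq_one (n := Fintype.card G) ?_ Fintype.card_ne_zero
    rw [← map_pow, pow_card_eq_one, map_one]
  have h3 : ψ m * (starRingEnd ℂ) (ψ m) = 1 := by
    rw [Complex.mul_conj, Complex.normSq_eq_norm_sq, h2]; simp
  have h0 : ψ m ≠ 0 := left_ne_zero_of_mul_eq_one h1
  exact mul_left_cancel₀ h0 (h1.trans h3.symm)

end CharacterTheory

/-! ### Characters induced from linear characters, and Mackey's criterion. -/

section Induction

variable {G : Type*} [Group G] (M : Subgroup G)

open Classical in
/-- Extension by zero of a linear character of a subgroup. -/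
def extZero (ψ : M →* ℂ) (g : G) : ℂ := if h : g ∈ M then ψ ⟨g, h⟩ else 0

variable {M}

theorem extZero_of_mem (ψ : M →* ℂ) {g : G} (h : g ∈ M) : extZero M ψ g = ψ ⟨g, h⟩ := dif_pos h

theorem extZero_of_notMem (ψ : M →* ℂ) {g : G} (h : g ∉ M) : extZero M ψ g = 0 := dif_neg h

theorem extZero_mul_left (ψ : M →* ℂ) {m : G} (hm : m ∈ M) (g : G) :
    extZero M ψ (m * g) = extZero M ψ m * extZero M ψ g := by
  by_cases hg : g ∈ M
  · rw [extZero_of_mem _ hm, extZero_of_mem _ hg, extZero_of_mem _ (mul_mem hm hg), ← map_mul]; rfl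
  · rw [extZero_of_notMem _ hg, extZero_of_notMem _ (by rwa [Subgroup.mul_mem_cancel_left _ hm]),
      mul_zero]

theorem extZero_mul_right (ψ : M →* ℂ) {m : G} (hm : m ∈ M) (g : G) :
    extZero M ψ (g * m) = extZero M ψ g * extZero M ψ m := by
  by_cases hg : g ∈ M
  · rw [extZero_of_mem _ hm, extZero_of_mem _ hg, extZero_of_mem _ (mul_mem hg hm), ← map_mul]; rfl
  · rw [extZero_of_notMem _ hg, extZero_of_notMem _ (by rwa [Subgroup.mul_mem_cancel_right _ hm]),
      zero_mul]

theorem extZero_mul_inv (ψ : M →* ℂ) {m : G} (hm : m ∈ M) :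
    extZero M ψ m * extZero M ψ m⁻¹ = 1 := by
  rw [← extZero_mul_left ψ hm, mul_inv_cancel, extZero_of_mem ψ (one_mem _)]
  exact map_one ψ

variable [Fintype G]

theorem extZero_inv (ψ : M →* ℂ) (g : G) :
    extZero M ψ g⁻¹ = (starRingEnd ℂ) (extZero M ψ g) := by
  by_cases hg : g ∈ M
  · have := Fintype.ofFinite M
    rw [extZero_of_mem _ hg, extZero_of_mem _ (inv_mem hg), ← map_inv_eq_conj ψ ⟨g, hg⟩]; rfl
  · rw [extZero_of_notMem _ hg, extZero_of_notMem _ (by rwa [inv_mem_iff]), map_zero]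

theorem indChar_eq_sum (ψ : M →* ℂ) (g : G) :
    indChar M ψ g = (Nat.card M : ℂ)⁻¹ * ∑ y, extZero M ψ (y * g * y⁻¹) := by
  rw [indChar, finsum_eq_sum_of_fintype]
  rfl

theorem indChar_inv (ψ : M →* ℂ) (g : G) :
    indChar M ψ g⁻¹ = (starRingEnd ℂ) (indChar M ψ g) := by
  simp only [indChar_eq_sum, map_mul, map_inv₀, map_natCast, map_sum, ← extZero_inv]
  simp [mul_assoc]

theorem indChar_one (ψ : M →* ℂ) : indChar M ψ 1 = (Nat.card G : ℂ) / Nat.card M := by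
  have h1 : extZero M ψ 1 = 1 := by rw [extZero_of_mem ψ (one_mem _)]; exact map_one ψ
  simp only [indChar_eq_sum, mul_one, mul_inv_cancel, h1, Finset.sum_const, Finset.card_univ,
    nsmul_eq_mul, Nat.card_eq_fintype_card (α := G)]
  rw [div_eq_inv_mul]

theorem indChar_central_mul (ψ : M →* ℂ) {z : G} (hz : z ∈ Subgroup.center G) (hM : z ∈ M)
    (g : G) : indChar M ψ (z * g) = ψ ⟨z, hM⟩ * indChar M ψ g := by
  rw [indChar_eq_sum, indChar_eq_sum, mul_left_comm, Finset.mul_sum Finset.univ _ (ψ _)]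
  congr 1
  apply Finset.sum_congr rfl
  intro y _
  rw [← extZero_of_mem ψ hM, ← extZero_mul_left ψ hM]
  congr 1
  rw [← mul_assoc, Subgroup.mem_center_iff.mp hz y]
  group

/-- Mackey's formula when only the trivial double coset contributes. For `y` outside `M`,
translating the sum by the witness of `H` multiplies it by a scalar different from 1, so the sum is
zero. -/
theorem sum_indChar_mul_inv (ψ ψ' : M →* ℂ)
    (H : ∀ y ∉ M, ∃ n ∈ M, y * n * y⁻¹ ∈ M ∧ extZero M ψ (y * n * y⁻¹) ≠ extZero M ψ' n) :
    ∑ g, indChar M ψ g * indChar M ψ' g⁻¹ =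
      (Nat.card G : ℂ) * ((Nat.card M : ℂ)⁻¹ * ∑ g, extZero M ψ g * extZero M ψ' g⁻¹) := by
  have hc : (Nat.card M : ℂ) ≠ 0 := by exact_mod_cast Nat.card_pos.ne'
  have inner : ∀ y : G, ∑ g, extZero M ψ (y * g * y⁻¹) * extZero M ψ' g⁻¹ =
      extZero M 1 y * ∑ g, extZero M ψ g * extZero M ψ' g⁻¹ := by
    intro y
    by_cases hy : y ∈ M
    · have h1 : extZero M (1 : M →* ℂ) y = 1 := by rw [extZero_of_mem _ hy]; rfl
      rw [h1, one_mul]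
      refine Finset.sum_congr rfl fun g _ => ?_
      rw [extZero_mul_right ψ (inv_mem hy), extZero_mul_left ψ hy, mul_right_comm _ _ (extZero M ψ y⁻¹),
        extZero_mul_inv ψ hy, one_mul]
    · rw [extZero_of_notMem _ hy, zero_mul]
      obtain ⟨n, hn, hyn, hne⟩ := H y hy
      have h2 : ∑ g, extZero M ψ (y * g * y⁻¹) * extZero M ψ' g⁻¹ =
          (extZero M ψ (y * n * y⁻¹) * extZero M ψ' n⁻¹) *
            ∑ g, extZero M ψ (y * g * y⁻¹) * extZero M ψ' g⁻¹ := by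
        conv_lhs => rw [← Equiv.sum_comp (Equiv.mulRight n)]
        rw [Finset.mul_sum]
        refine Finset.sum_congr rfl fun g _ => ?_
        have e1 : y * (g * n) * y⁻¹ = (y * g * y⁻¹) * (y * n * y⁻¹) := by group
        simp only [Equiv.coe_mulRight]
        rw [e1, extZero_mul_right ψ hyn, mul_inv_rev, extZero_mul_left ψ' (inv_mem hn)]
        ring
      by_contra h0
      have h3 : extZero M ψ (y * n * y⁻¹) * extZero M ψ' n⁻¹ = 1 :=
        mul_right_cancel₀ h0 (by rw [← h2, one_mul])
      apply hne
      have h4 := extZero_mul_inv ψ' hn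
      calc _ = extZero M ψ (y * n * y⁻¹) * (extZero M ψ' n * extZero M ψ' n⁻¹) := by
            rw [h4, mul_one]
        _ = extZero M ψ' n * (extZero M ψ (y * n * y⁻¹) * extZero M ψ' n⁻¹) := by ring
        _ = _ := by rw [h3, mul_one]
  have hM : ∑ y, extZero M (1 : M →* ℂ) y = Nat.card M := by
    classical
    have : ∀ y, extZero M (1 : M →* ℂ) y = if y ∈ M then 1 else 0 := fun y => by
      by_cases hy : y ∈ M
      · rw [extZero_of_mem _ hy, if_pos hy]; rfl
      · rw [extZero_of_notMem _ hy, if_neg hy]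
    simp only [this, Finset.sum_boole, Nat.cast_inj]
    exact (Nat.subtype_card _ (fun x => by simp)).symm
  set T := ∑ g, extZero M ψ g * extZero M ψ' g⁻¹ with hT
  -- The substitutions g ↦ z⁻¹gz and y ↦ yz remove `z`, so every `z` contributes the same amount.
  have swap : ∀ z : G, ∑ g, ∑ y, extZero M ψ (y * g * y⁻¹) * extZero M ψ' (z * g⁻¹ * z⁻¹) =
      Nat.card M * T := by
    intro z
    rw [← Equiv.sum_comp (MulAut.conj z⁻¹).toEquiv]
    have : ∀ g, ∑ y, extZero M ψ (y * (MulAut.conj z⁻¹).toEquiv g * y⁻¹) *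
        extZero M ψ' (z * ((MulAut.conj z⁻¹).toEquiv g)⁻¹ * z⁻¹) =
        ∑ y, extZero M ψ (y * g * y⁻¹) * extZero M ψ' g⁻¹ := by
      intro g
      rw [← Equiv.sum_comp (Equiv.mulRight z)]
      refine Finset.sum_congr rfl fun y _ => ?_
      have e1 : y * z * (MulAut.conj z⁻¹ g) * (y * z)⁻¹ = y * g * y⁻¹ := by
        rw [MulAut.conj_apply]; group
      have e2 : z * (MulAut.conj z⁻¹ g)⁻¹ * z⁻¹ = g⁻¹ := by
        rw [MulAut.conj_apply]; group
      change extZero M ψ (y * z * (MulAut.conj z⁻¹ g) * (y * z)⁻¹) *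
        extZero M ψ' (z * (MulAut.conj z⁻¹ g)⁻¹ * z⁻¹) = _
      rw [e1, e2]
    simp only [this]
    rw [Finset.sum_comm]
    simp only [inner]
    rw [← Finset.sum_mul, hM]
  have expand : ∀ g, indChar M ψ g * indChar M ψ' g⁻¹ = (Nat.card M : ℂ)⁻¹ * (Nat.card M : ℂ)⁻¹ *
      ∑ z, ∑ y, extZero M ψ (y * g * y⁻¹) * extZero M ψ' (z * g⁻¹ * z⁻¹) := by
    intro g
    rw [indChar_eq_sum, indChar_eq_sum, Finset.sum_comm, ← Finset.sum_mul_sum]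
    ring
  simp only [expand]
  rw [← Finset.mul_sum, Finset.sum_comm]
  simp only [swap]
  rw [Finset.sum_const, Finset.card_univ, nsmul_eq_mul, Nat.card_eq_fintype_card (α := G)]
  field_simp

theorem sum_extZero_mul_inv (ψ : M →* ℂ) :
    ∑ g, extZero M ψ g * extZero M ψ g⁻¹ = Nat.card M := by
  classical
  have : ∀ y, extZero M ψ y * extZero M ψ y⁻¹ = if y ∈ M then 1 else 0 := fun y => by
    by_cases hy : y ∈ M
    · rw [extZero_mul_inv ψ hy, if_pos hy]
    · rw [extZero_of_notMem _ hy, if_neg hy, zero_mul]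
  simp only [this, Finset.sum_boole, Nat.cast_inj]
  exact (Nat.subtype_card _ (fun x => by simp)).symm

theorem sum_extZero_mul_inv_of_ne {ψ ψ' : M →* ℂ} (hne : ψ ≠ ψ') :
    ∑ g, extZero M ψ g * extZero M ψ' g⁻¹ = 0 := by
  obtain ⟨n, hn⟩ := DFunLike.ne_iff.mp hne
  have h2 : ∑ g, extZero M ψ g * extZero M ψ' g⁻¹ =
      (extZero M ψ n * extZero M ψ' (n : G)⁻¹) * ∑ g, extZero M ψ g * extZero M ψ' g⁻¹ := by
    conv_lhs => rw [← Equiv.sum_comp (Equiv.mulRight (n : G))]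
    rw [Finset.mul_sum]
    refine Finset.sum_congr rfl fun g _ => ?_
    simp only [Equiv.coe_mulRight]
    rw [extZero_mul_right ψ n.2, mul_inv_rev, extZero_mul_left ψ' (inv_mem n.2)]
    ring
  by_contra h0
  have h3 : extZero M ψ n * extZero M ψ' (n : G)⁻¹ = 1 :=
    mul_right_cancel₀ h0 (by rw [← h2, one_mul])
  apply hn
  have h4 := extZero_mul_inv ψ' n.2
  rw [← extZero_of_mem ψ n.2, ← extZero_of_mem ψ' n.2]
  calc _ = extZero M ψ n * (extZero M ψ' n * extZero M ψ' (n : G)⁻¹) := by rw [h4, mul_one]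
    _ = extZero M ψ' n * (extZero M ψ n * extZero M ψ' (n : G)⁻¹) := by ring
    _ = _ := by rw [h3, mul_one]

/-- Mackey's criterion for distinctness. -/
theorem indChar_ne {ψ ψ' : M →* ℂ} (hne : ψ ≠ ψ')
    (hψ : indChar M ψ ∈ Irr G)
    (H : ∀ y ∉ M, ∃ n ∈ M, y * n * y⁻¹ ∈ M ∧ extZero M ψ (y * n * y⁻¹) ≠ extZero M ψ' n) :
    indChar M ψ ≠ indChar M ψ' := by
  intro h
  have h1 := sum_indChar_mul_inv ψ ψ' H
  rw [sum_extZero_mul_inv_of_ne hne, mul_zero, mul_zero, ← h] at h1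
  obtain ⟨n, ρ, hρ, h2⟩ := hψ
  obtain ⟨_⟩ := invertible_card (G := G)
  have key := Representation.char_orthonormal ρ ρ
  rw [if_pos ⟨Representation.Equiv.refl ρ⟩, ← h2, h1, mul_zero] at key
  exact zero_ne_one key

/-- The space of the representation induced from a linear character. -/
def indSpace (ψ : M →* ℂ) : Submodule ℂ (G → ℂ) where
  carrier := {f | ∀ (m : M) (g : G), f (m * g) = ψ m * f g}
  add_mem' ha hb m g := by simp only [Pi.add_apply, ha m g, hb m g, mul_add]
  zero_mem' m g := by simp
  smul_mem' c f hf m g := by simp only [Pi.smul_apply, smul_eq_mul, hf m g]; ring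

/-- The representation induced from a linear character. -/
def indRep (ψ : M →* ℂ) : Representation ℂ G (indSpace ψ) where
  toFun g :=
    { toFun := fun f => ⟨fun y => f.1 (y * g), fun m y => by
        simp only [mul_assoc]; exact f.2 m _⟩
      map_add' := fun _ _ => rfl
      map_smul' := fun _ _ => rfl }
  map_one' := by ext f; simp
  map_mul' a b := by ext f; simp [mul_assoc]

/-- The projection onto the space of the induced representation. -/
def indProj (ψ : M →* ℂ) : (G → ℂ) →ₗ[ℂ] indSpace ψ where
  toFun f := ⟨fun y => (Nat.card M : ℂ)⁻¹ * ∑ h, extZero M ψ h⁻¹ * f (h * y), fun m y => by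
    beta_reduce
    conv_lhs => rw [← Equiv.sum_comp (Equiv.mulRight (m : G)⁻¹)]
    rw [mul_left_comm, Finset.mul_sum Finset.univ _ (ψ _)]
    congr 1
    apply Finset.sum_congr rfl
    intro h _
    simp only [Equiv.coe_mulRight, mul_inv_rev, inv_inv]
    rw [extZero_mul_left ψ m.2, extZero_of_mem ψ m.2, mul_assoc]
    congr 3
    group⟩
  map_add' a b := by
    ext y; simp [mul_add, Finset.sum_add_distrib]
  map_smul' c a := by
    ext y
    simp only [Pi.smul_apply, smul_eq_mul, RingHom.id_apply, SetLike.val_smul,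
      mul_left_comm _ c, ← Finset.mul_sum]

theorem indProj_coe (ψ : M →* ℂ) (f : indSpace ψ) : indProj ψ f = f := by
  ext y
  have : ∀ h, extZero M ψ h⁻¹ * f.1 (h * y) = extZero M ψ h * extZero M ψ h⁻¹ * f.1 y := by
    intro h
    by_cases hh : h ∈ M
    · rw [f.2 ⟨h, hh⟩ y, extZero_of_mem ψ hh]; ring
    · rw [extZero_of_notMem ψ hh, extZero_of_notMem ψ (by rwa [inv_mem_iff])]; ring
  change (Nat.card M : ℂ)⁻¹ * ∑ h, extZero M ψ h⁻¹ * f.1 (h * y) = f.1 y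
  simp only [this]
  rw [← Finset.sum_mul, sum_extZero_mul_inv, inv_mul_cancel_left₀
    (by exact_mod_cast Nat.card_pos.ne')]

/-- `indProj` is the identity on `indSpace ψ`, so the trace can be taken on all functions on `G`,
where the delta functions form a basis. -/
theorem indRep_character (ψ : M →* ℂ) : (indRep ψ).character = indChar M ψ := by
  classical
  ext g
  have h1 : indRep ψ g = (indRep ψ g ∘ₗ indProj ψ) ∘ₗ (indSpace ψ).subtype := by
    refine LinearMap.ext fun f => ?_
    simp [indProj_coe]
  rw [character, h1, LinearMap.trace_comp_comm', LinearMap.trace_eq_matrix_trace ℂ (Pi.basisFun ℂ G),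
    Matrix.trace, indChar_eq_sum, Finset.mul_sum]
  refine Finset.sum_congr rfl fun y _ => ?_
  rw [Matrix.diag_apply, LinearMap.toMatrix_apply]
  simp only [Pi.basisFun_apply, Pi.basisFun_repr]
  change (Nat.card M : ℂ)⁻¹ * ∑ h, extZero M ψ h⁻¹ * (Pi.single y 1 : G → ℂ) (h * (y * g)) = _
  rw [Finset.sum_eq_single (y * g⁻¹ * y⁻¹)]
  · have : y * g⁻¹ * y⁻¹ * (y * g) = y := by group
    rw [this, Pi.single_eq_same, mul_one]
    congr 2
    group
  · intro h _ hne
    rw [Pi.single_eq_of_ne, mul_zero]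
    intro heq
    apply hne
    rw [eq_mul_inv_of_mul_eq heq]
    group
  · simp

/-- Mackey's irreducibility criterion. -/
theorem indChar_mem_irr (ψ : M →* ℂ)
    (H : ∀ y ∉ M, ∃ n ∈ M, y * n * y⁻¹ ∈ M ∧ extZero M ψ (y * n * y⁻¹) ≠ extZero M ψ n) :
    indChar M ψ ∈ Irr G := by
  rw [← indRep_character]
  apply character_mem_irr
  rw [indRep_character, sum_indChar_mul_inv ψ ψ H, sum_extZero_mul_inv,
    inv_mul_cancel₀ (by exact_mod_cast Nat.card_pos.ne'), mul_one]

end Induction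

/-! ### Completeness of a family of irreducible characters from the sum of squares of degrees. -/

section Completeness

variable {G : Type*} [Group G] [Fintype G]

/-- A family of irreducible characters over a linear character of a subgroup, with sum of squares
of degrees the index of the subgroup, is complete. -/
theorem mem_range_of_sum_sq (Z : Subgroup G) (l : Z →* ℂ) {ι : Type*} [Fintype ι]
    (X : ι → G → ℂ) (hX : Function.Injective X) (hirr : ∀ i, X i ∈ Irr G)
    (hZ : ∀ i (z : Z), X i z = l z * X i 1)
    (hconj : ∀ i g, X i g⁻¹ = (starRingEnd ℂ) (X i g))
    (hsum : (∑ i, X i 1 ^ 2) * Nat.card Z = Nat.card G)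
    {χ : G → ℂ} (hχ : χ ∈ Irr G) (hχZ : ∀ z : Z, χ z = l z * χ 1) : χ ∈ Set.range X := by
  by_contra hmem
  have hG : (Nat.card G : ℂ) ≠ 0 := by exact_mod_cast Nat.card_pos.ne'
  have hZ0 : (Nat.card Z : ℂ) ≠ 0 := by exact_mod_cast Nat.card_pos.ne'
  set q : ℂ := Nat.card G / Nat.card Z with hq
  have pair : ∀ (θ : G → ℂ) (d : ℂ), (∀ z : Z, θ z = l z * d) →
      ∑ g, extZero Z l g * θ g⁻¹ = Nat.card Z * d := by
    intro θ d hθ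
    have : ∀ g, extZero Z l g * θ g⁻¹ = extZero Z l g * extZero Z l g⁻¹ * d := by
      intro g
      by_cases hg : g ∈ Z
      · rw [hθ ⟨g⁻¹, inv_mem hg⟩, extZero_of_mem l (inv_mem hg)]; ring
      · rw [extZero_of_notMem l hg]; ring
    simp only [this]
    rw [← Finset.sum_mul, sum_extZero_mul_inv]
  set S : G → ℂ := fun g => ∑ i, X i 1 * X i g with hS
  -- For central `Z` the first term is the character induced from `l`, and `S` is its expected
  -- decomposition. `T` turns out to be orthogonal to both, hence to itself, hence zero.
  set T : G → ℂ := fun g => q * extZero Z l g - S g with hT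
  have hself : ∀ i, ∑ g, X i g * X i g⁻¹ = Nat.card G := by
    intro i
    obtain ⟨n, ρ, hρ, h2⟩ := hirr i
    obtain ⟨_⟩ := invertible_card (G := G)
    have key := Representation.char_orthonormal ρ ρ
    rw [if_pos ⟨Representation.Equiv.refl ρ⟩, ← h2, inv_mul_eq_one₀ hG] at key
    exact key.symm
  have hSX : ∀ i, ∑ g, S g * X i g⁻¹ = Nat.card G * X i 1 := by
    intro i
    simp only [hS, Finset.sum_mul]
    rw [Finset.sum_comm, Finset.sum_eq_single i]
    · simp only [mul_assoc, ← Finset.mul_sum]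
      rw [hself, mul_comm]
    · intro j _ hj
      simp only [mul_assoc, ← Finset.mul_sum]
      rw [sum_mul_inv_eq_zero_of_ne (hirr j) (hirr i) (fun h => hj (hX h)), mul_zero]
    · simp
  have hRX : ∀ i, ∑ g, q * extZero Z l g * X i g⁻¹ = Nat.card G * X i 1 := by
    intro i
    simp only [mul_assoc, ← Finset.mul_sum]
    rw [pair (X i) (X i 1) (hZ i), hq]
    field_simp
  have hTX : ∀ i, ∑ g, T g * X i g⁻¹ = 0 := by
    intro i
    simp only [hT, sub_mul, Finset.sum_sub_distrib]
    rw [hRX, hSX, sub_self]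
  have hTS : ∑ g, T g * S g⁻¹ = 0 := by
    simp only [hS, Finset.mul_sum]
    rw [Finset.sum_comm]
    refine Finset.sum_eq_zero fun i _ => ?_
    simp only [mul_left_comm _ (X i 1), ← Finset.mul_sum]
    rw [hTX, mul_zero]
  have hTR : ∑ g, T g * (q * extZero Z l g⁻¹) = 0 := by
    have e1 : ∑ g, T g * (q * extZero Z l g⁻¹) = q * ∑ g, extZero Z l g * T g⁻¹ := by
      rw [← Equiv.sum_comp (Equiv.inv G), Finset.mul_sum]
      refine Finset.sum_congr rfl fun g _ => ?_
      simp only [Equiv.inv_apply, inv_inv]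
      ring
    rw [e1, pair T (T 1)]
    -- This is where the sum of squares of the degrees enters.
    · have : T 1 = 0 := by
        have h1 : extZero Z l 1 = 1 := by rw [extZero_of_mem l (one_mem _)]; exact map_one l
        simp only [hT, hS, h1, mul_one, ← sq]
        rw [hq, ← hsum]
        field_simp
        ring
      rw [this, mul_zero, mul_zero]
    · intro z
      have h1 : extZero Z l 1 = 1 := by rw [extZero_of_mem l (one_mem _)]; exact map_one l
      simp only [hT, hS, extZero_of_mem l z.2, h1, hZ]
      rw [mul_sub, Finset.mul_sum]
      congr 1
      · ring
      · exact Finset.sum_congr rfl fun i _ => by ring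
  have hTT : ∑ g, T g * T g⁻¹ = 0 := by
    have : ∀ g, T g * T g⁻¹ = T g * (q * extZero Z l g⁻¹) - T g * S g⁻¹ := fun g => by
      simp only [hT]; ring
    simp only [this, Finset.sum_sub_distrib]
    rw [hTR, hTS, sub_self]
  have hTconj : ∀ g, T g⁻¹ = (starRingEnd ℂ) (T g) := by
    intro g
    have h1 : ∀ i, (starRingEnd ℂ) (X i 1) = X i 1 := fun i => by
      rw [← hconj, inv_one]
    simp [hT, hS, hq, extZero_inv, hconj, h1]
  have hT0 : ∀ g, T g = 0 := by
    have h2 : ∑ g, ‖T g‖ ^ 2 = 0 := by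
      have : ((∑ g, ‖T g‖ ^ 2 : ℝ) : ℂ) = 0 := by
        rw [← hTT]
        push_cast
        refine Finset.sum_congr rfl fun g _ => ?_
        rw [hTconj, Complex.mul_conj, Complex.normSq_eq_norm_sq]
        push_cast; rfl
      exact_mod_cast this
    intro g
    have h3 := (Finset.sum_eq_zero_iff_of_nonneg (fun g _ => sq_nonneg ‖T g‖)).mp h2 g
      (Finset.mem_univ _)
    simpa using h3
  -- If `χ` were outside the family it would be orthogonal to `S`, while its pairing with the
  -- extension of `l` is |Z| χ(1) ≠ 0.
  have h4 := pair χ (χ 1) hχZ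
  have h5 : ∑ g, q * extZero Z l g * χ g⁻¹ = 0 := by
    have : ∀ g, q * extZero Z l g = S g := fun g => sub_eq_zero.mp (hT0 g)
    simp only [this, hS, Finset.sum_mul]
    rw [Finset.sum_comm]
    refine Finset.sum_eq_zero fun i _ => ?_
    simp only [mul_assoc, ← Finset.mul_sum]
    rw [sum_mul_inv_eq_zero_of_ne (hirr i) hχ (fun h => hmem ⟨i, h⟩), mul_zero]
  simp only [mul_assoc, ← Finset.mul_sum] at h5
  rw [h4, hq, ← mul_assoc, div_mul_cancel₀ _ hZ0] at h5
  exact (mul_ne_zero hG (irr_apply_one_ne_zero hχ)) h5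

end Completeness

end Characters

/-! ### An explicit model of X_S. -/

/-- Coordinates of the elements of `X_S`: the tuple `(c_r)` stands for the product of the root
elements `x_r(c_r)`, taken in the order of the fields. -/
@[ext]
structure Coord (F : Type*) where
  c1 : F
  c2 : F
  c3 : F
  c5 : F
  c6 : F
  c8 : F
  c9 : F
  c10 : F
  c7 : F
  c11 : F
  c12 : F
  c13 : F
  c14 : F
  c15 : F
  c16 : F
  c17 : F
  c18 : F
  c20 : F
  c21 : F
  c24 : F

namespace Coord

variable {F : Type*} [Field F]

instance : One (Coord F) := ⟨⟨0, 0, 0, 0, 0, 0, 0, 0, 0, 0, 0, 0, 0, 0, 0, 0, 0, 0, 0, 0⟩⟩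

/-- This is what collecting a product of two ordered words by the Chevalley relations modulo X_K
yields; that it describes X_S is established by `toCoord`. The first eight coordinates simply add:
without `α_4`, the roots 8, 9, 10 are not sums of roots of `P`. -/
instance : Mul (Coord F) where
  mul g h :=
    { c1 := g.c1 + h.c1
      c2 := g.c2 + h.c2
      c3 := g.c3 + h.c3
      c5 := g.c5 + h.c5
      c6 := g.c6 + h.c6
      c8 := g.c8 + h.c8
      c9 := g.c9 + h.c9
      c10 := g.c10 + h.c10
      c7 := -g.c3 * h.c1 + g.c7 + h.c7
      c11 := g.c11 - g.c6 * h.c5 + h.c11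
      c12 := g.c12 - g.c9 * h.c1 + h.c12
      c13 := g.c13 - g.c8 * h.c3 - g.c9 * h.c2 + h.c13
      c14 := -g.c10 * h.c2 + g.c14 + g.c8 * h.c5 + h.c14
      c15 := -g.c10 * h.c3 + g.c15 + g.c9 * h.c5 + h.c15
      c16 := g.c10 * h.c6 + g.c16 + h.c16
      c17 := -g.c12 * h.c2 - g.c13 * h.c1 + g.c17 - g.c3 * g.c8 * h.c1 - g.c3 * h.c1 * h.c8 + g.c7 * h.c8 + g.c9 * h.c1 * h.c2 + h.c17
      c18 := -g.c10 * g.c3 * h.c1 + g.c12 * h.c5 - g.c15 * h.c1 + g.c18 - g.c3 * h.c1 * h.c10 + g.c7 * h.c10 - g.c9 * h.c1 * h.c5 + h.c18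
      c20 := -g.c10 * h.c2 * h.c6 - g.c11 * h.c8 + g.c14 * h.c6 - g.c16 * h.c2 + g.c20 + g.c6 * g.c8 * h.c5 + g.c6 * h.c5 * h.c8 + g.c8 * h.c5 * h.c6 + h.c20
      c21 := -g.c10 * h.c3 * h.c6 - g.c11 * h.c9 + g.c15 * h.c6 - g.c16 * h.c3 + g.c21 + g.c6 * g.c9 * h.c5 + g.c6 * h.c5 * h.c9 + g.c9 * h.c5 * h.c6 + h.c21
      c24 := -g.c10 * g.c8 * h.c3 - g.c10 * g.c9 * h.c2 - g.c10 * h.c2 * h.c9 - g.c10 * h.c3 * h.c8 + g.c13 * h.c10 + g.c14 * h.c9 + g.c15 * h.c8 + g.c24 + g.c8 * g.c9 * h.c5 - g.c8 * h.c10 * h.c3 + g.c8 * h.c5 * h.c9 - g.c9 * h.c10 * h.c2 + g.c9 * h.c5 * h.c8 + h.c24 }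

instance : Inv (Coord F) where
  inv g :=
    { c1 := -g.c1
      c2 := -g.c2
      c3 := -g.c3
      c5 := -g.c5
      c6 := -g.c6
      c8 := -g.c8
      c9 := -g.c9
      c10 := -g.c10
      c7 := -g.c1 * g.c3 - g.c7
      c11 := -g.c11 - g.c5 * g.c6
      c12 := -g.c1 * g.c9 - g.c12
      c13 := -g.c13 - g.c2 * g.c9 - g.c3 * g.c8
      c14 := -g.c10 * g.c2 - g.c14 + g.c5 * g.c8
      c15 := -g.c10 * g.c3 - g.c15 + g.c5 * g.c9
      c16 := g.c10 * g.c6 - g.c16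
      c17 := -g.c1 * g.c13 - g.c1 * g.c2 * g.c9 - g.c12 * g.c2 - g.c17 + g.c7 * g.c8
      c18 := -g.c1 * g.c15 + g.c1 * g.c5 * g.c9 + g.c10 * g.c7 + g.c12 * g.c5 - g.c18
      c20 := g.c10 * g.c2 * g.c6 - g.c11 * g.c8 + g.c14 * g.c6 - g.c16 * g.c2 - g.c20 - g.c5 * g.c6 * g.c8
      c21 := g.c10 * g.c3 * g.c6 - g.c11 * g.c9 + g.c15 * g.c6 - g.c16 * g.c3 - g.c21 - g.c5 * g.c6 * g.c9
      c24 := g.c10 * g.c13 + g.c10 * g.c2 * g.c9 + g.c10 * g.c3 * g.c8 + g.c14 * g.c9 + g.c15 * g.c8 - g.c24 - g.c5 * g.c8 * g.c9 }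

@[simp] theorem one_c1 : (1 : Coord F).c1 = 0 := rfl

@[simp] theorem one_c2 : (1 : Coord F).c2 = 0 := rfl

@[simp] theorem one_c3 : (1 : Coord F).c3 = 0 := rfl

@[simp] theorem one_c5 : (1 : Coord F).c5 = 0 := rfl

@[simp] theorem one_c6 : (1 : Coord F).c6 = 0 := rfl

@[simp] theorem one_c8 : (1 : Coord F).c8 = 0 := rfl

@[simp] theorem one_c9 : (1 : Coord F).c9 = 0 := rfl

@[simp] theorem one_c10 : (1 : Coord F).c10 = 0 := rfl

@[simp] theorem one_c7 : (1 : Coord F).c7 = 0 := rfl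

@[simp] theorem one_c11 : (1 : Coord F).c11 = 0 := rfl

@[simp] theorem one_c12 : (1 : Coord F).c12 = 0 := rfl

@[simp] theorem one_c13 : (1 : Coord F).c13 = 0 := rfl

@[simp] theorem one_c14 : (1 : Coord F).c14 = 0 := rfl

@[simp] theorem one_c15 : (1 : Coord F).c15 = 0 := rfl

@[simp] theorem one_c16 : (1 : Coord F).c16 = 0 := rfl

@[simp] theorem one_c17 : (1 : Coord F).c17 = 0 := rfl

@[simp] theorem one_c18 : (1 : Coord F).c18 = 0 := rfl

@[simp] theorem one_c20 : (1 : Coord F).c20 = 0 := rfl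

@[simp] theorem one_c21 : (1 : Coord F).c21 = 0 := rfl

@[simp] theorem one_c24 : (1 : Coord F).c24 = 0 := rfl

@[simp] theorem mul_c1 (g h : Coord F) :
    (g * h).c1 = g.c1 + h.c1 := rfl

@[simp] theorem mul_c2 (g h : Coord F) :
    (g * h).c2 = g.c2 + h.c2 := rfl

@[simp] theorem mul_c3 (g h : Coord F) :
    (g * h).c3 = g.c3 + h.c3 := rfl

@[simp] theorem mul_c5 (g h : Coord F) :
    (g * h).c5 = g.c5 + h.c5 := rfl

@[simp] theorem mul_c6 (g h : Coord F) :
    (g * h).c6 = g.c6 + h.c6 := rfl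

@[simp] theorem mul_c8 (g h : Coord F) :
    (g * h).c8 = g.c8 + h.c8 := rfl

@[simp] theorem mul_c9 (g h : Coord F) :
    (g * h).c9 = g.c9 + h.c9 := rfl

@[simp] theorem mul_c10 (g h : Coord F) :
    (g * h).c10 = g.c10 + h.c10 := rfl

@[simp] theorem mul_c7 (g h : Coord F) :
    (g * h).c7 = -g.c3 * h.c1 + g.c7 + h.c7 := rfl

@[simp] theorem mul_c11 (g h : Coord F) :
    (g * h).c11 = g.c11 - g.c6 * h.c5 + h.c11 := rfl

@[simp] theorem mul_c12 (g h : Coord F) :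
    (g * h).c12 = g.c12 - g.c9 * h.c1 + h.c12 := rfl

@[simp] theorem mul_c13 (g h : Coord F) :
    (g * h).c13 = g.c13 - g.c8 * h.c3 - g.c9 * h.c2 + h.c13 := rfl

@[simp] theorem mul_c14 (g h : Coord F) :
    (g * h).c14 = -g.c10 * h.c2 + g.c14 + g.c8 * h.c5 + h.c14 := rfl

@[simp] theorem mul_c15 (g h : Coord F) :
    (g * h).c15 = -g.c10 * h.c3 + g.c15 + g.c9 * h.c5 + h.c15 := rfl

@[simp] theorem mul_c16 (g h : Coord F) :
    (g * h).c16 = g.c10 * h.c6 + g.c16 + h.c16 := rfl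

@[simp] theorem mul_c17 (g h : Coord F) :
    (g * h).c17 = -g.c12 * h.c2 - g.c13 * h.c1 + g.c17 - g.c3 * g.c8 * h.c1 - g.c3 * h.c1 * h.c8 + g.c7 * h.c8 + g.c9 * h.c1 * h.c2 + h.c17 := rfl

@[simp] theorem mul_c18 (g h : Coord F) :
    (g * h).c18 = -g.c10 * g.c3 * h.c1 + g.c12 * h.c5 - g.c15 * h.c1 + g.c18 - g.c3 * h.c1 * h.c10 + g.c7 * h.c10 - g.c9 * h.c1 * h.c5 + h.c18 := rfl

@[simp] theorem mul_c20 (g h : Coord F) :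
    (g * h).c20 = -g.c10 * h.c2 * h.c6 - g.c11 * h.c8 + g.c14 * h.c6 - g.c16 * h.c2 + g.c20 + g.c6 * g.c8 * h.c5 + g.c6 * h.c5 * h.c8 + g.c8 * h.c5 * h.c6 + h.c20 := rfl

@[simp] theorem mul_c21 (g h : Coord F) :
    (g * h).c21 = -g.c10 * h.c3 * h.c6 - g.c11 * h.c9 + g.c15 * h.c6 - g.c16 * h.c3 + g.c21 + g.c6 * g.c9 * h.c5 + g.c6 * h.c5 * h.c9 + g.c9 * h.c5 * h.c6 + h.c21 := rfl

@[simp] theorem mul_c24 (g h : Coord F) :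
    (g * h).c24 = -g.c10 * g.c8 * h.c3 - g.c10 * g.c9 * h.c2 - g.c10 * h.c2 * h.c9 - g.c10 * h.c3 * h.c8 + g.c13 * h.c10 + g.c14 * h.c9 + g.c15 * h.c8 + g.c24 + g.c8 * g.c9 * h.c5 - g.c8 * h.c10 * h.c3 + g.c8 * h.c5 * h.c9 - g.c9 * h.c10 * h.c2 + g.c9 * h.c5 * h.c8 + h.c24 := rfl

@[simp] theorem inv_c1 (g : Coord F) : g⁻¹.c1 =
    -g.c1 := rfl

@[simp] theorem inv_c2 (g : Coord F) : g⁻¹.c2 =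
    -g.c2 := rfl

@[simp] theorem inv_c3 (g : Coord F) : g⁻¹.c3 =
    -g.c3 := rfl

@[simp] theorem inv_c5 (g : Coord F) : g⁻¹.c5 =
    -g.c5 := rfl

@[simp] theorem inv_c6 (g : Coord F) : g⁻¹.c6 =
    -g.c6 := rfl

@[simp] theorem inv_c8 (g : Coord F) : g⁻¹.c8 =
    -g.c8 := rfl

@[simp] theorem inv_c9 (g : Coord F) : g⁻¹.c9 =
    -g.c9 := rfl

@[simp] theorem inv_c10 (g : Coord F) : g⁻¹.c10 =
    -g.c10 := rfl

@[simp] theorem inv_c7 (g : Coord F) : g⁻¹.c7 =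
    -g.c1 * g.c3 - g.c7 := rfl

@[simp] theorem inv_c11 (g : Coord F) : g⁻¹.c11 =
    -g.c11 - g.c5 * g.c6 := rfl

@[simp] theorem inv_c12 (g : Coord F) : g⁻¹.c12 =
    -g.c1 * g.c9 - g.c12 := rfl

@[simp] theorem inv_c13 (g : Coord F) : g⁻¹.c13 =
    -g.c13 - g.c2 * g.c9 - g.c3 * g.c8 := rfl

@[simp] theorem inv_c14 (g : Coord F) : g⁻¹.c14 =
    -g.c10 * g.c2 - g.c14 + g.c5 * g.c8 := rfl

@[simp] theorem inv_c15 (g : Coord F) : g⁻¹.c15 =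
    -g.c10 * g.c3 - g.c15 + g.c5 * g.c9 := rfl

@[simp] theorem inv_c16 (g : Coord F) : g⁻¹.c16 =
    g.c10 * g.c6 - g.c16 := rfl

@[simp] theorem inv_c17 (g : Coord F) : g⁻¹.c17 =
    -g.c1 * g.c13 - g.c1 * g.c2 * g.c9 - g.c12 * g.c2 - g.c17 + g.c7 * g.c8 := rfl

@[simp] theorem inv_c18 (g : Coord F) : g⁻¹.c18 =
    -g.c1 * g.c15 + g.c1 * g.c5 * g.c9 + g.c10 * g.c7 + g.c12 * g.c5 - g.c18 := rfl

@[simp] theorem inv_c20 (g : Coord F) : g⁻¹.c20 =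
    g.c10 * g.c2 * g.c6 - g.c11 * g.c8 + g.c14 * g.c6 - g.c16 * g.c2 - g.c20 - g.c5 * g.c6 * g.c8 := rfl

@[simp] theorem inv_c21 (g : Coord F) : g⁻¹.c21 =
    g.c10 * g.c3 * g.c6 - g.c11 * g.c9 + g.c15 * g.c6 - g.c16 * g.c3 - g.c21 - g.c5 * g.c6 * g.c9 := rfl

@[simp] theorem inv_c24 (g : Coord F) : g⁻¹.c24 =
    g.c10 * g.c13 + g.c10 * g.c2 * g.c9 + g.c10 * g.c3 * g.c8 + g.c14 * g.c9 + g.c15 * g.c8 - g.c24 - g.c5 * g.c8 * g.c9 := rfl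

instance : Group (Coord F) :=
  Group.ofLeftAxioms
    (fun a b c => by ext <;> simp only [mul_c1, mul_c2, mul_c3, mul_c5, mul_c6, mul_c8, mul_c9, mul_c10, mul_c7, mul_c11, mul_c12, mul_c13, mul_c14, mul_c15, mul_c16, mul_c17, mul_c18, mul_c20, mul_c21, mul_c24] <;> ring)
    (fun a => by ext <;> simp only [mul_c1, mul_c2, mul_c3, mul_c5, mul_c6, mul_c8, mul_c9, mul_c10, mul_c7, mul_c11, mul_c12, mul_c13, mul_c14, mul_c15, mul_c16, mul_c17, mul_c18, mul_c20, mul_c21, mul_c24, one_c1, one_c2, one_c3, one_c5, one_c6, one_c8, one_c9, one_c10, one_c7, one_c11, one_c12, one_c13, one_c14, one_c15, one_c16, one_c17, one_c18, one_c20, one_c21, one_c24] <;> ring)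
    (fun a => by ext <;> simp only [mul_c1, mul_c2, mul_c3, mul_c5, mul_c6, mul_c8, mul_c9, mul_c10, mul_c7, mul_c11, mul_c12, mul_c13, mul_c14, mul_c15, mul_c16, mul_c17, mul_c18, mul_c20, mul_c21, mul_c24, one_c1, one_c2, one_c3, one_c5, one_c6, one_c8, one_c9, one_c10, one_c7, one_c11, one_c12, one_c13, one_c14, one_c15, one_c16, one_c17, one_c18, one_c20, one_c21, one_c24, inv_c1, inv_c2, inv_c3, inv_c5, inv_c6, inv_c8, inv_c9, inv_c10, inv_c7, inv_c11, inv_c12, inv_c13, inv_c14, inv_c15, inv_c16, inv_c17, inv_c18, inv_c20, inv_c21, inv_c24] <;> ring)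

end Coord

/-! ### Root sums and structure constants. -/

section Bracket

/-- The index of the sum of two roots and the structure constant, for the pairs of roots whose sum
is needed; the value for the other pairs is `(35, 0)`. -/
def brk (i j : Fin 36) : Fin 36 × ℤ :=
  match i.val, j.val with
  | 0, 2 => (6, 1)
  | 0, 8 => (11, 1)
  | 0, 12 => (16, 1)
  | 0, 14 => (17, 1)
  | 1, 8 => (12, 1)
  | 1, 9 => (13, 1)
  | 1, 11 => (16, 1)
  | 1, 14 => (18, 1)
  | 1, 15 => (19, 1)
  | 2, 7 => (12, 1)
  | 2, 9 => (14, 1)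
  | 2, 13 => (18, 1)
  | 2, 15 => (20, 1)
  | 4, 5 => (10, 1)
  | 4, 7 => (13, -1)
  | 4, 8 => (14, -1)
  | 4, 11 => (17, -1)
  | 4, 12 => (18, -1)
  | 5, 9 => (15, -1)
  | 5, 13 => (19, -1)
  | 5, 14 => (20, -1)
  | 6, 7 => (16, 1)
  | 6, 9 => (17, 1)
  | 7, 10 => (19, 1)
  | 7, 14 => (23, -1)
  | 8, 10 => (20, 1)
  | 8, 13 => (23, -1)
  | 9, 12 => (23, -1)
  | _, _ => (35, 0)

/-- The roots of the core, and `α_19`. -/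
def coreR : Finset (Fin 36) :=
  {0, 1, 2, 4, 5, 6, 7, 8, 9, 10, 11, 12, 13, 14, 15, 16, 17, 18, 19, 20, 23}

/-- The coefficient vector of a root, as the list of digits of a natural number. -/
def rootCode : Fin 36 → ℕ :=
  ![1, 4, 16, 64, 256, 1024, 17, 68, 80, 320, 1280, 81, 84, 324, 336, 1344, 85, 337, 340, 1348, 1360, 341, 1361, 404, 1364, 405, 1365, 1428, 421, 1429, 1684, 1445, 1685, 1701, 1765, 1769]

theorem rootCode_eq : ∀ i, rootCode i = rootVec i 0 + 4 * rootVec i 1 + 16 * rootVec i 2 +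
    64 * rootVec i 3 + 256 * rootVec i 4 + 1024 * rootVec i 5 := by decide +kernel

theorem rootCode_add {i j k : Fin 36} (h : IsSum i j k) :
    rootCode i + rootCode j = rootCode k := by
  rw [rootCode_eq, rootCode_eq, rootCode_eq, ← h 0, ← h 1, ← h 2, ← h 3, ← h 4, ← h 5]
  ring

theorem IsSum.comm {i j k : Fin 36} (h : IsSum i j k) : IsSum j i k :=
  fun a => (add_comm _ _).trans (h a)

/-- The root with a given code; the residues of the codes modulo `82` are distinct. -/
def rootOfCode (n : ℕ) : Fin 36 :=
  Fin.ofNat 36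
    (2222695177711511366533015114858913778464224618566882496824644052330193501921335656257551009696897422747887086278513657927097156462125736876589498368 /
      64 ^ (n % 82) % 64)

theorem rootOfCode_rootCode : ∀ i, rootOfCode (rootCode i) = i := by
  decide +kernel

/-- The code of a sum determines the third root, so a statement about triples is decided by running
through the 36² pairs. -/
theorem forall_rootCode_add {Q : Fin 36 → Fin 36 → Fin 36 → Prop}
    (h : ∀ i j, rootCode (rootOfCode (rootCode i + rootCode j)) = rootCode i + rootCode j →
      Q i j (rootOfCode (rootCode i + rootCode j))) (i j k : Fin 36)
    (hk : rootCode i + rootCode j = rootCode k) : Q i j k := by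
  have := h i j
  rw [hk, rootOfCode_rootCode] at this
  exact this rfl

/-- In the second alternative the sum is a root whose elements are trivial in the model, even after
conjugation by x_4(c). Antisymmetry in the first one makes it enough to tabulate pairs with `i < j`.
-/
theorem brk_of_rootCode_add {i : Fin 36} (hi : i ∈ coreR) {j : Fin 36} (hj : j ∈ coreR)
    (hij : i < j) {k : Fin 36} (hk : rootCode i + rootCode j = rootCode k) :
    brk i j = (k, structConst i j k) ∧ structConst j i k = - structConst i j k ∨
      k ∉ coreR ∧ k ≠ ix 4 ∧ brk i j = (35, 0) :=
  forall_rootCode_add (Q := fun i j k => i ∈ coreR → j ∈ coreR → i < j →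
    brk i j = (k, structConst i j k) ∧ structConst j i k = - structConst i j k ∨
      k ∉ coreR ∧ k ≠ ix 4 ∧ brk i j = (35, 0)) (by decide +kernel) i j k hk hi hj hij

theorem notMem_coreR_of_rootCode_add {i : Fin 36} (hi : i ∉ coreR) (hi4 : i ≠ ix 4)
    {j k : Fin 36} (hk : rootCode i + rootCode j = rootCode k) (hj4 : j ≠ ix 4) :
    k ∉ coreR ∧ k ≠ ix 4 :=
  forall_rootCode_add (Q := fun i j k => i ∉ coreR → i ≠ ix 4 → j ≠ ix 4 →
    k ∉ coreR ∧ k ≠ ix 4) (by decide +kernel) i j k hk hi hi4 hj4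

theorem exists_isSum_of_brk_ne : ∀ i j, brk i j ≠ (35, 0) → ∃ k, IsSum i j k := by
  decide +kernel

end Bracket

/-! ### Root elements conjugated by x_4(c), in coordinates. -/

section TwistedElements

variable {F : Type*} [Field F]

/-- The element `x_4(c)⁻¹ x_i(t) x_4(c)` of `X_S`, for a root `α_i ≠ α_4`. -/
def tw (c : F) (i : Fin 36) (t : F) : Coord F :=
  match i.val with
  | 0 => ⟨t, 0, 0, 0, 0, 0, 0, 0, 0, 0, 0, 0, 0, 0, 0, 0, 0, 0, 0, 0⟩
  | 1 => ⟨0, t, 0, 0, 0, c * t, 0, 0, 0, 0, 0, 0, 0, 0, 0, 0, 0, 0, 0, 0⟩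
  | 2 => ⟨0, 0, t, 0, 0, 0, c * t, 0, 0, 0, 0, 0, 0, 0, 0, 0, 0, 0, 0, 0⟩
  | 4 => ⟨0, 0, 0, t, 0, 0, 0, -(c * t), 0, 0, 0, 0, 0, 0, 0, 0, 0, 0, 0, 0⟩
  | 5 => ⟨0, 0, 0, 0, t, 0, 0, 0, 0, 0, 0, 0, 0, 0, 0, 0, 0, 0, 0, 0⟩
  | 6 => ⟨0, 0, 0, 0, 0, 0, 0, 0, t, 0, c * t, 0, 0, 0, 0, 0, 0, 0, 0, 0⟩
  | 7 => ⟨0, 0, 0, 0, 0, t, 0, 0, 0, 0, 0, 0, 0, 0, 0, 0, 0, 0, 0, 0⟩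
  | 8 => ⟨0, 0, 0, 0, 0, 0, t, 0, 0, 0, 0, 0, 0, 0, 0, 0, 0, 0, 0, 0⟩
  | 9 => ⟨0, 0, 0, 0, 0, 0, 0, t, 0, 0, 0, 0, 0, 0, 0, 0, 0, 0, 0, 0⟩
  | 10 => ⟨0, 0, 0, 0, 0, 0, 0, 0, 0, t, 0, 0, 0, 0, -(c * t), 0, 0, 0, 0, 0⟩
  | 11 => ⟨0, 0, 0, 0, 0, 0, 0, 0, 0, 0, t, 0, 0, 0, 0, 0, 0, 0, 0, 0⟩
  | 12 => ⟨0, 0, 0, 0, 0, 0, 0, 0, 0, 0, 0, t, 0, 0, 0, 0, 0, 0, 0, 0⟩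
  | 13 => ⟨0, 0, 0, 0, 0, 0, 0, 0, 0, 0, 0, 0, t, 0, 0, 0, 0, 0, 0, 0⟩
  | 14 => ⟨0, 0, 0, 0, 0, 0, 0, 0, 0, 0, 0, 0, 0, t, 0, 0, 0, 0, 0, 0⟩
  | 15 => ⟨0, 0, 0, 0, 0, 0, 0, 0, 0, 0, 0, 0, 0, 0, t, 0, 0, 0, 0, 0⟩
  | 16 => ⟨0, 0, 0, 0, 0, 0, 0, 0, 0, 0, 0, 0, 0, 0, 0, t, 0, 0, 0, 0⟩
  | 17 => ⟨0, 0, 0, 0, 0, 0, 0, 0, 0, 0, 0, 0, 0, 0, 0, 0, t, 0, 0, 0⟩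
  | 19 => ⟨0, 0, 0, 0, 0, 0, 0, 0, 0, 0, 0, 0, 0, 0, 0, 0, 0, t, 0, 0⟩
  | 20 => ⟨0, 0, 0, 0, 0, 0, 0, 0, 0, 0, 0, 0, 0, 0, 0, 0, 0, 0, t, 0⟩
  | 23 => ⟨0, 0, 0, 0, 0, 0, 0, 0, 0, 0, 0, 0, 0, 0, 0, 0, 0, 0, 0, t⟩
  -- `α_19` lies in `K`, but `α_19 + α_4 = α_24` does not: x_4(c) does not normalise X_K, and this
  -- conjugate is nontrivial when `c` and `t` are nonzero.
  | 18 => ⟨0, 0, 0, 0, 0, 0, 0, 0, 0, 0, 0, 0, 0, 0, 0, 0, 0, 0, 0, -(c * t)⟩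
  | _ => 1

theorem tw_ix1 (c t : F) : tw c 0 t =
    ⟨t, 0, 0, 0, 0, 0, 0, 0, 0, 0, 0, 0, 0, 0, 0, 0, 0, 0, 0, 0⟩ := rfl

theorem tw_ix2 (c t : F) : tw c 1 t =
    ⟨0, t, 0, 0, 0, c * t, 0, 0, 0, 0, 0, 0, 0, 0, 0, 0, 0, 0, 0, 0⟩ := rfl

theorem tw_ix3 (c t : F) : tw c 2 t =
    ⟨0, 0, t, 0, 0, 0, c * t, 0, 0, 0, 0, 0, 0, 0, 0, 0, 0, 0, 0, 0⟩ := rfl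

theorem tw_ix5 (c t : F) : tw c 4 t =
    ⟨0, 0, 0, t, 0, 0, 0, -(c * t), 0, 0, 0, 0, 0, 0, 0, 0, 0, 0, 0, 0⟩ := rfl

theorem tw_ix6 (c t : F) : tw c 5 t =
    ⟨0, 0, 0, 0, t, 0, 0, 0, 0, 0, 0, 0, 0, 0, 0, 0, 0, 0, 0, 0⟩ := rfl

theorem tw_ix7 (c t : F) : tw c 6 t =
    ⟨0, 0, 0, 0, 0, 0, 0, 0, t, 0, c * t, 0, 0, 0, 0, 0, 0, 0, 0, 0⟩ := rfl

theorem tw_ix8 (c t : F) : tw c 7 t =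
    ⟨0, 0, 0, 0, 0, t, 0, 0, 0, 0, 0, 0, 0, 0, 0, 0, 0, 0, 0, 0⟩ := rfl

theorem tw_ix9 (c t : F) : tw c 8 t =
    ⟨0, 0, 0, 0, 0, 0, t, 0, 0, 0, 0, 0, 0, 0, 0, 0, 0, 0, 0, 0⟩ := rfl

theorem tw_ix10 (c t : F) : tw c 9 t =
    ⟨0, 0, 0, 0, 0, 0, 0, t, 0, 0, 0, 0, 0, 0, 0, 0, 0, 0, 0, 0⟩ := rfl

theorem tw_ix11 (c t : F) : tw c 10 t =
    ⟨0, 0, 0, 0, 0, 0, 0, 0, 0, t, 0, 0, 0, 0, -(c * t), 0, 0, 0, 0, 0⟩ := rfl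

theorem tw_ix12 (c t : F) : tw c 11 t =
    ⟨0, 0, 0, 0, 0, 0, 0, 0, 0, 0, t, 0, 0, 0, 0, 0, 0, 0, 0, 0⟩ := rfl

theorem tw_ix13 (c t : F) : tw c 12 t =
    ⟨0, 0, 0, 0, 0, 0, 0, 0, 0, 0, 0, t, 0, 0, 0, 0, 0, 0, 0, 0⟩ := rfl

theorem tw_ix14 (c t : F) : tw c 13 t =
    ⟨0, 0, 0, 0, 0, 0, 0, 0, 0, 0, 0, 0, t, 0, 0, 0, 0, 0, 0, 0⟩ := rfl

theorem tw_ix15 (c t : F) : tw c 14 t =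
    ⟨0, 0, 0, 0, 0, 0, 0, 0, 0, 0, 0, 0, 0, t, 0, 0, 0, 0, 0, 0⟩ := rfl

theorem tw_ix16 (c t : F) : tw c 15 t =
    ⟨0, 0, 0, 0, 0, 0, 0, 0, 0, 0, 0, 0, 0, 0, t, 0, 0, 0, 0, 0⟩ := rfl

theorem tw_ix17 (c t : F) : tw c 16 t =
    ⟨0, 0, 0, 0, 0, 0, 0, 0, 0, 0, 0, 0, 0, 0, 0, t, 0, 0, 0, 0⟩ := rfl

theorem tw_ix18 (c t : F) : tw c 17 t =
    ⟨0, 0, 0, 0, 0, 0, 0, 0, 0, 0, 0, 0, 0, 0, 0, 0, t, 0, 0, 0⟩ := rfl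

theorem tw_ix20 (c t : F) : tw c 19 t =
    ⟨0, 0, 0, 0, 0, 0, 0, 0, 0, 0, 0, 0, 0, 0, 0, 0, 0, t, 0, 0⟩ := rfl

theorem tw_ix21 (c t : F) : tw c 20 t =
    ⟨0, 0, 0, 0, 0, 0, 0, 0, 0, 0, 0, 0, 0, 0, 0, 0, 0, 0, t, 0⟩ := rfl

theorem tw_ix24 (c t : F) : tw c 23 t =
    ⟨0, 0, 0, 0, 0, 0, 0, 0, 0, 0, 0, 0, 0, 0, 0, 0, 0, 0, 0, t⟩ := rfl

theorem tw_ix19 (c t : F) : tw c 18 t =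
    ⟨0, 0, 0, 0, 0, 0, 0, 0, 0, 0, 0, 0, 0, 0, 0, 0, 0, 0, 0, -(c * t)⟩ := rfl

theorem Coord.mk_mul_mk
    (g1 g2 g3 g5 g6 g8 g9 g10 g7 g11 g12 g13 g14 g15 g16 g17 g18 g20 g21 g24
      h1 h2 h3 h5 h6 h8 h9 h10 h7 h11 h12 h13 h14 h15 h16 h17 h18 h20 h21 h24 : F) :
    (⟨g1, g2, g3, g5, g6, g8, g9, g10, g7, g11, g12, g13, g14, g15, g16, g17, g18, g20, g21, g24⟩ *
      ⟨h1, h2, h3, h5, h6, h8, h9, h10, h7, h11, h12, h13, h14, h15, h16, h17, h18, h20, h21, h24⟩ : Coord F) =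
    ⟨g1 + h1,
      g2 + h2,
      g3 + h3,
      g5 + h5,
      g6 + h6,
      g8 + h8,
      g9 + h9,
      g10 + h10,
      -g3 * h1 + g7 + h7,
      g11 - g6 * h5 + h11,
      g12 - g9 * h1 + h12,
      g13 - g8 * h3 - g9 * h2 + h13,
      -g10 * h2 + g14 + g8 * h5 + h14,
      -g10 * h3 + g15 + g9 * h5 + h15,
      g10 * h6 + g16 + h16,
      -g12 * h2 - g13 * h1 + g17 - g3 * g8 * h1 - g3 * h1 * h8 + g7 * h8 + g9 * h1 * h2 + h17,
      -g10 * g3 * h1 + g12 * h5 - g15 * h1 + g18 - g3 * h1 * h10 + g7 * h10 - g9 * h1 * h5 + h18,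
      -g10 * h2 * h6 - g11 * h8 + g14 * h6 - g16 * h2 + g20 + g6 * g8 * h5 + g6 * h5 * h8 + g8 * h5 * h6 + h20,
      -g10 * h3 * h6 - g11 * h9 + g15 * h6 - g16 * h3 + g21 + g6 * g9 * h5 + g6 * h5 * h9 + g9 * h5 * h6 + h21,
      -g10 * g8 * h3 - g10 * g9 * h2 - g10 * h2 * h9 - g10 * h3 * h8 + g13 * h10 + g14 * h9 + g15 * h8 + g24 + g8 * g9 * h5 - g8 * h10 * h3 + g8 * h5 * h9 - g9 * h10 * h2 + g9 * h5 * h8 + h24⟩ := rfl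

theorem tw_eq_one (c : F) {i : Fin 36} (hi : i ∉ coreR) (t : F) : tw c i t = 1 := by
  revert hi
  fin_cases i <;> first | (intro _; rfl) | (intro h; exact absurd (by decide) h)

theorem tw_add (c : F) (i : Fin 36) (s t : F) : tw c i s * tw c i t = tw c i (s + t) := by
  by_cases hi : i ∈ coreR
  · simp only [coreR, Finset.mem_insert, Finset.mem_singleton] at hi
    rcases hi with rfl | rfl | rfl | rfl | rfl | rfl | rfl | rfl | rfl | rfl | rfl | rfl | rfl | rfl | rfl | rfl
    | rfl | rfl | rfl | rfl | rfl <;>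
    simp only [tw_ix1, tw_ix2, tw_ix3, tw_ix5, tw_ix6, tw_ix7, tw_ix8, tw_ix9, tw_ix10, tw_ix11, tw_ix12,
    tw_ix13, tw_ix14, tw_ix15, tw_ix16, tw_ix17, tw_ix18, tw_ix20, tw_ix21, tw_ix24, tw_ix19,
      Coord.mk_mul_mk, mul_zero, zero_mul, sub_zero, add_zero, zero_add, neg_zero] <;>
    congr 1 <;> ring
  · simp [tw_eq_one c hi]

-- Conjugation by x_4(c) is an automorphism, so the constants do not depend on `c`. For the default
-- value `(35, 0)` the last factor is trivial, because index 35 is outside `coreR`, and the identity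
-- says that the elements commute.
set_option maxHeartbeats 8000000 in
theorem tw_mul_tw_of_mem (c : F) {i j : Fin 36} (hi : i ∈ coreR) (hj : j ∈ coreR) (hij : i < j)
    (s r : F) {k : Fin 36} {e : ℤ} (hk : brk i j = (k, e)) :
    tw c i s * tw c j r = tw c j r * tw c i s * tw c k (e * s * r) := by
  simp only [coreR, Finset.mem_insert, Finset.mem_singleton] at hi hj
  rcases hi with rfl | rfl | rfl | rfl | rfl | rfl | rfl | rfl | rfl | rfl | rfl | rfl | rfl | rfl | rfl | rfl
    | rfl | rfl | rfl | rfl | rfl <;>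
  rcases hj with rfl | rfl | rfl | rfl | rfl | rfl | rfl | rfl | rfl | rfl | rfl | rfl | rfl | rfl | rfl | rfl
    | rfl | rfl | rfl | rfl | rfl <;>
  first
  | exact absurd hij (by decide)
  | (injection hk with h1 h2
     subst h1
     subst h2
     simp only [tw_ix1, tw_ix2, tw_ix3, tw_ix5, tw_ix6, tw_ix7, tw_ix8, tw_ix9, tw_ix10, tw_ix11, tw_ix12,
    tw_ix13, tw_ix14, tw_ix15, tw_ix16, tw_ix17, tw_ix18, tw_ix20, tw_ix21, tw_ix24, tw_ix19,
       tw_eq_one c (show 35 ∉ coreR by decide), Coord.mk_mul_mk, mul_one, Int.cast_one,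
       Int.cast_neg, neg_mul, one_mul,
       mul_zero, zero_mul, sub_zero, add_zero, zero_add, neg_zero] <;> congr 1 <;> ring1)

end TwistedElements

/-! ### Root sums involving `α_4`. -/

section BracketFour

/-- The analogue of `brk` for the sums of `α_4` and another root. -/
def brkFour (j : Fin 36) : Fin 36 × ℤ :=
  match j.val with
  | 1 => (7, -1)
  | 2 => (8, -1)
  | 4 => (9, 1)
  | 6 => (11, -1)
  | 10 => (15, 1)
  | 18 => (23, 1)
  | _ => (35, 0)

theorem brkFour_of_rootCode_add : ∀ j k, rootCode 3 + rootCode j = rootCode k →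
    k ≠ 3 ∧ (j ∈ coreR ∧ brkFour j = (k, structConst 3 j k) ∧
      structConst j 3 k = - structConst 3 j k ∨ j ∉ coreR ∧ k ∉ coreR) := by
  decide +kernel

theorem exists_isSum_of_brkFour_ne : ∀ j, brkFour j ≠ (35, 0) → ∃ k, IsSum 3 j k := by
  decide +kernel

theorem rootCode_add_ne_three : ∀ i j, rootCode i + rootCode j ≠ rootCode 3 := by
  decide +kernel

theorem rootCode_add_self_ne (i k : Fin 36) : rootCode i + rootCode i ≠ rootCode k := fun h =>
  forall_rootCode_add (Q := fun i j _ => i ≠ j) (by decide +kernel) i i k h rfl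

end BracketFour

/-! ### The action of U on the cosets of X_K, and the homomorphism from X_S to the model. -/

section Action

variable {F : Type*} [Field F]

theorem tw_zero (c : F) (i : Fin 36) : tw c i 0 = 1 := by
  have h := tw_add c i 0 0
  rwa [add_zero, mul_eq_left] at h

/-- The conjugates of x_j(r) by x_4(c) and x_4(c + s) differ by a commutator with x_4(s). This is
what the Chevalley relations for `α_4` demand of `act`. -/
theorem tw_shift (c s r : F) {j : Fin 36} (hj : j ∈ coreR) {k : Fin 36} {e : ℤ}
    (hk : brkFour j = (k, e)) : tw c j r = tw (c + s) j r * tw c k (e * s * r) := by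
  simp only [coreR, Finset.mem_insert, Finset.mem_singleton] at hj
  rcases hj with rfl | rfl | rfl | rfl | rfl | rfl | rfl | rfl | rfl | rfl | rfl | rfl | rfl |
    rfl | rfl | rfl | rfl | rfl | rfl | rfl | rfl <;>
  (injection hk with h1 h2
   subst h1
   subst h2
   simp only [tw_ix1, tw_ix2, tw_ix3, tw_ix5, tw_ix6, tw_ix7, tw_ix8, tw_ix9, tw_ix10, tw_ix11,
     tw_ix12, tw_ix13, tw_ix14, tw_ix15, tw_ix16, tw_ix17, tw_ix18, tw_ix20, tw_ix21, tw_ix24,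
     tw_ix19, tw_eq_one c (show 35 ∉ coreR by decide), Coord.mk_mul_mk, mul_one, Int.cast_one,
     Int.cast_neg, neg_mul, one_mul,
     mul_zero, zero_mul, sub_zero, add_zero, zero_add, neg_zero] <;> congr 1 <;> ring1)

theorem tw_mul_tw_of_isSum (c : F) {i j k : Fin 36} (h : IsSum i j k) (hi : i ≠ 3) (hj : j ≠ 3)
    (s r : F) :
    k ≠ 3 ∧ tw c i s * tw c j r = tw c j r * tw c i s * tw c k (structConst i j k * s * r) := by
  have hc := rootCode_add h
  by_cases hiR : i ∈ coreR
  · by_cases hjR : j ∈ coreR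
    · rcases lt_trichotomy i j with hij | rfl | hij
      · rcases brk_of_rootCode_add hiR hjR hij hc with ⟨h1, -⟩ | ⟨h1, h2, h3⟩
        · refine ⟨?_, tw_mul_tw_of_mem c hiR hjR hij s r h1⟩
          rintro rfl
          exact rootCode_add_ne_three _ _ hc
        · refine ⟨h2, ?_⟩
          rw [tw_mul_tw_of_mem c hiR hjR hij s r h3, tw_eq_one c h1, tw_eq_one c (show (35 : Fin 36) ∉ coreR by decide)]
      · exact absurd hc (rootCode_add_self_ne i k)
      · have hc' := rootCode_add h.comm
        rcases brk_of_rootCode_add hjR hiR hij hc' with ⟨h1, h4⟩ | ⟨h1, h2, h3⟩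
        · refine ⟨?_, ?_⟩
          · rintro rfl
            exact rootCode_add_ne_three _ _ hc
          -- Here `j < i`, and the table gives the reverse commutator; the two factors cancel by
          -- antisymmetry of the structure constants.
          · rw [tw_mul_tw_of_mem c hjR hiR hij r s h1, h4, mul_assoc, tw_add]
            push_cast
            rw [show (structConst j i k : F) * r * s + -(structConst j i k : F) * s * r = 0 by ring,
              tw_zero, mul_one]
        · refine ⟨h2, ?_⟩
          rw [tw_mul_tw_of_mem c hjR hiR hij r s h3, tw_eq_one c h1, tw_eq_one c (show (35 : Fin 36) ∉ coreR by decide)]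
          simp
    · obtain ⟨h1, h2⟩ := notMem_coreR_of_rootCode_add hjR hj (rootCode_add h.comm) hi
      exact ⟨h2, by simp [tw_eq_one c h1, tw_eq_one c hjR]⟩
  · obtain ⟨h1, h2⟩ := notMem_coreR_of_rootCode_add hiR hi hc hj
    exact ⟨h2, by simp [tw_eq_one c h1, tw_eq_one c hiR]⟩

theorem tw_mul_tw_of_not_isSum (c : F) {i j : Fin 36} (h : ∀ k, ¬ IsSum i j k)
    (s r : F) : tw c i s * tw c j r = tw c j r * tw c i s := by
  have key : ∀ i j : Fin 36, (∀ k, ¬ IsSum i j k) → i ∈ coreR → j ∈ coreR → i < j → ∀ s r,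
      tw c i s * tw c j r = tw c j r * tw c i s := by
    intro i j h hi hj hij s r
    have hb : brk i j = (35, 0) := by
      by_contra hne
      obtain ⟨k, hk⟩ := exists_isSum_of_brk_ne i j hne
      exact h k hk
    rw [tw_mul_tw_of_mem c hi hj hij s r hb, tw_eq_one c (show (35 : Fin 36) ∉ coreR by decide), mul_one]
  by_cases hiR : i ∈ coreR
  · by_cases hjR : j ∈ coreR
    · rcases lt_trichotomy i j with hij | rfl | hij
      · exact key i j h hiR hjR hij s r
      · rw [tw_add, tw_add, add_comm]
      · exact (key j i (fun k hk => h k hk.comm) hjR hiR hij r s).symm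
    · simp [tw_eq_one c hjR]
  · simp [tw_eq_one c hiR]

/-- The permutations by which the root elements act on the cosets of `X_K`; the pair `(c, g)`
represents the coset of `x_4(c) g`. -/
def act (i : Fin 36) (t : F) : Equiv.Perm (F × Coord F) where
  -- Index 3 is `α_4`. For the other roots, x_i(t) x_4(c) g = x_4(c) · (x_4(c)⁻¹ x_i(t) x_4(c)) · g.
  toFun p := if i = 3 then (p.1 + t, p.2) else (p.1, tw p.1 i t * p.2)
  invFun p := if i = 3 then (p.1 - t, p.2) else (p.1, (tw p.1 i t)⁻¹ * p.2)
  left_inv p := by by_cases h : i = 3 <;> simp [h]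
  right_inv p := by by_cases h : i = 3 <;> simp [h]

theorem act_three (t c : F) (g : Coord F) : act 3 t (c, g) = (c + t, g) := rfl

theorem act_of_ne {i : Fin 36} (hi : i ≠ 3) (t c : F) (g : Coord F) :
    act i t (c, g) = (c, tw c i t * g) := if_neg hi

theorem act_add (i : Fin 36) (s t : F) : act i s * act i t = act i (s + t) := by
  ext1 ⟨c, g⟩
  by_cases h : i = 3
  · subst h
    simp only [Equiv.Perm.mul_apply, act_three, add_assoc, add_comm t s]
  · simp only [Equiv.Perm.mul_apply, act_of_ne h, ← tw_add, mul_assoc]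

theorem act_zero (i : Fin 36) : act i (0 : F) = 1 := by
  have h := act_add i (0 : F) 0
  rwa [add_zero, mul_eq_left] at h

theorem act_mul_act_of_isSum {i j k : Fin 36} (h : IsSum i j k) (s r : F) :
    act i s * act j r = act j r * act i s * act k (structConst i j k * s * r) := by
  have key : ∀ (j k : Fin 36), IsSum 3 j k → ∀ s r : F,
      act 3 s * act j r = act j r * act 3 s * act k (structConst 3 j k * s * r) ∧
        structConst j 3 k = - structConst 3 j k ∨
      act 3 s * act j r = act j r * act 3 s ∧ ∀ t : F, act k t = 1 := by
    intro j k h s r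
    obtain ⟨hk, h1⟩ := brkFour_of_rootCode_add j k (rootCode_add h)
    have hj : j ≠ 3 := by
      rintro rfl
      exact rootCode_add_self_ne _ _ (rootCode_add h)
    rcases h1 with ⟨hjR, h1, h2⟩ | ⟨h1, h2⟩
    · refine Or.inl ⟨?_, h2⟩
      ext1 ⟨c, g⟩
      simp only [Equiv.Perm.mul_apply, act_of_ne hj, act_of_ne hk, act_three]
      rw [tw_shift c s r hjR h1, mul_assoc]
    · refine Or.inr ⟨?_, fun t => ?_⟩
      · ext1 ⟨c, g⟩
        simp only [Equiv.Perm.mul_apply, act_of_ne hj, act_three, tw_eq_one _ h1]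
      · ext1 ⟨c, g⟩
        simp only [act_of_ne hk, tw_eq_one _ h2, one_mul, Equiv.Perm.one_apply]
  by_cases hi : i = 3
  · subst hi
    rcases key j k h s r with ⟨h1, -⟩ | ⟨h1, h2⟩
    · exact h1
    · rw [h1, h2, mul_one]
  · by_cases hj : j = 3
    · subst hj
      rcases key i k h.comm r s with ⟨h1, h2⟩ | ⟨h1, h2⟩
      · rw [h1, h2, mul_assoc, act_add]
        push_cast
        rw [show (structConst 3 i k : F) * r * s + -(structConst 3 i k : F) * s * r = 0 by ring,
          act_zero, mul_one]
      · rw [h1, h2, mul_one]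
    · ext1 ⟨c, g⟩
      obtain ⟨hk, h1⟩ := tw_mul_tw_of_isSum c h hi hj s r
      simp only [Equiv.Perm.mul_apply, act_of_ne hi, act_of_ne hj, act_of_ne hk]
      rw [← mul_assoc, h1, mul_assoc, mul_assoc]

theorem act_mul_act_of_not_isSum {i j : Fin 36} (h : ∀ k, ¬ IsSum i j k) (s r : F) :
    act i s * act j r = act j r * act i s := by
  have key : ∀ j : Fin 36, (∀ k, ¬ IsSum 3 j k) → j ≠ 3 → ∀ s r : F,
      act 3 s * act j r = act j r * act 3 s := by
    intro j h hj s r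
    have hb : brkFour j = (35, 0) := by
      by_contra hne
      obtain ⟨k, hk⟩ := exists_isSum_of_brkFour_ne j hne
      exact h k hk
    ext1 ⟨c, g⟩
    simp only [Equiv.Perm.mul_apply, act_of_ne hj, act_three]
    by_cases hjR : j ∈ coreR
    · rw [tw_shift c s r hjR hb, tw_eq_one c (show 35 ∉ coreR by decide), mul_one]
    · rw [tw_eq_one _ hjR, tw_eq_one _ hjR]
  by_cases hi : i = 3
  · subst hi
    by_cases hj : j = 3
    · subst hj
      rw [act_add, act_add, add_comm]
    · exact key j h hj s r
  · by_cases hj : j = 3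
    · subst hj
      exact (key i (fun k hk => h k hk.comm) hi r s).symm
    · ext1 ⟨c, g⟩
      simp only [Equiv.Perm.mul_apply, act_of_ne hi, act_of_ne hj, ← mul_assoc]
      rw [tw_mul_tw_of_not_isSum c h s r]

/-- The action of `U` on the cosets of `X_K`. -/
def toPerm (F : Type*) [Field F] : U F →* Equiv.Perm (F × Coord F) :=
  PresentedGroup.toGroup (f := fun p : Fin 36 × F => act p.1 p.2) (by
    intro w hw
    cases hw with
    | add i s t => simp [act_add]
    | comm_sum i j k s r h =>
      simp only [map_mul, map_inv, FreeGroup.lift_apply_of]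
      rw [mul_inv_eq_one, mul_assoc, act_mul_act_of_isSum h]
      group
    | comm_one i j s r h =>
      simp only [map_mul, map_inv, FreeGroup.lift_apply_of]
      rw [mul_assoc, act_mul_act_of_not_isSum h]
      group)

theorem toPerm_x (i : Fin 36) (t : F) : toPerm F (x i t) = act i t :=
  PresentedGroup.toGroup.of _

/-- Generators of X_P fix the first component and act on the fibre over 0 by left translation.
Restricting the action of U in this way yields a homomorphism on X_P without a presentation of X_P.
-/
theorem exists_toPerm_apply {g : U F} (hg : g ∈ XSub F core.P) :
    ∃ m : Coord F, ∀ h, toPerm F g (0, h) = (0, m * h) := by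
  induction hg using Subgroup.closure_induction with
  | mem g hg =>
    obtain ⟨i, hi, t, rfl⟩ := hg
    exact ⟨tw 0 i t, fun h => by
      rw [toPerm_x, act_of_ne (Finset.mem_erase.mp hi).1]⟩
  | one => exact ⟨1, fun h => by simp⟩
  | mul a b _ _ ha hb =>
    obtain ⟨m, hm⟩ := ha
    obtain ⟨n, hn⟩ := hb
    exact ⟨m * n, fun h => by rw [map_mul, Equiv.Perm.mul_apply, hn, hm, mul_assoc]⟩
  | inv a _ ha =>
    obtain ⟨m, hm⟩ := ha
    exact ⟨m⁻¹, fun h => by rw [map_inv, Equiv.Perm.inv_eq_iff_eq, hm, mul_inv_cancel_left]⟩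

/-- The coordinates of the image in `X_S` of an element of `X_P`. -/
def toCoordP (F : Type*) [Field F] : XSub F core.P →* Coord F where
  toFun g := (toPerm F g (0, 1)).2
  map_one' := by simp
  map_mul' a b := by
    obtain ⟨m, hm⟩ := exists_toPerm_apply a.2
    obtain ⟨n, hn⟩ := exists_toPerm_apply b.2
    simp only [Subgroup.coe_mul, map_mul, Equiv.Perm.mul_apply, hm, hn, mul_one]

theorem toCoordP_x (i : Fin 36) (hi : i ∈ core.P) (t : F) :
    toCoordP F ⟨x i t, Subgroup.subset_closure ⟨i, hi, t, rfl⟩⟩ = tw 0 i t := by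
  change (toPerm F (x i t) (0, 1)).2 = _
  rw [toPerm_x, act_of_ne (Finset.mem_erase.mp hi).1, mul_one]

/-- `α_19` is the only root of `K` in `coreR`, and its twisted element vanishes on the fibre `c =
0`, the one used by `toCoordP`. -/
theorem tw_zero_eq_one {i : Fin 36} (hi : i ∈ core.K) (t : F) : tw 0 i t = 1 := by
  by_cases h : i = 18
  · subst h
    rw [tw_ix19, zero_mul, neg_zero]
    rfl
  · refine tw_eq_one 0 ?_ t
    revert hi h
    revert i
    decide +kernel

/-- The coordinates of an element of `X_S`. -/
def toCoord (F : Type*) [Field F] : XS F →* Coord F :=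
  QuotientGroup.lift _ (toCoordP F) (by
    rintro ⟨g, hg⟩ hK
    rw [Subgroup.mem_subgroupOf] at hK
    simp only at hK
    have : toPerm F g (0, 1) = (0, 1) := by
      clear hg
      have key : ∀ h, toPerm F g (0, h) = (0, h) := by
        induction hK using Subgroup.closure_induction with
        | mem g hg =>
          obtain ⟨i, hi, t, rfl⟩ := hg
          intro h
          rw [toPerm_x, act_of_ne (Finset.mem_erase.mp (core.K_sub hi)).1, tw_zero_eq_one hi,
            one_mul]
        | one => intro h; simp
        | mul a b _ _ ha hb => intro h; rw [map_mul, Equiv.Perm.mul_apply, hb, ha]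
        | inv a _ ha => intro h; rw [map_inv, Equiv.Perm.inv_eq_iff_eq, ha]
      exact key 1
    change (toPerm F g (0, 1)).2 = 1
    rw [this])

theorem toCoord_elt (i : Fin 36) (hi : i ∈ core.P) (t : F) :
    toCoord F (core.elt i hi t) = tw 0 i t :=
  toCoordP_x i hi t

end Action

/-! ### The upper bound q^20 for the order of X_S. -/

theorem lt_of_rootCode_add : ∀ i j k, rootCode i + rootCode j = rootCode k → i < k :=
  forall_rootCode_add (by decide +kernel)

/-- The roots of the core. -/
def coreS : Finset (Fin 36) := coreR.erase 18

theorem mem_coreK_of_notMem_coreS : ∀ i ∈ core.P, i ∉ coreS → i ∈ core.K := by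
  decide +kernel

/-- Passing from the last `n` to the last `n + 1` roots adds the root with zero-based index `35 -
n`. -/
theorem card_filter_coreS_succ : ∀ n < 36,
    (coreS.filter fun i => 36 ≤ i.val + (n + 1)).card =
      (coreS.filter fun i => 36 ≤ i.val + n).card + if Fin.ofNat 36 (35 - n) ∈ coreS then 1 else 0 := by
  decide +kernel

theorem card_filter_coreS : (coreS.filter fun i => 36 ≤ i.val + 36).card = 20 := by
  decide +kernel

section Elt

variable {F : Type*} [Field F]

theorem elt_add {i : Fin 36} (hi : i ∈ core.P) (s t : F) :
    core.elt i hi s * core.elt i hi t = core.elt i hi (s + t) :=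
  congrArg QuotientGroup.mk (Subtype.ext (x_add i s t))

theorem elt_inv {i : Fin 36} (hi : i ∈ core.P) (t : F) :
    (core.elt i hi t)⁻¹ = core.elt i hi (-t) :=
  congrArg QuotientGroup.mk (Subtype.ext (x_inv i t))

theorem elt_eq_one {i : Fin 36} (hi : i ∈ core.P) (hK : i ∈ core.K) (t : F) :
    core.elt i hi t = 1 := by
  rw [Quattern.elt, QuotientGroup.eq_one_iff, Subgroup.mem_subgroupOf]
  exact Subgroup.subset_closure ⟨i, hK, t, rfl⟩

theorem elt_comm {i j : Fin 36} (hi : i ∈ core.P) (hj : j ∈ core.P) (s r : F) :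
    (core.elt i hi s)⁻¹ * (core.elt j hj r)⁻¹ * core.elt i hi s * core.elt j hj r = 1 ∨
      ∃ (k : Fin 36) (hk : k ∈ core.P) (t : F), i < k ∧
        (core.elt i hi s)⁻¹ * (core.elt j hj r)⁻¹ * core.elt i hi s * core.elt j hj r =
          core.elt k hk t := by
  by_cases h : ∃ k, IsSum i j k
  · obtain ⟨k, hk⟩ := h
    refine Or.inr ⟨k, core.P_closed i hi j hj k hk, structConst i j k * s * r,
      lt_of_rootCode_add i j k (rootCode_add hk), ?_⟩
    exact congrArg QuotientGroup.mk (Subtype.ext (comm_sum i j k s r hk))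
  · exact Or.inl (congrArg QuotientGroup.mk
      (Subtype.ext (comm_one i j s r (fun k hk => h ⟨k, hk⟩))))

variable (F) in
/-- The subgroup of `X_S` generated by the root subgroups of the last `n` positive roots. -/
def lastRoots (n : ℕ) : Subgroup (XS F) :=
  Subgroup.closure {g | ∃ (i : Fin 36) (hi : i ∈ core.P) (t : F), 36 ≤ i.val + n ∧
    g = core.elt i hi t}

theorem elt_mem_lastRoots {n : ℕ} {i : Fin 36} (hi : i ∈ core.P) (t : F) (h : 36 ≤ i.val + n) :
    core.elt i hi t ∈ lastRoots F n :=
  Subgroup.subset_closure ⟨i, hi, t, h, rfl⟩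

theorem lastRoots_eq_top : lastRoots F 36 = ⊤ := by
  rw [eq_top_iff]
  rintro g -
  obtain ⟨⟨g, hg⟩, rfl⟩ := QuotientGroup.mk_surjective g
  induction hg using Subgroup.closure_induction with
  | mem g hg =>
    obtain ⟨i, hi, t, rfl⟩ := hg
    exact elt_mem_lastRoots hi t (by omega)
  | one => exact one_mem _
  | mul a b ha hb h1 h2 => exact mul_mem h1 h2
  | inv a ha h1 => exact inv_mem h1

/-- By `lt_of_rootCode_add`, a commutator of root elements is trivial or lies in a root subgroup of
larger index. -/
theorem conj_mem_lastRoots {n : ℕ} {j : Fin 36} (hj : j ∈ core.P) (r : F) {g : XS F}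
    (hg : g ∈ lastRoots F n) :
    (core.elt j hj r)⁻¹ * g * core.elt j hj r ∈ lastRoots F n := by
  induction hg using Subgroup.closure_induction with
  | mem g hg =>
    obtain ⟨i, hi, s, hin, rfl⟩ := hg
    have e : (core.elt j hj r)⁻¹ * core.elt i hi s * core.elt j hj r = core.elt i hi s *
        ((core.elt i hi s)⁻¹ * (core.elt j hj r)⁻¹ * core.elt i hi s * core.elt j hj r) := by group
    rw [e]
    refine mul_mem (elt_mem_lastRoots hi s hin) ?_
    rcases elt_comm hi hj s r with h | ⟨k, hk, t, hik, h⟩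
    · rw [h]; exact one_mem _
    · rw [h]; exact elt_mem_lastRoots hk t (by have : i.val < k.val := hik; omega)
  | one => simp [one_mem]
  | mul a b _ _ h1 h2 => simpa [mul_assoc] using mul_mem h1 h2
  | inv a _ h1 => simpa [mul_assoc] using inv_mem h1

instance lastRoots_normal (n : ℕ) : (lastRoots F n).Normal := by
  rw [← Subgroup.normalizer_eq_top_iff, eq_top_iff, ← lastRoots_eq_top]
  refine (Subgroup.closure_le _).mpr ?_
  rintro g ⟨j, hj, r, -, rfl⟩
  rw [SetLike.mem_coe, Subgroup.mem_normalizer_iff]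
  intro g
  refine ⟨fun h => ?_, fun h => ?_⟩
  · have := conj_mem_lastRoots hj (-r) h
    rwa [← elt_inv, inv_inv] at this
  · have := conj_mem_lastRoots hj r h
    simpa [mul_assoc] using this

-- Each root of `S` contributes a factor q, and each root of `K` nothing. The bound is phrased by a
-- covering finset because finiteness of X_S is itself deduced from it.
open Pointwise in
theorem exists_finset_lastRoots [Fintype F] (n : ℕ) (hn : n ≤ 36) : ∃ s : Finset (XS F),
    (lastRoots F n : Set (XS F)) ⊆ s ∧
      s.card ≤ Fintype.card F ^ (coreS.filter fun i => 36 ≤ i.val + n).card := by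
  classical
  induction n with
  | zero =>
    refine ⟨{1}, ?_, ?_⟩
    · have : lastRoots F 0 = ⊥ := by
        rw [lastRoots, Subgroup.closure_eq_bot_iff]
        rintro g ⟨i, -, -, h, -⟩
        omega
      simp [this]
    · rw [Finset.card_singleton]
      exact Nat.one_le_pow _ _ Fintype.card_pos
  | succ n ih =>
    obtain ⟨s, hs, hc⟩ := ih (by omega)
    set i : Fin 36 := Fin.ofNat 36 (35 - n) with hi
    have hiv : i.val = 35 - n := by
      rw [hi, Fin.val_ofNat]
      exact Nat.mod_eq_of_lt (by omega)
    have hlast : ∀ j : Fin 36, 36 ≤ j.val + (n + 1) → j = i ∨ 36 ≤ j.val + n := by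
      intro j hj
      by_cases h : 36 ≤ j.val + n
      · exact Or.inr h
      · exact Or.inl (Fin.ext (by omega))
    rw [card_filter_coreS_succ n (by omega)]
    by_cases hiS : i ∈ coreS
    · rw [if_pos hiS]
      have hiP : i ∈ core.P := by
        refine Finset.mem_erase.mpr ⟨?_, Finset.mem_univ _⟩
        rintro h
        rw [h] at hiS
        revert hiS
        decide
      let H : Subgroup (XS F) :=
        { carrier := Set.range (core.elt i hiP)
          mul_mem' := by
            rintro _ _ ⟨a, rfl⟩ ⟨b, rfl⟩
            exact ⟨a + b, (elt_add hiP a b).symm⟩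
          one_mem' := ⟨0, by
            have h := elt_add hiP (0 : F) 0
            rwa [add_zero, mul_eq_left] at h⟩
          inv_mem' := by
            rintro _ ⟨a, rfl⟩
            exact ⟨-a, (elt_inv hiP a).symm⟩ }
      have hle : lastRoots F (n + 1) ≤ H ⊔ lastRoots F n := by
        refine (Subgroup.closure_le _).mpr ?_
        rintro g ⟨j, hj, t, hjn, rfl⟩
        rcases hlast j hjn with rfl | h
        · exact Subgroup.mem_sup_left ⟨t, rfl⟩
        · exact Subgroup.mem_sup_right (elt_mem_lastRoots hj t h)
      refine ⟨Finset.univ.image (core.elt i hiP) * s, ?_, ?_⟩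
      · refine (SetLike.coe_subset_coe.mpr hle).trans ?_
        rw [Subgroup.mul_normal, Finset.coe_mul]
        refine Set.mul_subset_mul ?_ hs
        rintro _ ⟨t, rfl⟩
        simp
      · refine Finset.card_mul_le.trans ?_
        rw [pow_succ, mul_comm]
        exact Nat.mul_le_mul hc Finset.card_image_le
    · rw [if_neg hiS, add_zero]
      refine ⟨s, ?_, hc⟩
      refine subset_trans ?_ hs
      refine (Subgroup.closure_le _).mpr ?_
      rintro g ⟨j, hj, t, hjn, rfl⟩
      rcases hlast j hjn with rfl | h
      · rw [elt_eq_one hj (mem_coreK_of_notMem_coreS _ hj hiS)]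
        exact one_mem _
      · exact elt_mem_lastRoots hj t h

end Elt

/-! ### The isomorphism between X_S and the model. -/

section Coordinates

variable {F : Type*} [Field F]

theorem tw_ix1_zero (t : F) : tw 0 0 t =
    ⟨t, 0, 0, 0, 0, 0, 0, 0, 0, 0, 0, 0, 0, 0, 0, 0, 0, 0, 0, 0⟩ := by
  rfl

theorem tw_ix2_zero (t : F) : tw 0 1 t =
    ⟨0, t, 0, 0, 0, 0, 0, 0, 0, 0, 0, 0, 0, 0, 0, 0, 0, 0, 0, 0⟩ := by
  rw [tw_ix2]; simp

theorem tw_ix3_zero (t : F) : tw 0 2 t =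
    ⟨0, 0, t, 0, 0, 0, 0, 0, 0, 0, 0, 0, 0, 0, 0, 0, 0, 0, 0, 0⟩ := by
  rw [tw_ix3]; simp

theorem tw_ix5_zero (t : F) : tw 0 4 t =
    ⟨0, 0, 0, t, 0, 0, 0, 0, 0, 0, 0, 0, 0, 0, 0, 0, 0, 0, 0, 0⟩ := by
  rw [tw_ix5]; simp

theorem tw_ix6_zero (t : F) : tw 0 5 t =
    ⟨0, 0, 0, 0, t, 0, 0, 0, 0, 0, 0, 0, 0, 0, 0, 0, 0, 0, 0, 0⟩ := by
  rfl

theorem tw_ix8_zero (t : F) : tw 0 7 t =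
    ⟨0, 0, 0, 0, 0, t, 0, 0, 0, 0, 0, 0, 0, 0, 0, 0, 0, 0, 0, 0⟩ := by
  rfl

theorem tw_ix9_zero (t : F) : tw 0 8 t =
    ⟨0, 0, 0, 0, 0, 0, t, 0, 0, 0, 0, 0, 0, 0, 0, 0, 0, 0, 0, 0⟩ := by
  rfl

theorem tw_ix10_zero (t : F) : tw 0 9 t =
    ⟨0, 0, 0, 0, 0, 0, 0, t, 0, 0, 0, 0, 0, 0, 0, 0, 0, 0, 0, 0⟩ := by
  rfl

theorem tw_ix7_zero (t : F) : tw 0 6 t =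
    ⟨0, 0, 0, 0, 0, 0, 0, 0, t, 0, 0, 0, 0, 0, 0, 0, 0, 0, 0, 0⟩ := by
  rw [tw_ix7]; simp

theorem tw_ix11_zero (t : F) : tw 0 10 t =
    ⟨0, 0, 0, 0, 0, 0, 0, 0, 0, t, 0, 0, 0, 0, 0, 0, 0, 0, 0, 0⟩ := by
  rw [tw_ix11]; simp

theorem tw_ix12_zero (t : F) : tw 0 11 t =
    ⟨0, 0, 0, 0, 0, 0, 0, 0, 0, 0, t, 0, 0, 0, 0, 0, 0, 0, 0, 0⟩ := by
  rfl

theorem tw_ix13_zero (t : F) : tw 0 12 t =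
    ⟨0, 0, 0, 0, 0, 0, 0, 0, 0, 0, 0, t, 0, 0, 0, 0, 0, 0, 0, 0⟩ := by
  rfl

theorem tw_ix14_zero (t : F) : tw 0 13 t =
    ⟨0, 0, 0, 0, 0, 0, 0, 0, 0, 0, 0, 0, t, 0, 0, 0, 0, 0, 0, 0⟩ := by
  rfl

theorem tw_ix15_zero (t : F) : tw 0 14 t =
    ⟨0, 0, 0, 0, 0, 0, 0, 0, 0, 0, 0, 0, 0, t, 0, 0, 0, 0, 0, 0⟩ := by
  rfl

theorem tw_ix16_zero (t : F) : tw 0 15 t =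
    ⟨0, 0, 0, 0, 0, 0, 0, 0, 0, 0, 0, 0, 0, 0, t, 0, 0, 0, 0, 0⟩ := by
  rfl

theorem tw_ix17_zero (t : F) : tw 0 16 t =
    ⟨0, 0, 0, 0, 0, 0, 0, 0, 0, 0, 0, 0, 0, 0, 0, t, 0, 0, 0, 0⟩ := by
  rfl

theorem tw_ix18_zero (t : F) : tw 0 17 t =
    ⟨0, 0, 0, 0, 0, 0, 0, 0, 0, 0, 0, 0, 0, 0, 0, 0, t, 0, 0, 0⟩ := by
  rfl

theorem tw_ix20_zero (t : F) : tw 0 19 t =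
    ⟨0, 0, 0, 0, 0, 0, 0, 0, 0, 0, 0, 0, 0, 0, 0, 0, 0, t, 0, 0⟩ := by
  rfl

theorem tw_ix21_zero (t : F) : tw 0 20 t =
    ⟨0, 0, 0, 0, 0, 0, 0, 0, 0, 0, 0, 0, 0, 0, 0, 0, 0, 0, t, 0⟩ := by
  rfl

theorem tw_ix24_zero (t : F) : tw 0 23 t =
    ⟨0, 0, 0, 0, 0, 0, 0, 0, 0, 0, 0, 0, 0, 0, 0, 0, 0, 0, 0, t⟩ := by
  rfl

@[simp] theorem toCoord_xS1 (t : F) : toCoord F (xS 1 t) =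
    ⟨t, 0, 0, 0, 0, 0, 0, 0, 0, 0, 0, 0, 0, 0, 0, 0, 0, 0, 0, 0⟩ := by
  change toCoord F (core.elt _ _ t) = _
  rw [toCoord_elt]
  exact tw_ix1_zero t

@[simp] theorem toCoord_xS2 (t : F) : toCoord F (xS 2 t) =
    ⟨0, t, 0, 0, 0, 0, 0, 0, 0, 0, 0, 0, 0, 0, 0, 0, 0, 0, 0, 0⟩ := by
  change toCoord F (core.elt _ _ t) = _
  rw [toCoord_elt]
  exact tw_ix2_zero t

@[simp] theorem toCoord_xS3 (t : F) : toCoord F (xS 3 t) =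
    ⟨0, 0, t, 0, 0, 0, 0, 0, 0, 0, 0, 0, 0, 0, 0, 0, 0, 0, 0, 0⟩ := by
  change toCoord F (core.elt _ _ t) = _
  rw [toCoord_elt]
  exact tw_ix3_zero t

@[simp] theorem toCoord_xS5 (t : F) : toCoord F (xS 5 t) =
    ⟨0, 0, 0, t, 0, 0, 0, 0, 0, 0, 0, 0, 0, 0, 0, 0, 0, 0, 0, 0⟩ := by
  change toCoord F (core.elt _ _ t) = _
  rw [toCoord_elt]
  exact tw_ix5_zero t

@[simp] theorem toCoord_xS6 (t : F) : toCoord F (xS 6 t) =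
    ⟨0, 0, 0, 0, t, 0, 0, 0, 0, 0, 0, 0, 0, 0, 0, 0, 0, 0, 0, 0⟩ := by
  change toCoord F (core.elt _ _ t) = _
  rw [toCoord_elt]
  exact tw_ix6_zero t

@[simp] theorem toCoord_xS8 (t : F) : toCoord F (xS 8 t) =
    ⟨0, 0, 0, 0, 0, t, 0, 0, 0, 0, 0, 0, 0, 0, 0, 0, 0, 0, 0, 0⟩ := by
  change toCoord F (core.elt _ _ t) = _
  rw [toCoord_elt]
  exact tw_ix8_zero t

@[simp] theorem toCoord_xS9 (t : F) : toCoord F (xS 9 t) =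
    ⟨0, 0, 0, 0, 0, 0, t, 0, 0, 0, 0, 0, 0, 0, 0, 0, 0, 0, 0, 0⟩ := by
  change toCoord F (core.elt _ _ t) = _
  rw [toCoord_elt]
  exact tw_ix9_zero t

@[simp] theorem toCoord_xS10 (t : F) : toCoord F (xS 10 t) =
    ⟨0, 0, 0, 0, 0, 0, 0, t, 0, 0, 0, 0, 0, 0, 0, 0, 0, 0, 0, 0⟩ := by
  change toCoord F (core.elt _ _ t) = _
  rw [toCoord_elt]
  exact tw_ix10_zero t

@[simp] theorem toCoord_xS7 (t : F) : toCoord F (xS 7 t) =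
    ⟨0, 0, 0, 0, 0, 0, 0, 0, t, 0, 0, 0, 0, 0, 0, 0, 0, 0, 0, 0⟩ := by
  change toCoord F (core.elt _ _ t) = _
  rw [toCoord_elt]
  exact tw_ix7_zero t

@[simp] theorem toCoord_xS11 (t : F) : toCoord F (xS 11 t) =
    ⟨0, 0, 0, 0, 0, 0, 0, 0, 0, t, 0, 0, 0, 0, 0, 0, 0, 0, 0, 0⟩ := by
  change toCoord F (core.elt _ _ t) = _
  rw [toCoord_elt]
  exact tw_ix11_zero t

@[simp] theorem toCoord_xS12 (t : F) : toCoord F (xS 12 t) =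
    ⟨0, 0, 0, 0, 0, 0, 0, 0, 0, 0, t, 0, 0, 0, 0, 0, 0, 0, 0, 0⟩ := by
  change toCoord F (core.elt _ _ t) = _
  rw [toCoord_elt]
  exact tw_ix12_zero t

@[simp] theorem toCoord_xS13 (t : F) : toCoord F (xS 13 t) =
    ⟨0, 0, 0, 0, 0, 0, 0, 0, 0, 0, 0, t, 0, 0, 0, 0, 0, 0, 0, 0⟩ := by
  change toCoord F (core.elt _ _ t) = _
  rw [toCoord_elt]
  exact tw_ix13_zero t

@[simp] theorem toCoord_xS14 (t : F) : toCoord F (xS 14 t) =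
    ⟨0, 0, 0, 0, 0, 0, 0, 0, 0, 0, 0, 0, t, 0, 0, 0, 0, 0, 0, 0⟩ := by
  change toCoord F (core.elt _ _ t) = _
  rw [toCoord_elt]
  exact tw_ix14_zero t

@[simp] theorem toCoord_xS15 (t : F) : toCoord F (xS 15 t) =
    ⟨0, 0, 0, 0, 0, 0, 0, 0, 0, 0, 0, 0, 0, t, 0, 0, 0, 0, 0, 0⟩ := by
  change toCoord F (core.elt _ _ t) = _
  rw [toCoord_elt]
  exact tw_ix15_zero t

@[simp] theorem toCoord_xS16 (t : F) : toCoord F (xS 16 t) =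
    ⟨0, 0, 0, 0, 0, 0, 0, 0, 0, 0, 0, 0, 0, 0, t, 0, 0, 0, 0, 0⟩ := by
  change toCoord F (core.elt _ _ t) = _
  rw [toCoord_elt]
  exact tw_ix16_zero t

@[simp] theorem toCoord_xS17 (t : F) : toCoord F (xS 17 t) =
    ⟨0, 0, 0, 0, 0, 0, 0, 0, 0, 0, 0, 0, 0, 0, 0, t, 0, 0, 0, 0⟩ := by
  change toCoord F (core.elt _ _ t) = _
  rw [toCoord_elt]
  exact tw_ix17_zero t

@[simp] theorem toCoord_xS18 (t : F) : toCoord F (xS 18 t) =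
    ⟨0, 0, 0, 0, 0, 0, 0, 0, 0, 0, 0, 0, 0, 0, 0, 0, t, 0, 0, 0⟩ := by
  change toCoord F (core.elt _ _ t) = _
  rw [toCoord_elt]
  exact tw_ix18_zero t

@[simp] theorem toCoord_xS20 (t : F) : toCoord F (xS 20 t) =
    ⟨0, 0, 0, 0, 0, 0, 0, 0, 0, 0, 0, 0, 0, 0, 0, 0, 0, t, 0, 0⟩ := by
  change toCoord F (core.elt _ _ t) = _
  rw [toCoord_elt]
  exact tw_ix20_zero t

@[simp] theorem toCoord_xS21 (t : F) : toCoord F (xS 21 t) =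
    ⟨0, 0, 0, 0, 0, 0, 0, 0, 0, 0, 0, 0, 0, 0, 0, 0, 0, 0, t, 0⟩ := by
  change toCoord F (core.elt _ _ t) = _
  rw [toCoord_elt]
  exact tw_ix21_zero t

@[simp] theorem toCoord_xS24 (t : F) : toCoord F (xS 24 t) =
    ⟨0, 0, 0, 0, 0, 0, 0, 0, 0, 0, 0, 0, 0, 0, 0, 0, 0, 0, 0, t⟩ := by
  change toCoord F (core.elt _ _ t) = _
  rw [toCoord_elt]
  exact tw_ix24_zero t

/-- The tuple of the coordinates. -/
def Coord.equivFun (F : Type*) : Coord F ≃ (Fin 20 → F) where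
  toFun g :=
    ![g.c1, g.c2, g.c3, g.c5, g.c6, g.c8, g.c9, g.c10, g.c7, g.c11, g.c12, g.c13, g.c14, g.c15,
    g.c16, g.c17, g.c18, g.c20, g.c21, g.c24]
  invFun v := ⟨v 0, v 1, v 2, v 3, v 4, v 5, v 6, v 7, v 8, v 9, v 10, v 11, v 12, v 13, v 14, v 15, v 16, v 17, v 18, v 19⟩
  left_inv _ := rfl
  right_inv v := by
    ext i
    fin_cases i <;> rfl

/-- The element of `X_S` with given coordinates. -/
def ofCoord (g : Coord F) : XS F :=
    xS 1 g.c1 * xS 2 g.c2 * xS 3 g.c3 * xS 5 g.c5 * xS 6 g.c6 * xS 8 g.c8 * xS 9 g.c9 *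
      xS 10 g.c10 * xS 7 g.c7 * xS 11 g.c11 * xS 12 g.c12 * xS 13 g.c13 * xS 14 g.c14 *
      xS 15 g.c15 * xS 16 g.c16 * xS 17 g.c17 * xS 18 g.c18 * xS 20 g.c20 * xS 21 g.c21 *
      xS 24 g.c24

theorem toCoord_ofCoord (g : Coord F) : toCoord F (ofCoord g) = g := by
  rw [ofCoord]
  simp only [map_mul, toCoord_xS1, toCoord_xS2, toCoord_xS3, toCoord_xS5, toCoord_xS6, toCoord_xS8, toCoord_xS9,
    toCoord_xS10, toCoord_xS7, toCoord_xS11, toCoord_xS12, toCoord_xS13, toCoord_xS14,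
    toCoord_xS15, toCoord_xS16, toCoord_xS17, toCoord_xS18, toCoord_xS20, toCoord_xS21,
    toCoord_xS24,
    Coord.mk_mul_mk, mul_zero, zero_mul, sub_zero, add_zero, zero_add, neg_zero]

variable [Fintype F]

instance : Finite (XS F) := by
  obtain ⟨s, hs, -⟩ := exists_finset_lastRoots (F := F) 36 le_rfl
  rw [lastRoots_eq_top] at hs
  exact Set.finite_univ_iff.mp (s.finite_toSet.subset hs)

theorem card_XS_le : Nat.card (XS F) ≤ Fintype.card F ^ 20 := by
  obtain ⟨s, hs, hc⟩ := exists_finset_lastRoots (F := F) 36 le_rfl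
  rw [card_filter_coreS] at hc
  rw [lastRoots_eq_top] at hs
  rw [← Set.ncard_univ]
  refine le_trans ?_ hc
  rw [← Set.ncard_coe_finset]
  exact Set.ncard_le_ncard hs s.finite_toSet

/-- The ordered products `ofCoord` give surjectivity onto a set of q^20 elements, and X_S has at
most that many. -/
theorem toCoord_bijective : Function.Bijective (toCoord F) := by
  refine Function.Surjective.bijective_of_nat_card_le (fun g => ⟨_, toCoord_ofCoord g⟩) ?_
  rw [Nat.card_congr (Coord.equivFun F), Nat.card_fun, Nat.card_eq_fintype_card (α := F),
    Nat.card_fin]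
  exact card_XS_le

theorem ofCoord_toCoord (g : XS F) : ofCoord (toCoord F g) = g :=
  toCoord_bijective.1 (toCoord_ofCoord _)

theorem card_XS : Nat.card (XS F) = Fintype.card F ^ 20 := by
  rw [Nat.card_eq_of_bijective _ toCoord_bijective, Nat.card_congr (Coord.equivFun F),
    Nat.card_fun, Nat.card_eq_fintype_card, Nat.card_fin]

end Coordinates

/-! ### Additive characters of F. -/

section AdditiveCharacter

variable (p : ℕ) [Fact p.Prime] {F : Type*} [Field F] [CharP F p]

theorem phi_add (s t : F) : phi p (s + t) = phi p s * phi p t := by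
  let _ := ZMod.algebra F p
  change ZMod.stdAddChar (Algebra.trace (ZMod p) F (s + t)) = _
  rw [map_add, AddChar.map_add_eq_mul]
  rfl

theorem phi_zero : phi p (0 : F) = 1 := by
  let _ := ZMod.algebra F p
  change ZMod.stdAddChar (Algebra.trace (ZMod p) F 0) = _
  rw [map_zero, AddChar.map_zero_eq_one]

variable [Fintype F]

/-- The trace form is nondegenerate, and the standard additive character of `ZMod p` is injective.
-/
theorem eq_of_phi_mul_eq {a b : F} (h : ∀ t, phi p (a * t) = phi p (b * t)) : a = b := by
  let _ := ZMod.algebra F p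
  have : FiniteDimensional (ZMod p) F := Module.Finite.of_finite
  rw [← sub_eq_zero]
  refine (traceForm_nondegenerate (ZMod p) F).1 _ fun t => ?_
  have ht := ZMod.injective_stdAddChar (h t)
  rw [Algebra.traceForm_apply, sub_mul, map_sub, ht, sub_self]

/-- The map a ↦ φ(a ·) is injective, and F has exactly |F| additive characters. -/
theorem exists_phi_mul (θ : AddChar F ℂ) : ∃ a : F, ∀ t, θ t = phi p (a * t) := by
  let f : F → AddChar F ℂ := fun a =>
    { toFun := fun t => phi p (a * t)
      map_zero_eq_one' := by rw [mul_zero, phi_zero]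
      map_add_eq_mul' := fun s t => by rw [mul_add, phi_add] }
  have hf : Function.Injective f := fun a b h =>
    eq_of_phi_mul_eq p fun t => DFunLike.congr_fun h t
  obtain ⟨a, rfl⟩ := (hf.bijective_of_nat_card_le
    (by rw [Nat.card_eq_fintype_card, Nat.card_eq_fintype_card, AddChar.card_eq])).2 θ
  exact ⟨a, fun t => rfl⟩

end AdditiveCharacter

/-! ### Linear characters given by additive functions. -/

section LinearCharacter

variable (p : ℕ) [Fact p.Prime] {F : Type*} [Field F] [CharP F p] {G : Type*} [Group G]

/-- The linear character `φ ∘ l` of a subgroup on which `l` is additive. -/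
def linChar (M : Subgroup G) (l : G → F) (hl : ∀ g ∈ M, ∀ h ∈ M, l (g * h) = l g + l h) :
    M →* ℂ where
  toFun g := phi p (l g)
  map_one' := by
    have h := hl 1 (one_mem _) 1 (one_mem _)
    rw [mul_one, left_eq_add] at h
    rw [Subgroup.coe_one, h, phi_zero]
  map_mul' g h := by rw [Subgroup.coe_mul, hl g g.2 h h.2, phi_add]

/-- A linear character is determined on generators, and `φ ∘ l` has the prescribed values there.
This replaces the existential in `IsIndFrom` by one explicit induced character. -/
theorem isIndFrom_iff {D : List ((F → G) × F)} {M : Subgroup G} {l : G → F}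
    (hl : ∀ g ∈ M, ∀ h ∈ M, l (g * h) = l g + l h)
    (hM : ∀ d ∈ D, ∀ t, d.1 t ∈ M) (hD : ∀ d ∈ D, ∀ t, l (d.1 t) = d.2 * t)
    (hle : M ≤ Subgroup.closure {g : G | ∃ d ∈ D, ∃ t, g = d.1 t}) {χ : G → ℂ} :
    IsIndFrom p D χ ↔ χ = indChar M (linChar p M l hl) := by
  obtain rfl : Subgroup.closure {g : G | ∃ d ∈ D, ∃ t, g = d.1 t} = M := by
    refine le_antisymm ((Subgroup.closure_le _).mpr ?_) hle
    rintro g ⟨d, hd, t, rfl⟩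
    exact hM d hd t
  constructor
  · rintro ⟨ψ, hψ, rfl⟩
    congr 1
    ext ⟨g, hg⟩
    induction hg using Subgroup.closure_induction with
    | mem g hg =>
      obtain ⟨d, hd, t, rfl⟩ := hg
      rw [hψ d hd t]
      change _ = phi p (l (d.1 t))
      rw [hD d hd t]
    | one => exact (map_one ψ).trans (map_one _).symm
    | mul a b ha hb h1 h2 =>
      have e1 := map_mul ψ ⟨a, ha⟩ ⟨b, hb⟩
      have e2 := map_mul (linChar p _ l hl) ⟨a, ha⟩ ⟨b, hb⟩
      rw [h1, h2, ← e2] at e1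
      exact e1
    | inv a ha h1 =>
      have e1 := map_mul ψ ⟨a, ha⟩ ⟨a, ha⟩⁻¹
      have e2 := map_mul (linChar p _ l hl) ⟨a, ha⟩ ⟨a, ha⟩⁻¹
      rw [mul_inv_cancel, map_one] at e1 e2
      rw [h1] at e1
      exact mul_left_cancel₀ (left_ne_zero_of_mul_eq_one e2.symm) (e1.symm.trans e2)
  · rintro rfl
    refine ⟨_, fun d hd t => ?_, rfl⟩
    change phi p (l (d.1 t)) = _
    rw [hD d hd t]

end LinearCharacter

/-! ### The central subgroup X_Z and its characters. -/

section Center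

variable {F : Type*} [Field F]

variable (F) in
/-- The subgroup of the tuples supported on `Z`. -/
def Coord.zSub : Subgroup (Coord F) where
  carrier := {g | g.c1 = 0 ∧ g.c2 = 0 ∧ g.c3 = 0 ∧ g.c5 = 0 ∧ g.c6 = 0 ∧ g.c8 = 0 ∧ g.c9 = 0 ∧ g.c10 = 0 ∧ g.c7 = 0 ∧ g.c11 = 0 ∧ g.c12 = 0 ∧ g.c13 = 0 ∧ g.c14 = 0 ∧ g.c15 = 0 ∧ g.c16 = 0}
  one_mem' := by simp
  mul_mem' := by
    rintro a b ⟨h1, h2, h3, h5, h6, h8, h9, h10, h7, h11, h12, h13, h14, h15, h16⟩ ⟨k1, k2, k3, k5, k6, k8, k9, k10, k7, k11, k12, k13, k14, k15, k16⟩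
    simp [*]
  inv_mem' := by
    rintro a ⟨h1, h2, h3, h5, h6, h8, h9, h10, h7, h11, h12, h13, h14, h15, h16⟩
    simp [*]

variable (F) in
/-- The central subgroup `X_Z` of `X_S`. -/
def zSub : Subgroup (XS F) := (Coord.zSub F).comap (toCoord F)

theorem card_comap_toCoord [Fintype F] (M : Subgroup (Coord F)) :
    Nat.card (M.comap (toCoord F)) = Nat.card M :=
  Nat.card_congr ((Equiv.ofBijective _ toCoord_bijective).subtypeEquiv fun _ => Iff.rfl)

theorem card_zSub [Fintype F] : Nat.card (zSub F) = Fintype.card F ^ 5 := by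
  rw [zSub, card_comap_toCoord]
  let e : Coord.zSub F ≃ (Fin 5 → F) :=
    { toFun := fun g => ![g.1.c17, g.1.c18, g.1.c20, g.1.c21, g.1.c24]
      invFun := fun v => ⟨⟨0, 0, 0, 0, 0, 0, 0, 0, 0, 0, 0, 0, 0, 0, 0, v 0, v 1, v 2, v 3, v 4⟩, by simp [Coord.zSub]⟩
      left_inv := by
        rintro ⟨g, h1, h2, h3, h5, h6, h8, h9, h10, h7, h11, h12, h13, h14, h15, h16⟩
        ext <;> simp [*]
      right_inv := fun v => by
        ext i
        fin_cases i <;> rfl }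
  rw [Nat.card_congr e, Nat.card_fun, Nat.card_eq_fintype_card, Nat.card_fin]

/-- The linear form on `X_Z` with label `A`. -/
def CLabel.form (A : CLabel F) (g : Coord F) : F :=
  A.a17 * g.c17 + A.a18 * g.c18 + A.a20 * g.c20 + A.a21 * g.c21 + A.a24 * g.c24

theorem CLabel.form_mul (A : CLabel F) {g : Coord F} (hg : g ∈ Coord.zSub F) (h : Coord F) :
    A.form (g * h) = A.form g + A.form h := by
  obtain ⟨h1, h2, h3, h5, h6, h8, h9, h10, h7, h11, h12, h13, h14, h15, h16⟩ := hg
  simp only [CLabel.form, Coord.mul_c17, Coord.mul_c18, Coord.mul_c20, Coord.mul_c21,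
    Coord.mul_c24, *]
  ring

theorem xS17_mem_zSub (t : F) : xS 17 t ∈ zSub F := by
  simp [zSub, Coord.zSub]

theorem xS18_mem_zSub (t : F) : xS 18 t ∈ zSub F := by
  simp [zSub, Coord.zSub]

theorem xS20_mem_zSub (t : F) : xS 20 t ∈ zSub F := by
  simp [zSub, Coord.zSub]

theorem xS21_mem_zSub (t : F) : xS 21 t ∈ zSub F := by
  simp [zSub, Coord.zSub]

theorem xS24_mem_zSub (t : F) : xS 24 t ∈ zSub F := by
  simp [zSub, Coord.zSub]

theorem xS_add (n : ℕ) (h : ix n ∈ core.P) (s t : F) :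
    xS n s h * xS n t h = xS n (s + t) h := elt_add h s t

/-- The linear character of `X_Z` with label `A`. -/
def CLabel.char (p : ℕ) [Fact p.Prime] [CharP F p] (A : CLabel F) : zSub F →* ℂ :=
  linChar p (zSub F) (fun g => A.form (toCoord F g)) fun g hg h _ => by
    rw [map_mul]; exact A.form_mul hg _

theorem CLabel.char_apply (p : ℕ) [Fact p.Prime] [CharP F p] (A : CLabel F) (z : zSub F) :
    A.char p z = phi p (A.form (toCoord F z)) := rfl

variable [Fintype F]

theorem zSub_le_center : zSub F ≤ Subgroup.center (XS F) := by
  intro z hz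
  obtain ⟨h1, h2, h3, h5, h6, h8, h9, h10, h7, h11, h12, h13, h14, h15, h16⟩ := hz
  rw [Subgroup.mem_center_iff]
  intro g
  apply toCoord_bijective.1
  rw [map_mul, map_mul]
  ext <;> simp [*] <;> ring

theorem eq_prod_of_mem_zSub {z : XS F} (hz : z ∈ zSub F) :
    z = xS 17 (toCoord F z).c17 * xS 18 (toCoord F z).c18 * xS 20 (toCoord F z).c20 *
      xS 21 (toCoord F z).c21 * xS 24 (toCoord F z).c24 := by
  obtain ⟨h1, h2, h3, h5, h6, h8, h9, h10, h7, h11, h12, h13, h14, h15, h16⟩ := hz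
  apply toCoord_bijective.1
  simp only [map_mul, toCoord_xS17, toCoord_xS18, toCoord_xS20, toCoord_xS21, toCoord_xS24,
    Coord.mk_mul_mk, mul_zero, sub_zero, add_zero, zero_add, neg_zero]
  ext <;> simp [*]

/-- A central root subgroup acts through an additive character φ(a ·); with `a = 0` it would lie in
the kernel of `χ`. -/
theorem exists_label_root (p : ℕ) [Fact p.Prime] [CharP F p] {χ : XS F → ℂ}
    (l : Subgroup.center (XS F) →* ℂ)
    (hl : ∀ (z : Subgroup.center (XS F)) (g : XS F), χ (z * g) = l z * χ g)
    (n : ℕ) (hn : ix n ∈ core.P) (hz : ∀ t : F, xS n t hn ∈ zSub F)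
    (hker : ¬ (Set.range (core.elt (ix n) hn (F := F)) ⊆ charKer χ)) :
    ∃ a : Fˣ, ∀ t, l ⟨xS n t hn, zSub_le_center (hz t)⟩ = phi p (a * t) := by
  have h00 : xS n (0 : F) hn = 1 := by
    have h := xS_add n hn (0 : F) 0
    rwa [add_zero, mul_eq_left] at h
  let θ : AddChar F ℂ :=
    { toFun := fun t => l ⟨xS n t hn, zSub_le_center (hz t)⟩
      map_zero_eq_one' := by
        simp only [h00]
        exact map_one l
      map_add_eq_mul' := fun s t => by
        rw [← map_mul]
        congr 1
        exact Subtype.ext (xS_add n hn s t).symm }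
  obtain ⟨a, ha⟩ := exists_phi_mul p θ
  refine ⟨Units.mk0 a ?_, ha⟩
  rintro rfl
  apply hker
  rintro _ ⟨t, rfl⟩
  have h1 := hl ⟨xS n t hn, zSub_le_center (hz t)⟩ 1
  have h2 := ha t
  rw [zero_mul, phi_zero] at h2
  change l ⟨xS n t hn, zSub_le_center (hz t)⟩ = 1 at h2
  rw [h2, mul_one, one_mul] at h1
  exact h1

theorem exists_label (p : ℕ) [Fact p.Prime] [CharP F p] {χ : XS F → ℂ}
    (h : χ ∈ core.IrrOver F coreZ) :
    ∃ A : CLabel F, ∀ z : zSub F, χ z = A.char p z * χ 1 := by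
  obtain ⟨l, hl⟩ := exists_central_char h.1
  obtain ⟨a17, h17⟩ := exists_label_root p l hl 17 (by decide) xS17_mem_zSub
    (h.2 _ (by decide) _)
  obtain ⟨a18, h18⟩ := exists_label_root p l hl 18 (by decide) xS18_mem_zSub
    (h.2 _ (by decide) _)
  obtain ⟨a20, h20⟩ := exists_label_root p l hl 20 (by decide) xS20_mem_zSub
    (h.2 _ (by decide) _)
  obtain ⟨a21, h21⟩ := exists_label_root p l hl 21 (by decide) xS21_mem_zSub
    (h.2 _ (by decide) _)
  obtain ⟨a24, h24⟩ := exists_label_root p l hl 24 (by decide) xS24_mem_zSub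
    (h.2 _ (by decide) _)
  refine ⟨⟨a17, a18, a20, a21, a24⟩, fun z => ?_⟩
  have key : ∀ (n : ℕ) (hn : ix n ∈ core.P) (hz : ∀ t : F, xS n t hn ∈ zSub F) (a : Fˣ)
      (_ : ∀ t, l ⟨xS n t hn, zSub_le_center (hz t)⟩ = phi p (a * t)) (t : F) (g : XS F),
      χ (xS n t hn * g) = phi p (a * t) * χ g := fun n hn hz a ha t g => by
    rw [← ha t]; exact hl ⟨xS n t hn, zSub_le_center (hz t)⟩ g
  have e := eq_prod_of_mem_zSub z.2
  rw [CLabel.char_apply]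
  have aux : ∀ t17 t18 t20 t21 t24 : F,
      χ (xS 17 t17 * xS 18 t18 * xS 20 t20 * xS 21 t21 * xS 24 t24) =
        phi p (a17 * t17) * (phi p (a18 * t18) * (phi p (a20 * t20) * (phi p (a21 * t21) *
          (phi p (a24 * t24) * χ 1)))) := by
    intro t17 t18 t20 t21 t24
    have k24 := key 24 _ xS24_mem_zSub a24 h24 t24 1
    rw [mul_one] at k24
    rw [← k24, ← key 21 _ xS21_mem_zSub a21 h21, ← key 20 _ xS20_mem_zSub a20 h20,
      ← key 18 _ xS18_mem_zSub a18 h18, ← key 17 _ xS17_mem_zSub a17 h17]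
    simp only [mul_assoc]
  refine (congrArg χ e).trans ((aux _ _ _ _ _).trans ?_)
  simp only [CLabel.form, phi_add]
  ring

theorem CLabel.char_injective (p : ℕ) [Fact p.Prime] [CharP F p] :
    Function.Injective (CLabel.char p : CLabel F → (zSub F →* ℂ)) := by
  intro A B h
  have key : ∀ z, z ∈ zSub F → phi p (A.form (toCoord F z)) = phi p (B.form (toCoord F z)) :=
    fun z hz => by rw [← A.char_apply p ⟨z, hz⟩, h, char_apply]
  have e17 : A.a17 = B.a17 := Units.ext (eq_of_phi_mul_eq p fun t => by
    simpa [CLabel.form] using key _ (xS17_mem_zSub t))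
  have e18 : A.a18 = B.a18 := Units.ext (eq_of_phi_mul_eq p fun t => by
    simpa [CLabel.form] using key _ (xS18_mem_zSub t))
  have e20 : A.a20 = B.a20 := Units.ext (eq_of_phi_mul_eq p fun t => by
    simpa [CLabel.form] using key _ (xS20_mem_zSub t))
  have e21 : A.a21 = B.a21 := Units.ext (eq_of_phi_mul_eq p fun t => by
    simpa [CLabel.form] using key _ (xS21_mem_zSub t))
  have e24 : A.a24 = B.a24 := Units.ext (eq_of_phi_mul_eq p fun t => by
    simpa [CLabel.form] using key _ (xS24_mem_zSub t))
  cases A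
  cases B
  simp only at e17 e18 e20 e21 e24
  rw [e17, e18, e20, e21, e24]

end Center

/-! ### Conjugates of root elements in coordinates. -/

section Conjugation

variable {F : Type*} [Field F] (u : Coord F) (t : F)

theorem Coord.conj_c2 :
    u * ⟨0, t, 0, 0, 0, 0, 0, 0, 0, 0, 0, 0, 0, 0, 0, 0, 0, 0, 0, 0⟩ * u⁻¹ =
      ⟨0, t, 0, 0, 0, 0, 0, 0, 0, 0, 0, -(t * u.c9), -(t * u.c10), 0, 0, -(t * u.c1 * u.c9) - t * u.c12, 0, t * u.c10 * u.c6 - t * u.c16, 0, t * u.c10 * u.c9⟩ := by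
  rw [mul_inv_eq_iff_eq_mul]
  ext <;> simp <;> ring1

theorem Coord.conj_c3 :
    u * ⟨0, 0, t, 0, 0, 0, 0, 0, 0, 0, 0, 0, 0, 0, 0, 0, 0, 0, 0, 0⟩ * u⁻¹ =
      ⟨0, 0, t, 0, 0, 0, 0, 0, t * u.c1, 0, 0, -(t * u.c8), 0, -(t * u.c10), 0, -(t * u.c1 * u.c8), -(t * u.c1 * u.c10), 0, t * u.c10 * u.c6 - t * u.c16, t * u.c10 * u.c8⟩ := by
  rw [mul_inv_eq_iff_eq_mul]
  ext <;> simp <;> ring1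

theorem Coord.conj_c5 :
    u * ⟨0, 0, 0, t, 0, 0, 0, 0, 0, 0, 0, 0, 0, 0, 0, 0, 0, 0, 0, 0⟩ * u⁻¹ =
      ⟨0, 0, 0, t, 0, 0, 0, 0, 0, -(t * u.c6), 0, 0, t * u.c8, t * u.c9, 0, 0, t * u.c1 * u.c9 + t * u.c12, -(t * u.c6 * u.c8), -(t * u.c6 * u.c9), -(t * u.c8 * u.c9)⟩ := by
  rw [mul_inv_eq_iff_eq_mul]
  ext <;> simp <;> ring1

/-- For the middle-layer roots 7, 11, …, 16 conjugation changes only central coordinates, and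
linearly in `u`. These changes supply the linear equations in Mackey's criterion. -/
theorem Coord.conj_c7 :
    u * ⟨0, 0, 0, 0, 0, 0, 0, 0, t, 0, 0, 0, 0, 0, 0, 0, 0, 0, 0, 0⟩ * u⁻¹ =
      ⟨0, 0, 0, 0, 0, 0, 0, 0, t, 0, 0, 0, 0, 0, 0, -(t * u.c8), -(t * u.c10), 0, 0, 0⟩ := by
  rw [mul_inv_eq_iff_eq_mul]
  ext <;> simp
  ring1

theorem Coord.conj_c11 :
    u * ⟨0, 0, 0, 0, 0, 0, 0, 0, 0, t, 0, 0, 0, 0, 0, 0, 0, 0, 0, 0⟩ * u⁻¹ =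
      ⟨0, 0, 0, 0, 0, 0, 0, 0, 0, t, 0, 0, 0, 0, 0, 0, 0, t * u.c8, t * u.c9, 0⟩ := by
  rw [mul_inv_eq_iff_eq_mul]
  ext <;> simp
  ring1

theorem Coord.conj_c12 :
    u * ⟨0, 0, 0, 0, 0, 0, 0, 0, 0, 0, t, 0, 0, 0, 0, 0, 0, 0, 0, 0⟩ * u⁻¹ =
      ⟨0, 0, 0, 0, 0, 0, 0, 0, 0, 0, t, 0, 0, 0, 0, t * u.c2, -(t * u.c5), 0, 0, 0⟩ := by
  rw [mul_inv_eq_iff_eq_mul]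
  ext <;> simp
  ring1

theorem Coord.conj_c13 :
    u * ⟨0, 0, 0, 0, 0, 0, 0, 0, 0, 0, 0, t, 0, 0, 0, 0, 0, 0, 0, 0⟩ * u⁻¹ =
      ⟨0, 0, 0, 0, 0, 0, 0, 0, 0, 0, 0, t, 0, 0, 0, t * u.c1, 0, 0, 0, -(t * u.c10)⟩ := by
  rw [mul_inv_eq_iff_eq_mul]
  ext <;> simp
  ring1

theorem Coord.conj_c14 :
    u * ⟨0, 0, 0, 0, 0, 0, 0, 0, 0, 0, 0, 0, t, 0, 0, 0, 0, 0, 0, 0⟩ * u⁻¹ =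
      ⟨0, 0, 0, 0, 0, 0, 0, 0, 0, 0, 0, 0, t, 0, 0, 0, 0, -(t * u.c6), 0, -(t * u.c9)⟩ := by
  rw [mul_inv_eq_iff_eq_mul]
  ext <;> simp
  ring1

theorem Coord.conj_c15 :
    u * ⟨0, 0, 0, 0, 0, 0, 0, 0, 0, 0, 0, 0, 0, t, 0, 0, 0, 0, 0, 0⟩ * u⁻¹ =
      ⟨0, 0, 0, 0, 0, 0, 0, 0, 0, 0, 0, 0, 0, t, 0, 0, t * u.c1, 0, -(t * u.c6), -(t * u.c8)⟩ := by
  rw [mul_inv_eq_iff_eq_mul]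
  ext <;> simp
  ring1

theorem Coord.conj_c16 :
    u * ⟨0, 0, 0, 0, 0, 0, 0, 0, 0, 0, 0, 0, 0, 0, t, 0, 0, 0, 0, 0⟩ * u⁻¹ =
      ⟨0, 0, 0, 0, 0, 0, 0, 0, 0, 0, 0, 0, 0, 0, t, 0, 0, t * u.c2, t * u.c3, 0⟩ := by
  rw [mul_inv_eq_iff_eq_mul]
  ext <;> simp
  ring1

end Conjugation

/-! ### Families of induced characters satisfying Mackey's criterion. -/

section MonomialFamily

variable {p : ℕ} [Fact p.Prime] {F : Type*} [Field F] [CharP F p] {B : Type*}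

variable (p F B) in
/-- Linear characters `φ ∘ l` of subgroups `N` containing `X_Z`, for the labels `A` of the linear
characters of `X_Z` and for labels `β` in `B`, such that Mackey's criterion holds. -/
structure MonomialFamily where
  N : CLabel F → Subgroup (Coord F)
  l : CLabel F → B → Coord F → F
  l_mul : ∀ A β, ∀ g ∈ N A, ∀ h ∈ N A, l A β (g * h) = l A β g + l A β h
  zSub_le : ∀ A, Coord.zSub F ≤ N A
  l_zSub : ∀ A β, ∀ z ∈ Coord.zSub F, l A β z = A.form z
  l_injective : ∀ A β β', (∀ g ∈ N A, phi p (l A β g) = phi p (l A β' g)) → β = β'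
  -- Two labels are allowed so that one condition serves both irreducibility (β = β') and
  -- distinctness.
  mem_of_conj : ∀ A β β' u,
    (∀ g ∈ N A, u * g * u⁻¹ ∈ N A → phi p (l A β (u * g * u⁻¹)) = phi p (l A β' g)) → u ∈ N A

namespace MonomialFamily

variable (D : MonomialFamily p F B)

/-- The subgroup of `X_S` with label `A`. -/
def sub (A : CLabel F) : Subgroup (XS F) := (D.N A).comap (toCoord F)

/-- The linear form with label `(A, β)`. -/
def form (A : CLabel F) (β : B) (g : XS F) : F := D.l A β (toCoord F g)

theorem form_mul (A : CLabel F) (β : B) :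
    ∀ g ∈ D.sub A, ∀ h ∈ D.sub A, D.form A β (g * h) = D.form A β g + D.form A β h := by
  intro g hg h hh
  simp only [form, map_mul]
  exact D.l_mul A β _ hg _ hh

/-- The linear character with label `(A, β)`. -/
def lin (A : CLabel F) (β : B) : D.sub A →* ℂ := linChar p _ _ (D.form_mul A β)

theorem lin_apply (A : CLabel F) (β : B) (g : D.sub A) : D.lin A β g = phi p (D.form A β g) := rfl

/-- The induced character with label `(A, β)`. -/
def char (A : CLabel F) (β : B) : XS F → ℂ := indChar (D.sub A) (D.lin A β)

theorem extZero_lin (A : CLabel F) (β : B) {g : XS F} (hg : g ∈ D.sub A) :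
    extZero (D.sub A) (D.lin A β) g = phi p (D.l A β (toCoord F g)) :=
  extZero_of_mem _ hg

theorem lin_injective [Fintype F] (A : CLabel F) : Function.Injective (D.lin A) := by
  intro β β' h
  refine D.l_injective A β β' fun g hg => ?_
  obtain ⟨g, rfl⟩ := toCoord_bijective.2 g
  have := DFunLike.congr_fun h ⟨g, hg⟩
  rwa [lin_apply, lin_apply] at this

theorem mackey [Fintype F] (A : CLabel F) (β β' : B) {y : XS F} (hy : y ∉ D.sub A) :
    ∃ n ∈ D.sub A, y * n * y⁻¹ ∈ D.sub A ∧
      extZero (D.sub A) (D.lin A β) (y * n * y⁻¹) ≠ extZero (D.sub A) (D.lin A β') n := by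
  by_contra! hcon
  refine hy (D.mem_of_conj A β β' (toCoord F y) fun g hg hu => ?_)
  obtain ⟨n, rfl⟩ := toCoord_bijective.2 g
  rw [← map_inv, ← map_mul, ← map_mul] at hu ⊢
  have h := hcon n hg hu
  rwa [D.extZero_lin A β hu, D.extZero_lin A β' hg] at h

theorem mackey' [Fintype F] (A : CLabel F) {β β' : B} (hne : β ≠ β') (y : XS F) :
    ∃ n ∈ D.sub A, y * n * y⁻¹ ∈ D.sub A ∧
      extZero (D.sub A) (D.lin A β) (y * n * y⁻¹) ≠ extZero (D.sub A) (D.lin A β') n := by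
  by_cases hy : y ∈ D.sub A
  · by_contra! hcon
    refine hne (D.l_injective A β β' fun g hg => ?_)
    obtain ⟨n, rfl⟩ := toCoord_bijective.2 g
    replace hg : n ∈ D.sub A := hg
    have hn := mul_mem (mul_mem hy hg) (inv_mem hy)
    have h := hcon n hg hn
    rw [extZero_of_mem _ hn, extZero_of_mem _ hg] at h
    have e : D.lin A β ⟨y * n * y⁻¹, hn⟩ = D.lin A β ⟨n, hg⟩ := by
      change D.lin A β (⟨y, hy⟩ * ⟨n, hg⟩ * ⟨y, hy⟩⁻¹) = _
      rw [map_mul, map_mul, mul_right_comm, ← map_mul, mul_inv_cancel, map_one, one_mul]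
    rw [e] at h
    exact h
  · exact D.mackey A β β' hy

variable [Fintype F]

theorem char_mem_irr (A : CLabel F) (β : B) : D.char A β ∈ Irr (XS F) :=
  let _ := Fintype.ofFinite (XS F)
  indChar_mem_irr _ fun _ hy => D.mackey A β β hy

theorem char_inv (A : CLabel F) (β : B) (g : XS F) :
    D.char A β g⁻¹ = starRingEnd ℂ (D.char A β g) :=
  let _ := Fintype.ofFinite (XS F)
  indChar_inv _ g

theorem char_one_ne_zero (A : CLabel F) (β : B) : D.char A β 1 ≠ 0 :=
  irr_apply_one_ne_zero (D.char_mem_irr A β)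

theorem char_apply_zSub (A : CLabel F) (β : B) (z : zSub F) :
    D.char A β z = A.char p z * D.char A β 1 := by
  let _ := Fintype.ofFinite (XS F)
  have hz : (z : XS F) ∈ D.sub A := D.zSub_le A z.2
  have h := indChar_central_mul (D.lin A β) (zSub_le_center z.2) hz 1
  rw [mul_one, lin_apply, form, D.l_zSub A β _ z.2, ← CLabel.char_apply] at h
  exact h

theorem char_one (A : CLabel F) (β : B) {n : ℕ} (hn : n ≤ 20)
    (h : Nat.card (D.N A) = Fintype.card F ^ n) :
    D.char A β 1 = (Fintype.card F : ℂ) ^ (20 - n) := by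
  let _ := Fintype.ofFinite (XS F)
  have hq : (Fintype.card F : ℂ) ≠ 0 := Nat.cast_ne_zero.mpr Fintype.card_ne_zero
  rw [char, indChar_one, card_XS, sub, card_comap_toCoord, h, Nat.cast_pow, Nat.cast_pow,
    pow_sub₀ _ hq hn, div_eq_mul_inv]

/-- The restriction to X_Z returns `A`; for fixed `A`, Mackey's criterion separates the labels `β`.
-/
theorem char_injective : Function.Injective fun x : CLabel F × B => D.char x.1 x.2 := by
  rintro ⟨A, β⟩ ⟨A', β'⟩ h
  simp only at h
  obtain rfl : A = A' := CLabel.char_injective p (MonoidHom.ext fun z =>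
    mul_right_cancel₀ (D.char_one_ne_zero A β) (by
      rw [← char_apply_zSub, h, char_apply_zSub]))
  congr 1
  by_contra hne
  let _ := Fintype.ofFinite (XS F)
  exact indChar_ne (fun e => hne (D.lin_injective A e)) (D.char_mem_irr A β)
    (fun y _ => D.mackey' A hne y) h

end MonomialFamily

/-- A root subgroup of `Z` in the kernel would give φ(a t) = 1 for all t, although its label `a` is
a unit. -/
theorem mem_irrOver {χ : XS F → ℂ} [Fintype F] (h : χ ∈ Irr (XS F)) (A : CLabel F)
    (hA : ∀ z : zSub F, χ z = A.char p z * χ 1) : χ ∈ core.IrrOver F coreZ := by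
  have aux : ∀ (n : ℕ) (hn : ix n ∈ core.P) (a : Fˣ) (hz : ∀ t : F, xS n t hn ∈ zSub F)
      (_ : ∀ t : F, A.form (toCoord F (xS n t hn)) = a * t),
      ¬ (Set.range (core.elt (ix n) hn (F := F)) ⊆ charKer χ) := by
    intro n hn a hz ha hsub
    refine a.ne_zero (eq_of_phi_mul_eq p fun t => ?_)
    have h1 : χ (xS n t hn) = χ 1 := hsub ⟨t, rfl⟩
    have h2 := hA ⟨xS n t hn, hz t⟩
    rw [CLabel.char_apply, ha, h1] at h2
    rw [zero_mul, phi_zero]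
    exact (mul_eq_right₀ (irr_apply_one_ne_zero h)).mp h2.symm
  refine ⟨h, fun i hi => ?_⟩
  simp only [coreZ, Finset.mem_insert, Finset.mem_singleton] at hi
  rcases hi with rfl | rfl | rfl | rfl | rfl <;> intro hi
  · exact aux 17 hi A.a17 xS17_mem_zSub fun t => by simp [CLabel.form]
  · exact aux 18 hi A.a18 xS18_mem_zSub fun t => by simp [CLabel.form]
  · exact aux 20 hi A.a20 xS20_mem_zSub fun t => by simp [CLabel.form]
  · exact aux 21 hi A.a21 xS21_mem_zSub fun t => by simp [CLabel.form]
  · exact aux 24 hi A.a24 xS24_mem_zSub fun t => by simp [CLabel.form]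

theorem mem_of_xS_mem [Fintype F] {H : Subgroup (XS F)} (g : XS F)
    (h1 : xS 1 (toCoord F g).c1 ∈ H) (h2 : xS 2 (toCoord F g).c2 ∈ H)
    (h3 : xS 3 (toCoord F g).c3 ∈ H) (h5 : xS 5 (toCoord F g).c5 ∈ H)
    (h6 : xS 6 (toCoord F g).c6 ∈ H) (h8 : xS 8 (toCoord F g).c8 ∈ H)
    (h9 : xS 9 (toCoord F g).c9 ∈ H) (h10 : xS 10 (toCoord F g).c10 ∈ H)
    (h7 : xS 7 (toCoord F g).c7 ∈ H) (h11 : xS 11 (toCoord F g).c11 ∈ H)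
    (h12 : xS 12 (toCoord F g).c12 ∈ H) (h13 : xS 13 (toCoord F g).c13 ∈ H)
    (h14 : xS 14 (toCoord F g).c14 ∈ H) (h15 : xS 15 (toCoord F g).c15 ∈ H)
    (h16 : xS 16 (toCoord F g).c16 ∈ H) (h17 : xS 17 (toCoord F g).c17 ∈ H)
    (h18 : xS 18 (toCoord F g).c18 ∈ H) (h20 : xS 20 (toCoord F g).c20 ∈ H)
    (h21 : xS 21 (toCoord F g).c21 ∈ H) (h24 : xS 24 (toCoord F g).c24 ∈ H) : g ∈ H := by
  rw [← ofCoord_toCoord g, ofCoord]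
  repeat' apply mul_mem
  all_goals assumption

theorem xS_zero (n : ℕ) (h : ix n ∈ core.P) : xS n (0 : F) h = 1 := by
  have h := xS_add n h (0 : F) 0
  rwa [add_zero, mul_eq_left] at h

theorem xS_mem_of_eq_zero {H : Subgroup (XS F)} {n : ℕ} {h : ix n ∈ core.P} {t : F} (ht : t = 0) :
    xS n t h ∈ H := by
  rw [ht, xS_zero]
  exact one_mem _

theorem card_CLabel [Fintype F] : Nat.card (CLabel F) = (Fintype.card F - 1) ^ 5 := by
  let e : CLabel F ≃ (Fin 5 → Fˣ) :=
    { toFun := fun A => ![A.a17, A.a18, A.a20, A.a21, A.a24]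
      invFun := fun v => ⟨v 0, v 1, v 2, v 3, v 4⟩
      left_inv := fun A => rfl
      right_inv := fun v => by
        ext i
        fin_cases i <;> rfl }
  rw [Nat.card_congr e, Nat.card_fun, Nat.card_units, Nat.card_eq_fintype_card, Nat.card_fin]

end MonomialFamily

section Fields

variable {F : Type*} [Field F]

theorem card_eq_pow_of_equiv [Fintype F] {M : Subgroup (Coord F)} {n : ℕ} (e : M ≃ (Fin n → F)) :
    Nat.card M = Fintype.card F ^ n := by
  rw [Nat.card_congr e, Nat.card_fun, Nat.card_eq_fintype_card, Nat.card_fin]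

end Fields

/-! ### The family for p ≠ 3. -/

section FamilyNe3

variable {F : Type*} [Field F]

/-- The subgroup inducing the characters with label `A` for `p ≠ 3`. -/
def subNe3 (A : CLabel F) : Subgroup (Coord F) where
  carrier := {g | g.c1 = 0 ∧ g.c6 = 0 ∧ g.c8 = 0 ∧ g.c9 = 0 ∧ g.c10 = 0 ∧
    -- The line of x_{2,3,5}: the common zeros of the forms by which X_16 and X_12 pair with X_2,
    -- X_3, X_5.
    A.a20 * g.c2 + A.a21 * g.c3 = 0 ∧ A.a17 * g.c2 - A.a18 * g.c5 = 0}
  one_mem' := by simp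
  mul_mem' := by
    rintro g h ⟨h1, h6, h8, h9, h10, h3, h5⟩ ⟨k1, k6, k8, k9, k10, k3, k5⟩
    simp only [Set.mem_ofPred_eq, Coord.mul_c1, Coord.mul_c2, Coord.mul_c3, Coord.mul_c5,
      Coord.mul_c6, Coord.mul_c8, Coord.mul_c9, Coord.mul_c10, h1, h6, h8, h9, h10, k1, k6, k8,
      k9, k10, add_zero, true_and]
    exact ⟨by linear_combination h3 + k3, by linear_combination h5 + k5⟩
  inv_mem' := by
    rintro g ⟨h1, h6, h8, h9, h10, h3, h5⟩
    simp only [Set.mem_ofPred_eq, Coord.inv_c1, Coord.inv_c2, Coord.inv_c3, Coord.inv_c5,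
      Coord.inv_c6, Coord.inv_c8, Coord.inv_c9, Coord.inv_c10, h1, h6, h8, h9, h10, neg_zero,
      true_and]
    exact ⟨by linear_combination -h3, by linear_combination -h5⟩

/-- The linear form with label `(A, b)` for `p ≠ 3`. -/
def formNe3 (A : CLabel F) (b : F) (g : Coord F) : F :=
  b * (A.a18 * A.a21 : F)⁻¹ * g.c2 + A.form g

theorem mem_subNe3_of_conj [Fintype F] {p : ℕ} [Fact p.Prime] [CharP F p] (hp : (3 : F) ≠ 0)
    (A : CLabel F) (b b' : F) (u : Coord F)
    (h : ∀ g ∈ subNe3 A, u * g * u⁻¹ ∈ subNe3 A →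
      phi p (formNe3 A b (u * g * u⁻¹)) = phi p (formNe3 A b' g)) : u ∈ subNe3 A := by
  -- A one-parameter family in the kernel of the second form, whose conjugates stay in the subgroup,
  -- gives a condition on `u`: φ(a t) = 1 for all t forces `a = 0`.
  have key : ∀ (y : F → Coord F) (a : F)
      (_ : ∀ t, y t ∈ subNe3 A ∧ u * y t * u⁻¹ ∈ subNe3 A ∧ formNe3 A b' (y t) = 0 ∧
        formNe3 A b (u * y t * u⁻¹) = a * t), a = 0 := by
    intro y a hy
    refine eq_of_phi_mul_eq p fun t => ?_
    obtain ⟨h1, h2, h3, h4⟩ := hy t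
    rw [← h4, h _ h1 h2, h3, zero_mul]
  have e7 := key (fun t => ⟨0, 0, 0, 0, 0, 0, 0, 0, t, 0, 0, 0, 0, 0, 0, 0, 0, 0, 0, 0⟩)
    (-(A.a17 * u.c8) - A.a18 * u.c10) fun t => by
      simp [Coord.conj_c7, subNe3, formNe3, CLabel.form]; ring1
  have e11 := key (fun t => ⟨0, 0, 0, 0, 0, 0, 0, 0, 0, t, 0, 0, 0, 0, 0, 0, 0, 0, 0, 0⟩)
    (A.a20 * u.c8 + A.a21 * u.c9) fun t => by
      simp [Coord.conj_c11, subNe3, formNe3, CLabel.form]; ring1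
  have e12 := key (fun t => ⟨0, 0, 0, 0, 0, 0, 0, 0, 0, 0, t, 0, 0, 0, 0, 0, 0, 0, 0, 0⟩)
    (A.a17 * u.c2 - A.a18 * u.c5) fun t => by
      simp [Coord.conj_c12, subNe3, formNe3, CLabel.form]; ring1
  have e13 := key (fun t => ⟨0, 0, 0, 0, 0, 0, 0, 0, 0, 0, 0, t, 0, 0, 0, 0, 0, 0, 0, 0⟩)
    (A.a17 * u.c1 - A.a24 * u.c10) fun t => by
      simp [Coord.conj_c13, subNe3, formNe3, CLabel.form]; ring1
  have e14 := key (fun t => ⟨0, 0, 0, 0, 0, 0, 0, 0, 0, 0, 0, 0, t, 0, 0, 0, 0, 0, 0, 0⟩)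
    (-(A.a20 * u.c6) - A.a24 * u.c9) fun t => by
      simp [Coord.conj_c14, subNe3, formNe3, CLabel.form]; ring1
  have e15 := key (fun t => ⟨0, 0, 0, 0, 0, 0, 0, 0, 0, 0, 0, 0, 0, t, 0, 0, 0, 0, 0, 0⟩)
    (A.a18 * u.c1 - A.a21 * u.c6 - A.a24 * u.c8) fun t => by
      simp [Coord.conj_c15, subNe3, formNe3, CLabel.form]; ring1
  have e16 := key (fun t => ⟨0, 0, 0, 0, 0, 0, 0, 0, 0, 0, 0, 0, 0, 0, t, 0, 0, 0, 0, 0⟩)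
    (A.a20 * u.c2 + A.a21 * u.c3) fun t => by
      simp [Coord.conj_c16, subNe3, formNe3, CLabel.form]; ring1
  have h10 : u.c10 = 0 := by
    -- Eliminating the other four unknowns leaves the coefficient 3, which is where p ≠ 3 enters.
    have : (3 * A.a18 * A.a24 * A.a20 : F) * u.c10 = 0 := by
      linear_combination A.a17 * A.a20 * e15 - A.a18 * A.a20 * e13 - A.a17 * A.a21 * e14 - A.a17 * A.a24 * e11 -
        2 * A.a24 * A.a20 * e7
    simpa [hp] using this
  have h8 : u.c8 = 0 := by simpa [h10] using e7
  have h9 : u.c9 = 0 := by simpa [h8] using e11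
  have h1 : u.c1 = 0 := by simpa [h10] using e13
  have h6 : u.c6 = 0 := by simpa [h9] using e14
  exact ⟨h1, h6, h8, h9, h10, e16, e12⟩

theorem zSub_le_subNe3 (A : CLabel F) : Coord.zSub F ≤ subNe3 A := by
  rintro z ⟨h1, h2, h3, h5, h6, h8, h9, h10, -⟩
  exact ⟨h1, h6, h8, h9, h10, by simp [h2, h3], by simp [h2, h5]⟩

theorem formNe3_injective [Fintype F] (p : ℕ) [Fact p.Prime] [CharP F p] (A : CLabel F) (b b' : F)
    (h : ∀ g ∈ subNe3 A, phi p (formNe3 A b g) = phi p (formNe3 A b' g)) : b = b' := by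
  refine eq_of_phi_mul_eq p fun t => ?_
  have h' := h ⟨0, A.a18 * A.a21 * t, -(A.a18 * A.a20 * t), A.a17 * A.a21 * t, 0, 0, 0, 0, 0, 0, 0,
    0, 0, 0, 0, 0, 0, 0, 0, 0⟩ ⟨rfl, rfl, rfl, rfl, rfl, by ring1, by ring1⟩
  have n18 := A.a18.ne_zero
  have n21 := A.a21.ne_zero
  have e : ∀ b : F, b * (A.a18 * A.a21 : F)⁻¹ * (A.a18 * A.a21 * t) = b * t := fun b => by
    field_simp
  simp only [formNe3, CLabel.form, mul_zero, add_zero, e] at h'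
  exact h'

/-- The characters for `p ≠ 3`. -/
def familyNe3 [Fintype F] (p : ℕ) [Fact p.Prime] [CharP F p] (hp : (3 : F) ≠ 0) :
    MonomialFamily p F F where
  N := subNe3
  l := formNe3
  l_mul := by
    rintro A b g ⟨h1, h6, h8, h9, h10, h3, h5⟩ h ⟨k1, k6, k8, k9, k10, k3, k5⟩
    simp only [formNe3, CLabel.form, Coord.mul_c2, Coord.mul_c17, Coord.mul_c18, Coord.mul_c20,
      Coord.mul_c21, Coord.mul_c24, h6, h8, h9, h10, k1, k6, k8, k9, k10, mul_zero, zero_mul]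
    -- The terms violating additivity are `g.c12` and `g.c16` times the two equations of the line of
    -- x_{2,3,5}.
    linear_combination -g.c12 * k5 - g.c16 * k3
  zSub_le := zSub_le_subNe3
  l_zSub := by
    rintro A b z ⟨-, h2, -⟩
    simp [formNe3, h2]
  l_injective := formNe3_injective p
  mem_of_conj := mem_subNe3_of_conj hp

theorem card_subNe3 [Fintype F] (A : CLabel F) : Nat.card (subNe3 A) = Fintype.card F ^ 13 := by
  have n18 := A.a18.ne_zero
  have n21 := A.a21.ne_zero
  exact card_eq_pow_of_equiv
    { toFun := fun g => ![g.1.c2, g.1.c7, g.1.c11, g.1.c12, g.1.c13, g.1.c14, g.1.c15, g.1.c16,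
        g.1.c17, g.1.c18, g.1.c20, g.1.c21, g.1.c24]
      invFun := fun v => ⟨⟨0, v 0, -(A.a20 * v 0 / A.a21), A.a17 * v 0 / A.a18, 0, 0, 0, 0, v 1,
        v 2, v 3, v 4, v 5, v 6, v 7, v 8, v 9, v 10, v 11, v 12⟩,
        rfl, rfl, rfl, rfl, rfl, by field_simp; ring1, by field_simp; ring1⟩
      left_inv := by
        rintro ⟨g, h1, h6, h8, h9, h10, h3, h5⟩
        have e3 : g.c3 = -(A.a20 * g.c2 / A.a21) := by
          field_simp
          linear_combination h3
        have e5 : g.c5 = A.a17 * g.c2 / A.a18 := by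
          field_simp
          linear_combination -h5
        ext <;> simp [*]
      right_inv := fun v => by
        ext i
        fin_cases i <;> rfl }

theorem toCoord_x235 (A : CLabel F) (t : F) : toCoord F (x235 A t) =
    ⟨0, A.a18 * A.a21 * t, -(A.a18 * A.a20 * t), A.a17 * A.a21 * t, 0, 0, 0, 0, 0, 0, 0, 0, 0, 0, 0,
      0, 0, 0, 0, 0⟩ := by
  simp only [x235, map_mul, toCoord_xS2, toCoord_xS3, toCoord_xS5, Coord.mk_mul_mk, mul_zero,
    zero_mul, sub_zero, add_zero, zero_add, neg_zero]

theorem isIndFrom_dataNe3_iff [Fintype F] (p : ℕ) [Fact p.Prime] [CharP F p] (hp : (3 : F) ≠ 0) (A : CLabel F)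
    (b : F) (χ : XS F → ℂ) :
    IsIndFrom p (dataNe3 A b) χ ↔ χ = (familyNe3 p hp).char A b := by
  have n18 := A.a18.ne_zero
  have n21 := A.a21.ne_zero
  refine isIndFrom_iff p ((familyNe3 p hp).form_mul A b) ?_ ?_ ?_
  · intro d hd t
    change toCoord F _ ∈ subNe3 A
    simp only [dataNe3, dataZ, List.cons_append, List.nil_append, List.mem_cons, List.not_mem_nil,
      or_false] at hd
    rcases hd with rfl | rfl | rfl | rfl | rfl | rfl | rfl | rfl | rfl | rfl | rfl | rfl | rfl
    · rw [toCoord_x235]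
      exact ⟨rfl, rfl, rfl, rfl, rfl, by ring1, by ring1⟩
    all_goals simp [subNe3]
  · intro d hd t
    change formNe3 A b (toCoord F _) = _
    simp only [dataNe3, dataZ, List.cons_append, List.nil_append, List.mem_cons, List.not_mem_nil,
      or_false] at hd
    rcases hd with rfl | rfl | rfl | rfl | rfl | rfl | rfl | rfl | rfl | rfl | rfl | rfl | rfl
    · rw [toCoord_x235]
      simp only [formNe3, CLabel.form]
      field_simp
      ring1
    all_goals simp [formNe3, CLabel.form]
  · rintro g ⟨h1, h6, h8, h9, h10, h3, h5⟩
    have mem : ∀ d ∈ dataNe3 A b, ∀ t,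
        d.1 t ∈ Subgroup.closure {g : XS F | ∃ d ∈ dataNe3 A b, ∃ t, g = d.1 t} :=
      fun d hd t => Subgroup.subset_closure ⟨d, hd, t, rfl⟩
    generalize Subgroup.closure {g : XS F | ∃ d ∈ dataNe3 A b, ∃ t, g = d.1 t} = H at mem
    simp only [dataNe3, dataZ, List.cons_append, List.nil_append, List.forall_mem_cons,
      List.not_mem_nil, false_imp_iff, implies_true, and_true] at mem
    obtain ⟨m, m7, m11, m12, m13, m14, m15, m16, m17, m18, m20, m21, m24⟩ := mem
    replace h1 : (toCoord F g).c1 = 0 := h1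
    replace h6 : (toCoord F g).c6 = 0 := h6
    replace h8 : (toCoord F g).c8 = 0 := h8
    replace h9 : (toCoord F g).c9 = 0 := h9
    replace h10 : (toCoord F g).c10 = 0 := h10
    have e3 : (toCoord F g).c3 = -(A.a18 * A.a20 * ((toCoord F g).c2 / (A.a18 * A.a21))) := by
      field_simp
      linear_combination h3
    have e5 : (toCoord F g).c5 = A.a17 * A.a21 * ((toCoord F g).c2 / (A.a18 * A.a21)) := by
      field_simp
      linear_combination -h5
    have e2 : (toCoord F g).c2 = A.a18 * A.a21 * ((toCoord F g).c2 / (A.a18 * A.a21)) := by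
      field_simp
    have e : xS 2 (toCoord F g).c2 * xS 3 (toCoord F g).c3 * xS 5 (toCoord F g).c5 =
        x235 A ((toCoord F g).c2 / (A.a18 * A.a21)) := by
      rw [x235, ← e2, ← e3, ← e5]
    rw [← ofCoord_toCoord g, ofCoord, h1, h6, h8, h9, h10]
    simp only [xS_zero, one_mul, mul_one]
    have mx := m ((toCoord F g).c2 / (A.a18 * A.a21))
    rw [← e] at mx
    generalize xS 2 (toCoord F g).c2 * xS 3 (toCoord F g).c3 * xS 5 (toCoord F g).c5 = y at mx ⊢
    repeat' apply mul_mem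
    exacts [mx, m7 _, m11 _, m12 _, m13 _, m14 _, m15 _, m16 _, m17 _, m18 _, m20 _, m21 _, m24 _]

end FamilyNe3

/-! ### The first family for p = 3. -/

section FamilyOne

variable {F : Type*} [Field F]

/-- Modulo 3 the equation coming from X_7 is a consequence of these four, so the solutions form a
line. Leaving that equation out makes the lemma applicable when the form also sees the coordinate
`c7`. -/
theorem CLabel.exists_param (hp : (3 : F) = 0) (A : CLabel F) {u1 u6 u8 u9 u10 : F}
    (e11 : A.a20 * u8 + A.a21 * u9 = 0) (e13 : A.a17 * u1 - A.a24 * u10 = 0)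
    (e14 : -(A.a20 * u6) - A.a24 * u9 = 0) (e15 : A.a18 * u1 - A.a21 * u6 - A.a24 * u8 = 0) :
    ∃ s, u1 = A.a21 * A.a24 * s ∧ u6 = -(A.a18 * A.a24 * s) ∧ u8 = -(A.a18 * A.a21 * s) ∧
      u9 = A.a18 * A.a20 * s ∧ u10 = A.a17 * A.a21 * s := by
  have n17 := A.a17.ne_zero
  have n20 := A.a20.ne_zero
  have n21 := A.a21.ne_zero
  have e7 : -(A.a17 * u8) - A.a18 * u10 = 0 := by
    have : (A.a24 * A.a20 : F) * (-(A.a17 * u8) - A.a18 * u10) = 0 := by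
      linear_combination -A.a17 * A.a20 * e15 + A.a18 * A.a20 * e13 + A.a17 * A.a21 * e14 +
        A.a17 * A.a24 * e11 +
        A.a24 * A.a20 * (-(A.a17 * u8) - A.a18 * u10 + A.a18 * u10) * hp
    simpa using this
  obtain ⟨s, rfl⟩ : ∃ s, u10 = A.a17 * A.a21 * s := ⟨u10 / (A.a17 * A.a21), by field_simp⟩
  have e8 : u8 = -(A.a18 * A.a21 * s) := mul_left_cancel₀ n17 (by linear_combination -e7)
  subst e8
  have e9 : u9 = A.a18 * A.a20 * s := mul_left_cancel₀ n21 (by linear_combination e11)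
  subst e9
  exact ⟨s, mul_left_cancel₀ n17 (by linear_combination e13),
    mul_left_cancel₀ n20 (by linear_combination -e14), rfl, rfl, rfl⟩

variable (F) in
/-- The subgroup inducing the characters of the first family for `p = 3`. -/
def subOne : Subgroup (Coord F) where
  carrier := {g | g.c1 = 0 ∧ g.c6 = 0 ∧ g.c8 = 0 ∧ g.c9 = 0 ∧ g.c10 = 0 ∧ g.c12 = 0 ∧ g.c16 = 0}
  one_mem' := by simp
  mul_mem' := by
    rintro g h ⟨h1, h6, h8, h9, h10, h12, h16⟩ ⟨k1, k6, k8, k9, k10, k12, k16⟩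
    simp [*]
  inv_mem' := by
    rintro g ⟨h1, h6, h8, h9, h10, h12, h16⟩
    simp [*]

/-- The linear form with label `(A, c)` of the first family for `p = 3`. -/
def formOne (A : CLabel F) (c : Fˣ) (g : Coord F) : F :=
  c * (A.a20 * A.a24 : F)⁻¹ * g.c7 + A.form g

-- The roots 11, 13, 14, 15 put the five coordinates of `u` on a line with parameter `s`; then x_5
-- and x_2 determine `u.c12` and `u.c16` as multiples of s². Conjugating x_3(t) puts t u_1 into the
-- coordinate `c7`, which the form sees with the nonzero label `c`, and this forces `s = 0`.
set_option maxHeartbeats 1000000 in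
theorem mem_subOne_of_conj [Fintype F] {p : ℕ} [Fact p.Prime] [CharP F p] (hp : (3 : F) = 0)
    (A : CLabel F) (c c' : Fˣ) (u : Coord F)
    (h : ∀ g ∈ subOne F, u * g * u⁻¹ ∈ subOne F →
      phi p (formOne A c (u * g * u⁻¹)) = phi p (formOne A c' g)) : u ∈ subOne F := by
  have key : ∀ (y : F → Coord F) (a a' : F)
      (_ : ∀ t, y t ∈ subOne F ∧ u * y t * u⁻¹ ∈ subOne F ∧ formOne A c' (y t) = a' * t ∧
        formOne A c (u * y t * u⁻¹) = a * t), a = a' := by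
    intro y a a' hy
    refine eq_of_phi_mul_eq p fun t => ?_
    obtain ⟨h1, h2, h3, h4⟩ := hy t
    rw [← h4, h _ h1 h2, h3]
  have e7 := key (fun t => ⟨0, 0, 0, 0, 0, 0, 0, 0, t, 0, 0, 0, 0, 0, 0, 0, 0, 0, 0, 0⟩)
    (c * (A.a20 * A.a24 : F)⁻¹ - A.a17 * u.c8 - A.a18 * u.c10) (c' * (A.a20 * A.a24 : F)⁻¹)
    fun t => by
      simp [Coord.conj_c7, subOne, formOne, CLabel.form]; ring1
  have e11 := key (fun t => ⟨0, 0, 0, 0, 0, 0, 0, 0, 0, t, 0, 0, 0, 0, 0, 0, 0, 0, 0, 0⟩)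
    (A.a20 * u.c8 + A.a21 * u.c9) 0 fun t => by
      simp [Coord.conj_c11, subOne, formOne, CLabel.form]; ring1
  have e13 := key (fun t => ⟨0, 0, 0, 0, 0, 0, 0, 0, 0, 0, 0, t, 0, 0, 0, 0, 0, 0, 0, 0⟩)
    (A.a17 * u.c1 - A.a24 * u.c10) 0 fun t => by
      simp [Coord.conj_c13, subOne, formOne, CLabel.form]; ring1
  have e14 := key (fun t => ⟨0, 0, 0, 0, 0, 0, 0, 0, 0, 0, 0, 0, t, 0, 0, 0, 0, 0, 0, 0⟩)
    (-(A.a20 * u.c6) - A.a24 * u.c9) 0 fun t => by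
      simp [Coord.conj_c14, subOne, formOne, CLabel.form]; ring1
  have e15 := key (fun t => ⟨0, 0, 0, 0, 0, 0, 0, 0, 0, 0, 0, 0, 0, t, 0, 0, 0, 0, 0, 0⟩)
    (A.a18 * u.c1 - A.a21 * u.c6 - A.a24 * u.c8) 0 fun t => by
      simp [Coord.conj_c15, subOne, formOne, CLabel.form]; ring1
  have e2 := key (fun t => ⟨0, t, 0, 0, 0, 0, 0, 0, 0, 0, 0, 0, 0, 0, 0, 0, 0, 0, 0, 0⟩)
    (-(A.a17 * (u.c1 * u.c9 + u.c12)) + A.a20 * (u.c10 * u.c6 - u.c16) + A.a24 * u.c10 * u.c9) 0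
    fun t => by
      simp [Coord.conj_c2, subOne, formOne, CLabel.form]; ring1
  have e3 := key (fun t => ⟨0, 0, t, 0, 0, 0, 0, 0, 0, 0, 0, 0, 0, 0, 0, 0, 0, 0, 0, 0⟩)
    (c * (A.a20 * A.a24 : F)⁻¹ * u.c1 - A.a17 * u.c1 * u.c8 - A.a18 * u.c1 * u.c10 +
      A.a21 * (u.c10 * u.c6 - u.c16) + A.a24 * u.c10 * u.c8) 0
    fun t => by
      simp [Coord.conj_c3, subOne, formOne, CLabel.form]; ring1
  have e5 := key (fun t => ⟨0, 0, 0, t, 0, 0, 0, 0, 0, 0, 0, 0, 0, 0, 0, 0, 0, 0, 0, 0⟩)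
    (A.a18 * (u.c1 * u.c9 + u.c12) - A.a20 * u.c6 * u.c8 - A.a21 * u.c6 * u.c9 -
      A.a24 * u.c8 * u.c9) 0
    fun t => by
      simp [Coord.conj_c5, subOne, formOne, CLabel.form]; ring1
  have n17 := A.a17.ne_zero
  have n18 := A.a18.ne_zero
  have n20 := A.a20.ne_zero
  have n21 := A.a21.ne_zero
  obtain ⟨s, h1, h6, h8, h9, h10⟩ := A.exists_param hp e11 e13 e14 e15
  rw [h1, h9, h10, h6] at e2
  rw [h1, h8, h10, h6] at e3
  rw [h1, h9, h8, h6] at e5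
  have h12 : u.c12 = A.a18 * A.a20 * A.a21 * A.a24 * s ^ 2 := mul_left_cancel₀ n18 (by
    linear_combination e5 - A.a18 * (A.a18 * A.a20 * A.a21 * A.a24 * s ^ 2) * hp)
  have h16 : u.c16 = A.a17 * A.a18 * A.a21 * A.a24 * s ^ 2 := mul_left_cancel₀ n20 (by
    linear_combination -e2 - A.a17 * h12 - A.a17 * A.a18 * A.a20 * A.a21 * A.a24 * s ^ 2 * hp)
  -- All terms in s² of `e3` add up to a multiple of 3.
  have hs : (c * (A.a20 * A.a24 : F)⁻¹ * (A.a21 * A.a24)) * s = 0 := by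
    linear_combination e3 + A.a21 * h16 + A.a17 * A.a18 * A.a21 ^ 2 * A.a24 * s ^ 2 * hp
  obtain rfl : s = 0 := by simpa using hs
  simp only [mul_zero, neg_zero, ne_eq, OfNat.ofNat_ne_zero, not_false_eq_true, zero_pow]
    at h1 h6 h8 h9 h10 h12 h16
  exact ⟨h1, h6, h8, h9, h10, h12, h16⟩

theorem zSub_le_subOne : Coord.zSub F ≤ subOne F := by
  rintro z ⟨h1, h2, h3, h5, h6, h8, h9, h10, h7, h11, h12, h13, h14, h15, h16⟩
  exact ⟨h1, h6, h8, h9, h10, h12, h16⟩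

theorem formOne_injective [Fintype F] (p : ℕ) [Fact p.Prime] [CharP F p] (A : CLabel F)
    (c c' : Fˣ) (h : ∀ g ∈ subOne F, phi p (formOne A c g) = phi p (formOne A c' g)) : c = c' := by
  refine Units.ext (eq_of_phi_mul_eq p fun t => ?_)
  have h' := h ⟨0, 0, 0, 0, 0, 0, 0, 0, A.a20 * A.a24 * t, 0, 0, 0, 0, 0, 0, 0, 0, 0, 0, 0⟩
    ⟨rfl, rfl, rfl, rfl, rfl, rfl, rfl⟩
  have n20 := A.a20.ne_zero
  have n24 := A.a24.ne_zero
  have e : ∀ b : F, b * (A.a20 * A.a24 : F)⁻¹ * (A.a20 * A.a24 * t) = b * t := fun b => by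
    field_simp
  simp only [formOne, CLabel.form, mul_zero, add_zero, e] at h'
  exact h'

/-- The characters of the first family for `p = 3`. -/
def familyOne [Fintype F] (p : ℕ) [Fact p.Prime] [CharP F p] (hp : (3 : F) = 0) :
    MonomialFamily p F Fˣ where
  N _ := subOne F
  l := formOne
  l_mul := by
    rintro A b g ⟨h1, h6, h8, h9, h10, h12, h16⟩ h ⟨k1, k6, k8, k9, k10, k12, k16⟩
    simp only [formOne, CLabel.form, Coord.mul_c7, Coord.mul_c17, Coord.mul_c18, Coord.mul_c20,
      Coord.mul_c21, Coord.mul_c24, h6, h8, h9, h10, h12, h16, k1, k6, k8, k9, k10, mul_zero,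
      zero_mul]
    ring1
  zSub_le _ := zSub_le_subOne
  l_zSub := by
    rintro A b z ⟨-, -, -, -, -, -, -, -, h7, -⟩
    simp [formOne, h7]
  l_injective := formOne_injective p
  mem_of_conj := mem_subOne_of_conj hp

variable (F) in
theorem card_subOne [Fintype F] : Nat.card (subOne F) = Fintype.card F ^ 13 :=
  card_eq_pow_of_equiv
    { toFun := fun g => ![g.1.c2, g.1.c3, g.1.c5, g.1.c7, g.1.c11, g.1.c13, g.1.c14, g.1.c15,
        g.1.c17, g.1.c18, g.1.c20, g.1.c21, g.1.c24]
      invFun := fun v => ⟨⟨0, v 0, v 1, v 2, 0, 0, 0, 0, v 3, v 4, 0, v 5, v 6, v 7, 0, v 8, v 9,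
        v 10, v 11, v 12⟩, rfl, rfl, rfl, rfl, rfl, rfl, rfl⟩
      left_inv := by
        rintro ⟨g, h1, h6, h8, h9, h10, h12, h16⟩
        ext <;> simp [*]
      right_inv := fun v => by
        ext i
        fin_cases i <;> rfl }

theorem toCoord_xJ (A : CLabel F) (t : F) : toCoord F (xJ A t) =
    ⟨0, 0, 0, 0, 0, 0, 0, 0, A.a20 * A.a24 * t, -(A.a17 * A.a24 * t), 0, -(A.a18 * A.a20 * t),
      -(A.a17 * A.a21 * t), A.a17 * A.a20 * t, 0, 0, 0, 0, 0, 0⟩ := by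
  simp only [xJ, map_mul, toCoord_xS7, toCoord_xS11, toCoord_xS13, toCoord_xS14, toCoord_xS15,
    Coord.mk_mul_mk, mul_zero, sub_zero, add_zero, zero_add, neg_zero]

theorem isIndFrom_dataOne_iff [Fintype F] (p : ℕ) [Fact p.Prime] [CharP F p] (hp : (3 : F) = 0)
    (A : CLabel F) (c : Fˣ) (χ : XS F → ℂ) :
    IsIndFrom p (dataOne A c) χ ↔ χ = (familyOne p hp).char A c := by
  have n20 := A.a20.ne_zero
  have n24 := A.a24.ne_zero
  refine isIndFrom_iff p ((familyOne p hp).form_mul A c) ?_ ?_ ?_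
  · intro d hd t
    change toCoord F _ ∈ subOne F
    simp only [dataOne, dataZ, List.cons_append, List.nil_append, List.mem_cons, List.not_mem_nil,
      or_false] at hd
    rcases hd with rfl | rfl | rfl | rfl | rfl | rfl | rfl | rfl | rfl | rfl | rfl | rfl | rfl
    · rw [toCoord_xJ]
      exact ⟨rfl, rfl, rfl, rfl, rfl, rfl, rfl⟩
    all_goals simp [subOne]
  · intro d hd t
    change formOne A c (toCoord F _) = _
    simp only [dataOne, dataZ, List.cons_append, List.nil_append, List.mem_cons, List.not_mem_nil,
      or_false] at hd
    rcases hd with rfl | rfl | rfl | rfl | rfl | rfl | rfl | rfl | rfl | rfl | rfl | rfl | rfl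
    · rw [toCoord_xJ]
      simp only [formOne, CLabel.form]
      field_simp
      ring1
    all_goals simp [formOne, CLabel.form]
  · rintro g ⟨h1, h6, h8, h9, h10, h12, h16⟩
    have mem : ∀ d ∈ dataOne A c, ∀ t,
        d.1 t ∈ Subgroup.closure {g : XS F | ∃ d ∈ dataOne A c, ∃ t, g = d.1 t} :=
      fun d hd t => Subgroup.subset_closure ⟨d, hd, t, rfl⟩
    generalize Subgroup.closure {g : XS F | ∃ d ∈ dataOne A c, ∃ t, g = d.1 t} = H at mem
    simp only [dataOne, dataZ, List.cons_append, List.nil_append, List.forall_mem_cons,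
      List.not_mem_nil, false_imp_iff, implies_true, and_true] at mem
    obtain ⟨m, m2, m3, m5, m11, m13, m14, m15, m17, m18, m20, m21, m24⟩ := mem
    -- The other four factors of `xJ` are themselves among the generators and can be cancelled.
    have m7 : xS 7 (toCoord F g).c7 ∈ H := by
      have h := m ((toCoord F g).c7 / (A.a20 * A.a24))
      have e : A.a20 * A.a24 * ((toCoord F g).c7 / (A.a20 * A.a24)) = (toCoord F g).c7 := by
        field_simp
      rwa [xJ, mul_mem_cancel_right (m15 _), mul_mem_cancel_right (m14 _),
        mul_mem_cancel_right (m13 _), mul_mem_cancel_right (m11 _), e] at h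
    exact mem_of_xS_mem g (xS_mem_of_eq_zero h1) (m2 _) (m3 _) (m5 _) (xS_mem_of_eq_zero h6)
      (xS_mem_of_eq_zero h8) (xS_mem_of_eq_zero h9) (xS_mem_of_eq_zero h10) m7 (m11 _)
      (xS_mem_of_eq_zero h12) (m13 _) (m14 _) (m15 _) (xS_mem_of_eq_zero h16) (m17 _) (m18 _)
      (m20 _) (m21 _) (m24 _)

end FamilyOne

/-! ### The second family for p = 3. -/

section FamilyTwo

variable {F : Type*} [Field F]

/-- The subgroup inducing the characters with label `A` of the second family for `p = 3`. -/
def subTwo (hp : (3 : F) = 0) (A : CLabel F) : Subgroup (Coord F) where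
  carrier := {g | ∃ s, g.c1 = A.a21 * A.a24 * s ∧ g.c6 = -(A.a18 * A.a24 * s) ∧
    g.c8 = -(A.a18 * A.a21 * s) ∧ g.c9 = A.a18 * A.a20 * s ∧ g.c10 = A.a17 * A.a21 * s ∧
    g.c12 = A.a18 * A.a20 * A.a21 * A.a24 * s ^ 2 ∧ g.c16 = A.a17 * A.a18 * A.a21 * A.a24 * s ^ 2}
  one_mem' := ⟨0, by simp⟩
  mul_mem' := by
    rintro g h ⟨s, h1, h6, h8, h9, h10, h12, h16⟩ ⟨r, k1, k6, k8, k9, k10, k12, k16⟩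
    refine ⟨s + r, ?_⟩
    simp only [Coord.mul_c1, Coord.mul_c6, Coord.mul_c8, Coord.mul_c9, Coord.mul_c10,
      Coord.mul_c12, Coord.mul_c16, h1, h6, h8, h9, h10, h12, h16, k1, k6, k8, k9, k10, k12, k16]
    -- In characteristic 3, (s + r)² = s² + r² - s r, and - s r is the cross term of the group law;
    -- this explains the quadratic entries of `xI`.
    refine ⟨by ring1, by ring1, by ring1, by ring1, by ring1, ?_, ?_⟩
    · linear_combination -A.a18 * A.a20 * A.a21 * A.a24 * s * r * hp
    · linear_combination -A.a17 * A.a18 * A.a21 * A.a24 * s * r * hp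
  inv_mem' := by
    rintro g ⟨s, h1, h6, h8, h9, h10, h12, h16⟩
    refine ⟨-s, ?_⟩
    simp only [Coord.inv_c1, Coord.inv_c6, Coord.inv_c8, Coord.inv_c9, Coord.inv_c10,
      Coord.inv_c12, Coord.inv_c16, h1, h6, h8, h9, h10, h12, h16]
    refine ⟨by ring1, by ring1, by ring1, by ring1, by ring1, ?_, ?_⟩
    · linear_combination -A.a18 * A.a20 * A.a21 * A.a24 * s ^ 2 * hp
    · linear_combination -A.a17 * A.a18 * A.a21 * A.a24 * s ^ 2 * hp

/-- The linear form with label `(A, b, b')` of the second family for `p = 3`. -/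
def formTwo (A : CLabel F) (b : F × F) (g : Coord F) : F :=
  -- Since the character is trivial on X_2 and X_3, its value on x_{2,3,5} is carried by the
  -- coordinate `c5` alone.
  b.1 * (A.a21 * A.a24 : F)⁻¹ * g.c1 + b.2 * (A.a17 * A.a21 : F)⁻¹ * g.c5 + A.form g

-- Nothing is detected in the coordinate `c7` here, so x_3 and x_2 determine `u.c16` and `u.c12` but
-- leave `s` free: the solutions are exactly the directions of `xI`. The form vanishes on both X_2
-- and X_3, whatever the labels.
set_option maxHeartbeats 1000000 in
theorem mem_subTwo_of_conj [Fintype F] {p : ℕ} [Fact p.Prime] [CharP F p] (hp : (3 : F) = 0)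
    (A : CLabel F) (b b' : F × F) (u : Coord F)
    (h : ∀ g ∈ subTwo hp A, u * g * u⁻¹ ∈ subTwo hp A →
      phi p (formTwo A b (u * g * u⁻¹)) = phi p (formTwo A b' g)) : u ∈ subTwo hp A := by
  have key : ∀ (y : F → Coord F) (a : F)
      (_ : ∀ t, y t ∈ subTwo hp A ∧ u * y t * u⁻¹ ∈ subTwo hp A ∧ formTwo A b' (y t) = 0 ∧
        formTwo A b (u * y t * u⁻¹) = a * t), a = 0 := by
    intro y a hy
    refine eq_of_phi_mul_eq p fun t => ?_
    obtain ⟨h1, h2, h3, h4⟩ := hy t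
    rw [← h4, h _ h1 h2, h3, zero_mul]
  have mem : ∀ {g : Coord F}, g ∈ subOne F → g ∈ subTwo hp A := by
    rintro g ⟨h1, h6, h8, h9, h10, h12, h16⟩
    exact ⟨0, by simp [*]⟩
  have e7 := key (fun t => ⟨0, 0, 0, 0, 0, 0, 0, 0, t, 0, 0, 0, 0, 0, 0, 0, 0, 0, 0, 0⟩)
    (-(A.a17 * u.c8) - A.a18 * u.c10) fun t => by
      refine ⟨mem (by simp [subOne]), mem (by simp [Coord.conj_c7, subOne]), ?_⟩
      simp [Coord.conj_c7, formTwo, CLabel.form]; ring1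
  have e11 := key (fun t => ⟨0, 0, 0, 0, 0, 0, 0, 0, 0, t, 0, 0, 0, 0, 0, 0, 0, 0, 0, 0⟩)
    (A.a20 * u.c8 + A.a21 * u.c9) fun t => by
      refine ⟨mem (by simp [subOne]), mem (by simp [Coord.conj_c11, subOne]), ?_⟩
      simp [Coord.conj_c11, formTwo, CLabel.form]; ring1
  have e13 := key (fun t => ⟨0, 0, 0, 0, 0, 0, 0, 0, 0, 0, 0, t, 0, 0, 0, 0, 0, 0, 0, 0⟩)
    (A.a17 * u.c1 - A.a24 * u.c10) fun t => by
      refine ⟨mem (by simp [subOne]), mem (by simp [Coord.conj_c13, subOne]), ?_⟩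
      simp [Coord.conj_c13, formTwo, CLabel.form]; ring1
  have e14 := key (fun t => ⟨0, 0, 0, 0, 0, 0, 0, 0, 0, 0, 0, 0, t, 0, 0, 0, 0, 0, 0, 0⟩)
    (-(A.a20 * u.c6) - A.a24 * u.c9) fun t => by
      refine ⟨mem (by simp [subOne]), mem (by simp [Coord.conj_c14, subOne]), ?_⟩
      simp [Coord.conj_c14, formTwo, CLabel.form]; ring1
  have e15 := key (fun t => ⟨0, 0, 0, 0, 0, 0, 0, 0, 0, 0, 0, 0, 0, t, 0, 0, 0, 0, 0, 0⟩)
    (A.a18 * u.c1 - A.a21 * u.c6 - A.a24 * u.c8) fun t => by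
      refine ⟨mem (by simp [subOne]), mem (by simp [Coord.conj_c15, subOne]), ?_⟩
      simp [Coord.conj_c15, formTwo, CLabel.form]; ring1
  have e2 := key (fun t => ⟨0, t, 0, 0, 0, 0, 0, 0, 0, 0, 0, 0, 0, 0, 0, 0, 0, 0, 0, 0⟩)
    (-(A.a17 * (u.c1 * u.c9 + u.c12)) + A.a20 * (u.c10 * u.c6 - u.c16) + A.a24 * u.c10 * u.c9)
    fun t => by
      refine ⟨mem (by simp [subOne]), mem (by simp [Coord.conj_c2, subOne]), ?_⟩
      simp [Coord.conj_c2, formTwo, CLabel.form]; ring1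
  have e3 := key (fun t => ⟨0, 0, t, 0, 0, 0, 0, 0, 0, 0, 0, 0, 0, 0, 0, 0, 0, 0, 0, 0⟩)
    (-(A.a17 * u.c1 * u.c8) - A.a18 * u.c1 * u.c10 +
      A.a21 * (u.c10 * u.c6 - u.c16) + A.a24 * u.c10 * u.c8)
    fun t => by
      refine ⟨mem (by simp [subOne]), mem (by simp [Coord.conj_c3, subOne]), ?_⟩
      simp [Coord.conj_c3, formTwo, CLabel.form]; ring1
  have n17 := A.a17.ne_zero
  have n21 := A.a21.ne_zero
  obtain ⟨s, h1, h6, h8, h9, h10⟩ := A.exists_param hp e11 e13 e14 e15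
  rw [h1, h9, h10, h6] at e2
  rw [h1, h8, h10, h6] at e3
  have h16 : u.c16 = A.a17 * A.a18 * A.a21 * A.a24 * s ^ 2 := mul_left_cancel₀ n21 (by
    linear_combination -e3 - A.a17 * A.a18 * A.a21 ^ 2 * A.a24 * s ^ 2 * hp)
  have h12 : u.c12 = A.a18 * A.a20 * A.a21 * A.a24 * s ^ 2 := mul_left_cancel₀ n17 (by
    linear_combination -e2 - A.a20 * h16 - A.a17 * A.a18 * A.a20 * A.a21 * A.a24 * s ^ 2 * hp)
  exact ⟨s, h1, h6, h8, h9, h10, h12, h16⟩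

theorem zSub_le_subTwo (hp : (3 : F) = 0) (A : CLabel F) : Coord.zSub F ≤ subTwo hp A := by
  rintro z ⟨h1, h2, h3, h5, h6, h8, h9, h10, h7, h11, h12, h13, h14, h15, h16⟩
  exact ⟨0, by simp [*]⟩

theorem formTwo_injective [Fintype F] (p : ℕ) [Fact p.Prime] [CharP F p] (hp : (3 : F) = 0)
    (A : CLabel F) (b b' : F × F)
    (h : ∀ g ∈ subTwo hp A, phi p (formTwo A b g) = phi p (formTwo A b' g)) : b = b' := by
  have n17 := A.a17.ne_zero
  have n21 := A.a21.ne_zero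
  have n24 := A.a24.ne_zero
  refine Prod.ext (eq_of_phi_mul_eq p fun t => ?_) (eq_of_phi_mul_eq p fun t => ?_)
  · have h' := h ⟨A.a21 * A.a24 * t, 0, 0, 0, -(A.a18 * A.a24 * t), -(A.a18 * A.a21 * t),
      A.a18 * A.a20 * t, A.a17 * A.a21 * t, 0, 0, A.a18 * A.a20 * A.a21 * A.a24 * t ^ 2, 0, 0, 0,
      A.a17 * A.a18 * A.a21 * A.a24 * t ^ 2, 0, 0, 0, 0, 0⟩ ⟨t, rfl, rfl, rfl, rfl, rfl, rfl, rfl⟩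
    have e : ∀ b : F, b * (A.a21 * A.a24 : F)⁻¹ * (A.a21 * A.a24 * t) = b * t := fun b => by
      field_simp
    simp only [formTwo, CLabel.form, mul_zero, add_zero, e] at h'
    exact h'
  · have h' := h ⟨0, 0, 0, A.a17 * A.a21 * t, 0, 0, 0, 0, 0, 0, 0, 0, 0, 0, 0, 0, 0, 0, 0, 0⟩
      ⟨0, by simp⟩
    have e : ∀ b : F, b * (A.a17 * A.a21 : F)⁻¹ * (A.a17 * A.a21 * t) = b * t := fun b => by
      field_simp
    simp only [formTwo, CLabel.form, mul_zero, add_zero, zero_add, e] at h'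
    exact h'

/-- The characters of the second family for `p = 3`. -/
def familyTwo [Fintype F] (p : ℕ) [Fact p.Prime] [CharP F p] (hp : (3 : F) = 0) :
    MonomialFamily p F (F × F) where
  N := subTwo hp
  l := formTwo
  l_mul := by
    rintro A b g ⟨s, h1, h6, h8, h9, h10, h12, h16⟩ h ⟨r, k1, k6, k8, k9, k10, k12, k16⟩
    simp only [formTwo, CLabel.form, Coord.mul_c1, Coord.mul_c5, Coord.mul_c17, Coord.mul_c18,
      Coord.mul_c20, Coord.mul_c21, Coord.mul_c24, h1, h6, h8, h9, h10, h12, h16, k1, k6, k8, k9,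
      k10]
    -- All terms violating additivity have coefficients divisible by 3.
    linear_combination (-(A.a17 * A.a18 * A.a20 * A.a21 * A.a24 * s ^ 2 * h.c2) +
      A.a17 * A.a18 * A.a21 ^ 2 * A.a24 * s * r * h.c3 -
      A.a18 ^ 2 * A.a20 * A.a21 * A.a24 * s * r * h.c5 - A.a18 * A.a21 * A.a24 * r * g.c15) * hp
  zSub_le := zSub_le_subTwo hp
  l_zSub := by
    rintro A b z ⟨h1, h2, h3, h5, -⟩
    simp [formTwo, h1, h5]
  l_injective := formTwo_injective p hp
  mem_of_conj := mem_subTwo_of_conj hp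

theorem card_subTwo [Fintype F] (hp : (3 : F) = 0) (A : CLabel F) :
    Nat.card (subTwo hp A) = Fintype.card F ^ 14 := by
  have n21 := A.a21.ne_zero
  have n24 := A.a24.ne_zero
  exact card_eq_pow_of_equiv
    { toFun := fun g => ![g.1.c1 / (A.a21 * A.a24), g.1.c2, g.1.c3, g.1.c5, g.1.c7, g.1.c11,
        g.1.c13, g.1.c14, g.1.c15, g.1.c17, g.1.c18, g.1.c20, g.1.c21, g.1.c24]
      invFun := fun v => ⟨⟨A.a21 * A.a24 * v 0, v 1, v 2, v 3, -(A.a18 * A.a24 * v 0),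
        -(A.a18 * A.a21 * v 0), A.a18 * A.a20 * v 0, A.a17 * A.a21 * v 0, v 4, v 5,
        A.a18 * A.a20 * A.a21 * A.a24 * v 0 ^ 2, v 6, v 7, v 8,
        A.a17 * A.a18 * A.a21 * A.a24 * v 0 ^ 2, v 9, v 10, v 11, v 12, v 13⟩,
        v 0, rfl, rfl, rfl, rfl, rfl, rfl, rfl⟩
      left_inv := by
        rintro ⟨g, s, h1, h6, h8, h9, h10, h12, h16⟩
        ext <;> simp [h1, h6, h8, h9, h10, h12, h16]
      right_inv := fun v => by
        ext i
        fin_cases i <;> simp }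

theorem toCoord_xI (A : CLabel F) (t : F) : toCoord F (xI A t) =
    ⟨A.a21 * A.a24 * t, 0, 0, 0, -(A.a18 * A.a24 * t), -(A.a18 * A.a21 * t),
      A.a18 * A.a20 * t, A.a17 * A.a21 * t, 0, 0, A.a18 * A.a20 * A.a21 * A.a24 * t ^ 2, 0, 0, 0,
      A.a17 * A.a18 * A.a21 * A.a24 * t ^ 2, 0, 0, 0, 0, 0⟩ := by
  simp only [xI, map_mul, toCoord_xS1, toCoord_xS6, toCoord_xS8, toCoord_xS9, toCoord_xS10,
    toCoord_xS12, toCoord_xS16, Coord.mk_mul_mk, mul_zero, zero_mul, sub_zero, add_zero, zero_add,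
    neg_zero]

theorem isIndFrom_dataTwo_iff [Fintype F] (p : ℕ) [Fact p.Prime] [CharP F p] (hp : (3 : F) = 0)
    (A : CLabel F) (b b' : F) (χ : XS F → ℂ) :
    IsIndFrom p (dataTwo A b b') χ ↔ χ = (familyTwo p hp).char A (b, b') := by
  have n17 := A.a17.ne_zero
  have n21 := A.a21.ne_zero
  have n24 := A.a24.ne_zero
  have hI : ∀ t, xI A t ∈ (familyTwo p hp).sub A := fun t => by
    change toCoord F _ ∈ subTwo hp A
    rw [toCoord_xI]
    exact ⟨t, rfl, rfl, rfl, rfl, rfl, rfl, rfl⟩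
  refine isIndFrom_iff p ((familyTwo p hp).form_mul A (b, b')) ?_ ?_ ?_
  · intro d hd t
    simp only [dataTwo, dataZ, List.cons_append, List.nil_append, List.mem_cons, List.not_mem_nil,
      or_false] at hd
    rcases hd with rfl | rfl | rfl | rfl | rfl | rfl | rfl | rfl | rfl | rfl | rfl | rfl | rfl | rfl
    · exact hI t
    all_goals
      change toCoord F _ ∈ subTwo hp A
      refine ⟨0, ?_⟩
      simp [toCoord_x235]
  · intro d hd t
    change formTwo A (b, b') (toCoord F _) = _
    simp only [dataTwo, dataZ, List.cons_append, List.nil_append, List.mem_cons, List.not_mem_nil,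
      or_false] at hd
    rcases hd with rfl | rfl | rfl | rfl | rfl | rfl | rfl | rfl | rfl | rfl | rfl | rfl | rfl | rfl
    · rw [toCoord_xI]
      simp only [formTwo, CLabel.form]
      field_simp
      ring1
    · rw [toCoord_x235]
      simp only [formTwo, CLabel.form]
      field_simp
      ring1
    all_goals simp [formTwo, CLabel.form]
  · intro g hg
    have mem : ∀ d ∈ dataTwo A b b', ∀ t,
        d.1 t ∈ Subgroup.closure {g : XS F | ∃ d ∈ dataTwo A b b', ∃ t, g = d.1 t} :=
      fun d hd t => Subgroup.subset_closure ⟨d, hd, t, rfl⟩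
    generalize Subgroup.closure {g : XS F | ∃ d ∈ dataTwo A b b', ∃ t, g = d.1 t} = H at mem
    simp only [dataTwo, dataZ, List.cons_append, List.nil_append, List.forall_mem_cons,
      List.not_mem_nil, false_imp_iff, implies_true, and_true] at mem
    obtain ⟨m, m', m2, m3, m7, m11, m13, m14, m15, m17, m18, m20, m21, m24⟩ := mem
    -- X_2 and X_3 are among the generators, so they can be cancelled from x_{2,3,5}.
    have m5 : ∀ t, xS 5 t ∈ H := fun t => by
      have h := m' (t / (A.a17 * A.a21))
      have e : A.a17 * A.a21 * (t / (A.a17 * A.a21)) = t := by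
        field_simp
      rwa [x235, mul_mem_cancel_left (mul_mem (m2 _) (m3 _)), e] at h
    -- Multiplication by `xI A (-s)` brings the parameter to 0; the product then lies in `H`
    -- coordinate by coordinate.
    obtain ⟨s, h1, -⟩ := id hg
    have hg' := mul_mem (hI (-s)) hg
    obtain ⟨r, k1, k6, k8, k9, k10, k12, k16⟩ := id hg'
    rw [map_mul, toCoord_xI] at k1
    have hr : (A.a21 * A.a24 : F) * r = 0 := by
      rw [← k1, Coord.mul_c1, h1]
      ring1
    obtain rfl : r = 0 := by simpa using hr
    simp only [mul_zero, neg_zero, ne_eq, OfNat.ofNat_ne_zero, not_false_eq_true, zero_pow]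
      at k6 k8 k9 k10 k12 k16
    refine (mul_mem_cancel_left (m (-s))).mp (mem_of_xS_mem (xI A (-s) * g)
      (xS_mem_of_eq_zero ?_) (m2 _) (m3 _) (m5 _) (xS_mem_of_eq_zero k6)
      (xS_mem_of_eq_zero k8) (xS_mem_of_eq_zero k9) (xS_mem_of_eq_zero k10) (m7 _) (m11 _)
      (xS_mem_of_eq_zero k12) (m13 _) (m14 _) (m15 _) (xS_mem_of_eq_zero k16) (m17 _) (m18 _)
      (m20 _) (m21 _) (m24 _))
    rw [map_mul, toCoord_xI, k1, hr]

end FamilyTwo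

/-! ### Completeness of the families and assembly of the result. -/

section Main

variable {p : ℕ} [Fact p.Prime] {F : Type*} [Field F] [CharP F p]

theorem three_eq_zero_iff : (3 : F) = 0 ↔ p = 3 := by
  rw [show (3 : F) = ((3 : ℕ) : F) by norm_num, CharP.cast_eq_zero_iff F p,
    Nat.prime_dvd_prime_iff_eq Fact.out Nat.prime_three]

variable [Fintype F]

namespace MonomialFamily

variable {B : Type*} (D : MonomialFamily p F B)

theorem char_mem_irrOver (A : CLabel F) (β : B) : D.char A β ∈ core.IrrOver F coreZ :=
  mem_irrOver (D.char_mem_irr A β) A (D.char_apply_zSub A β)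

theorem exists_equiv {S : Set (XS F → ℂ)} (hS : ∀ χ, χ ∈ S ↔ ∃ A β, χ = D.char A β) :
    ∃ e : CLabel F × B ≃ S, ∀ x, (e x).1 = D.char x.1 x.2 := by
  refine ⟨Equiv.ofBijective (fun x => ⟨D.char x.1 x.2, (hS _).mpr ⟨_, _, rfl⟩⟩) ⟨?_, ?_⟩,
    fun x => rfl⟩
  · intro x y h
    exact D.char_injective (congrArg Subtype.val h)
  · rintro ⟨χ, hχ⟩
    obtain ⟨A, β, rfl⟩ := (hS χ).mp hχ
    exact ⟨(A, β), rfl⟩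

end MonomialFamily

variable (F) in
theorem card_pow_seven_ne : (Fintype.card F : ℂ) ^ 7 ≠ (Fintype.card F : ℂ) ^ 6 := by
  norm_cast
  exact (Nat.pow_lt_pow_right Fintype.one_lt_card (by norm_num)).ne'

/-- Over each label the squares of the degrees add up to q · (q^7)² = q^15, the index of X_Z. -/
theorem exists_char_familyNe3 (hp : (3 : F) ≠ 0) {χ : XS F → ℂ} (hχ : χ ∈ core.IrrOver F coreZ) :
    ∃ A b, χ = (familyNe3 p hp).char A b := by
  obtain ⟨A, hA⟩ := exists_label p hχ
  let _ := Fintype.ofFinite (XS F)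
  obtain ⟨b, hb⟩ := mem_range_of_sum_sq (zSub F) (A.char p) (fun b => (familyNe3 p hp).char A b)
    (fun b b' h => by
      have := (familyNe3 p hp).char_injective (a₁ := (A, b)) (a₂ := (A, b')) h
      exact (Prod.ext_iff.mp this).2)
    (fun b => (familyNe3 p hp).char_mem_irr A b) (fun b => (familyNe3 p hp).char_apply_zSub A b)
    (fun b => (familyNe3 p hp).char_inv A b)
    (by
      simp only [(familyNe3 p hp).char_one A _ (by norm_num) (card_subNe3 A), Finset.sum_const,
        Finset.card_univ, nsmul_eq_mul, card_zSub, card_XS]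
      push_cast
      ring1) hχ.1 hA
  exact ⟨A, b, hb.symm⟩

/-- Over each label (q - 1)(q^7)² + q²(q^6)² = q^15, the index of X_Z; the degrees keep the two
families apart. -/
theorem exists_char_familyOne_or_familyTwo (hp : (3 : F) = 0) {χ : XS F → ℂ} (hχ : χ ∈ core.IrrOver F coreZ) :
    (∃ A c, χ = (familyOne p hp).char A c) ∨ ∃ A b, χ = (familyTwo p hp).char A b := by
  obtain ⟨A, hA⟩ := exists_label p hχ
  let _ := Fintype.ofFinite (XS F)
  classical
  let D := familyOne p hp
  let E := familyTwo p hp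
  have hD : ∀ c, D.char A c 1 = (Fintype.card F : ℂ) ^ 7 := fun c =>
    D.char_one A c (by norm_num) (card_subOne F)
  have hE : ∀ b, E.char A b 1 = (Fintype.card F : ℂ) ^ 6 := fun b =>
    E.char_one A b (by norm_num) (card_subTwo hp A)
  obtain ⟨i, hi⟩ := mem_range_of_sum_sq (zSub F) (A.char p)
    (Sum.elim (fun c => D.char A c) fun b => E.char A b)
    (by
      refine Function.Injective.sumElim (fun c c' h => ?_) (fun b b' h => ?_) fun c b h => ?_
      · exact (Prod.ext_iff.mp (D.char_injective (a₁ := (A, c)) (a₂ := (A, c')) h)).2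
      · exact (Prod.ext_iff.mp (E.char_injective (a₁ := (A, b)) (a₂ := (A, b')) h)).2
      · exact card_pow_seven_ne F (by rw [← hD c, ← hE b, h]))
    (by
      rintro (c | b)
      exacts [D.char_mem_irr A c, E.char_mem_irr A b])
    (by
      rintro (c | b)
      exacts [D.char_apply_zSub A c, E.char_apply_zSub A b])
    (by
      rintro (c | b)
      exacts [D.char_inv A c, E.char_inv A b])
    (by
      simp only [Fintype.sum_sum_type, Sum.elim_inl, Sum.elim_inr, hD, hE, Finset.sum_const,
        Finset.card_univ, nsmul_eq_mul, card_zSub, card_XS, Fintype.card_prod, Fintype.card_units]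
      rw [Nat.cast_sub Fintype.card_pos]
      push_cast
      ring1) hχ.1 hA
  rcases i with c | b
  exacts [Or.inl ⟨A, c, hi.symm⟩, Or.inr ⟨A, b, hi.symm⟩]

theorem mem_famNe3_iff (hp : (3 : F) ≠ 0) (χ : XS F → ℂ) :
    χ ∈ famNe3 p F ↔ ∃ A b, χ = (familyNe3 p hp).char A b :=
  exists_congr fun A => exists_congr fun b => isIndFrom_dataNe3_iff p hp A b χ

theorem mem_famOne_iff (hp : (3 : F) = 0) (χ : XS F → ℂ) :
    χ ∈ famOne p F ↔ ∃ A c, χ = (familyOne p hp).char A c :=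
  exists_congr fun A => exists_congr fun c => isIndFrom_dataOne_iff p hp A c χ

theorem mem_famTwo_iff (hp : (3 : F) = 0) (χ : XS F → ℂ) :
    χ ∈ famTwo p F ↔ ∃ A b, χ = (familyTwo p hp).char A b := by
  rw [famTwo, Set.mem_ofPred_eq]
  simp only [Prod.exists, isIndFrom_dataTwo_iff p hp]

theorem famOne_apply_one (hp : (3 : F) = 0) {χ : XS F → ℂ} (hχ : χ ∈ famOne p F) :
    χ 1 = (Fintype.card F : ℂ) ^ 7 := by
  obtain ⟨A, c, rfl⟩ := (mem_famOne_iff hp χ).mp hχ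
  exact (familyOne p hp).char_one A c (by norm_num) (card_subOne F)

theorem famTwo_apply_one (hp : (3 : F) = 0) {χ : XS F → ℂ} (hχ : χ ∈ famTwo p F) :
    χ 1 = (Fintype.card F : ℂ) ^ 6 := by
  obtain ⟨A, b, rfl⟩ := (mem_famTwo_iff hp χ).mp hχ
  exact (familyTwo p hp).char_one A b (by norm_num) (card_subTwo hp A)

end Main

end UE6

end

theorem proposition5p4 (p : ℕ) [Fact p.Prime] (F : Type*) [Field F] [Fintype F] [CharP F p] :
    (p ≠ 3 →
      UE6.core.IrrOver F UE6.coreZ = UE6.famNe3 p F ∧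
      (∀ χ ∈ UE6.famNe3 p F, χ 1 = (Fintype.card F : ℂ) ^ 7) ∧
      (UE6.famNe3 p F).ncard = Fintype.card F * (Fintype.card F - 1) ^ 5 ∧
      (∃ e : UE6.CLabel F × F ≃ UE6.famNe3 p F,
        ∀ A b, UE6.IsIndFrom p (UE6.dataNe3 A b) (e (A, b)).1)) ∧
    (p = 3 →
      UE6.core.IrrOver F UE6.coreZ = UE6.famOne p F ∪ UE6.famTwo p F ∧
      Disjoint (UE6.famOne p F) (UE6.famTwo p F) ∧
      (∀ χ ∈ UE6.famOne p F, χ 1 = (Fintype.card F : ℂ) ^ 7) ∧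
      (UE6.famOne p F).ncard = (Fintype.card F - 1) ^ 6 ∧
      (∃ e : UE6.CLabel F × Fˣ ≃ UE6.famOne p F,
        ∀ A c, UE6.IsIndFrom p (UE6.dataOne A c) (e (A, c)).1) ∧
      (∀ χ ∈ UE6.famTwo p F, χ 1 = (Fintype.card F : ℂ) ^ 6) ∧
      (UE6.famTwo p F).ncard = Fintype.card F ^ 2 * (Fintype.card F - 1) ^ 5 ∧
      (∃ e : UE6.CLabel F × F × F ≃ UE6.famTwo p F,
        ∀ A b b', UE6.IsIndFrom p (UE6.dataTwo A b b') (e (A, b, b')).1)) := by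
  have card : Nat.card (UE6.CLabel F) = (Fintype.card F - 1) ^ 5 := UE6.card_CLabel
  refine ⟨fun h3 => ?_, fun h3 => ?_⟩
  · have hp : (3 : F) ≠ 0 := fun h => h3 (UE6.three_eq_zero_iff.mp h)
    have hmem := UE6.mem_famNe3_iff (p := p) hp
    obtain ⟨e, he⟩ := (UE6.familyNe3 p hp).exists_equiv hmem
    refine ⟨?_, ?_, ?_, e, fun A b => ?_⟩
    · ext χ
      rw [hmem]
      refine ⟨UE6.exists_char_familyNe3 hp, ?_⟩
      rintro ⟨A, b, rfl⟩
      exact (UE6.familyNe3 p hp).char_mem_irrOver A b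
    · intro χ hχ
      obtain ⟨A, b, rfl⟩ := (hmem χ).mp hχ
      exact (UE6.familyNe3 p hp).char_one A b (by norm_num) (UE6.card_subNe3 A)
    · rw [← Nat.card_coe_set_eq, ← Nat.card_congr e, Nat.card_prod, card,
        Nat.card_eq_fintype_card, mul_comm]
    · exact (UE6.isIndFrom_dataNe3_iff p hp A b _).mpr (he (A, b))
  · have hp : (3 : F) = 0 := UE6.three_eq_zero_iff.mpr h3
    have hmem := UE6.mem_famOne_iff (p := p) hp
    have hmem' := UE6.mem_famTwo_iff (p := p) hp
    obtain ⟨e, he⟩ := (UE6.familyOne p hp).exists_equiv hmem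
    obtain ⟨e', he'⟩ := (UE6.familyTwo p hp).exists_equiv hmem'
    refine ⟨?_, ?_, fun χ => UE6.famOne_apply_one hp, ?_, ⟨e, fun A c => ?_⟩,
      fun χ => UE6.famTwo_apply_one hp, ?_, e', fun A b b' => ?_⟩
    · ext χ
      rw [Set.mem_union, hmem, hmem']
      refine ⟨UE6.exists_char_familyOne_or_familyTwo hp, ?_⟩
      rintro (⟨A, c, rfl⟩ | ⟨A, b, rfl⟩)
      exacts [(UE6.familyOne p hp).char_mem_irrOver A c, (UE6.familyTwo p hp).char_mem_irrOver A b]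
    · refine Set.disjoint_left.mpr fun χ h h' => UE6.card_pow_seven_ne F ?_
      rw [← UE6.famOne_apply_one hp h, UE6.famTwo_apply_one hp h']
    · rw [← Nat.card_coe_set_eq, ← Nat.card_congr e, Nat.card_prod, card, Nat.card_units,
        Nat.card_eq_fintype_card, ← pow_succ]
    · exact (UE6.isIndFrom_dataOne_iff p hp A c _).mpr (he (A, c))
    · rw [← Nat.card_coe_set_eq, ← Nat.card_congr e', Nat.card_prod, card, Nat.card_prod,
        Nat.card_eq_fintype_card, ← sq, mul_comm]
    · exact (UE6.isIndFrom_dataTwo_iff p hp A b b' _).mpr (he' (A, b, b'))
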